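/- Let $k$ be an algebraically closed field of characteristic $0$ and let $p$ be a prime number. A \emph{braided pair} is a pair $(V,c)$ of a $k$-vector space $V$ and a linear automorphism $c$ of $V\otimes V$ satisfying the braid equation $(c\otimes\mathrm{id})(\mathrm{id}\otimes c)(c\otimes\mathrm{id})=(\mathrm{id}\otimes c)(c\otimes\mathrm{id})(\mathrm{id}\otimes c)$. It is of \emph{finite group type} if there are a basis $x_1,\dots,x_n$ of $V$ and $g_1,\dots,g_n\in GL(V)$ with $c(x_i\otimes x_j)=g_i(x_j)\otimes x_i$ for all $i,j$, such that the group $\Gamma\subseteq GL(V)$ generated by the $g_i$ is finite; it is of \emph{diagonal group type} if there are such a basis and such $g_i$ for which $\Gamma$ acts diagonally on $V$ (equivalently, if there are a basis $x_1,\dots,x_n$ of $V$ and a matrix $(q_{ij})$ with entries in $k^\times$ such that $c(x_i\otimes x_j)=q_{ij}\,x_j\otimes x_i$; then we say that $(V,c)$ has the basis $(x_i)$ and the matrix $(q_{ij})$). Let the braid group on $n$ strands act on $V^{\otimes n}$, with $\sigma_i$ acting by $c$ at the places $i,i+1$, and let $\mathfrak S^n=\sum_{x\in S_n}s(x)$,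 where $s(x)=\sigma_{i_1}\cdots\sigma_{i_l}$ if $x=\tau_{i_1}\cdots\tau_{i_l}$ is a reduced expression of $x$ in the transpositions $\tau_i=(i\ \,i+1)$. The \emph{Nichols algebra} $\mathfrak B(V)$ is the image of $\mathfrak S=\bigoplus_n\mathfrak S^n$ on $T(V)=\bigoplus_nV^{\otimes n}$, with the product for which $\mathfrak S:T(V)\to\mathfrak B(V)$ is a morphism of algebras. The \emph{Nichols rank} of $(V,c)$ is $\dim\mathfrak B(V)$. For $q\in k^\times$ let $N(q)$ be the order of $q$ if $q\ne1$ is a root of unity, and $N(q)=\infty$ otherwise. If $(V,c)$ has the basis $(x_i)$ and the matrix $(q_{ij})$, then $\mathfrak B(V)$ is a \emph{quantum linear space} if $q_{ij}q_{ji}=1$ for all $i\ne j$. The \emph{generalized Cartan matrix} is given by $a_{ii}=2$ and $a_{ij}=1-d_{ij}$ for $i\neq j$, where $d_{ij}$ is the least $d$ such that $(\mathrm{Ad}_{x_i})^d(x_j)=0$ in $\mathfrak B(V)$ and $\mathrm{Ad}_{x}(y)=xy-m(c(x\otimes y))$, with $m$ the multiplication and $c$ extended to $V\otimes V^{\otimes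 n}\to V^{\otimes n}\otimes V$ by $\sigma_n\cdots\sigma_1$; \emph{type $A_2$} means that this matrix is $\begin{pmatrix}2&-1\\-1&2\end{pmatrix}$. \textbf{Theorem.} Let $(V,c)$ be a braided pair of finite group type with Nichols rank $p^3$. Then $(V,c)$ is of diagonal group type, and it has a basis $(x_i)$ and a matrix $(q_{ij})$ as in one of the following cases: \begin{enumerate} \item $\dim V=3$, $\mathfrak B(V)$ is a quantum linear space, and $N(q_{11})=N(q_{22})=N(q_{33})=p$; \item $\dim V=2$, $\mathfrak B(V)$ is a quantum linear space, $N(q_{11})=p$ and $N(q_{22})=p^2$; \item $\dim V=2$, $(V,c)$ is of type $A_2$, $q_{11}=q_{22}=(q_{12}q_{21})^{-1}$ and $N(q_{11})=p$; \item $\dim V=1$, $N(q_{11})=p^3$, and $\mathfrak B(V)\cong k[x]/(x^{p^3})$ as algebras, with $x_1\mapsto x$. \end{enumerate} -/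

import Mathlib

open scoped TensorProduct DirectSum Polynomial

namespace NicholsAlg

/-! ### Permutations and reduced words -/

/-- The transposition `τ_i = (i  i+1)` of `{0, …, n-1}`, for `i + 1 < n`
(the generators are numbered from `0`). -/
def adjTransposition (n i : ℕ) : Equiv.Perm (Fin n) :=
  if h : i + 1 < n then Equiv.swap ⟨i, Nat.lt_of_succ_lt h⟩ ⟨i + 1, h⟩ else 1

/-- The number of values `u < m` which stand to the right of the value `m` in
the sequence `x 0, x 1, …, x (n-1)`. -/
def lehmer {n : ℕ} (x : Equiv.Perm (Fin n)) (m : Fin n) : ℕ :=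
  (Finset.univ.filter fun u : Fin n => u < m ∧ x.symm m < x.symm u).card

/-- A reduced word `[i₁, …, i_l]` of the permutation `x`: it satisfies
`x = τ_{i₁} ⋯ τ_{i_l}` and `l` is the least possible number of factors.  It is the
concatenation, over the values `m = 0, …, n-1`, of the descending runs
`m-1, m-2, …, m - lehmer x m`.  See `reducedWord_prod` and `reducedWord_length_le`. -/
def reducedWord {n : ℕ} (x : Equiv.Perm (Fin n)) : List ℕ :=
  (List.finRange n).flatMap fun m => (List.range (lehmer x m)).map fun t => (m : ℕ) - 1 - t

theorem adjTransposition_val {n i : ℕ} (hi : i + 1 < n) (a : Fin n) :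
    (adjTransposition n i a : ℕ) =
      if (a : ℕ) = i then i + 1 else if (a : ℕ) = i + 1 then i else a := by
  simp only [adjTransposition, hi, dite_true, Equiv.swap_apply_def, Fin.ext_iff]
  split_ifs <;> simp_all

theorem run_val {n m : ℕ} (hm : m < n) (e : ℕ) (he : e ≤ m) (a : Fin n) :
    (((((List.range e).map fun t => m - 1 - t).map (adjTransposition n)).prod a : Fin n) : ℕ) =
      if (a : ℕ) = m - e then m else if m - e < (a : ℕ) ∧ (a : ℕ) ≤ m then (a : ℕ) - 1 else a := by
  induction e generalizing a with
  | zero => simp; split_ifs <;> omega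
  | succ e ih =>
    rw [List.range_succ, List.map_append, List.map_append, List.prod_append]
    simp only [List.map_cons, List.map_nil, List.prod_singleton, Equiv.Perm.mul_apply]
    rw [ih (by omega), adjTransposition_val (by omega)]
    split_ifs <;> omega

/-- The number of values `u < m` which stand to the left of the value `v`. -/
def rankBelow {n : ℕ} (x : Equiv.Perm (Fin n)) (m : ℕ) (v : Fin n) : ℕ :=
  (Finset.univ.filter fun u : Fin n => (u : ℕ) < m ∧ x.symm u < x.symm v).card

theorem lehmer_add_rankBelow {n : ℕ} (x : Equiv.Perm (Fin n)) (m : Fin n) :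
    lehmer x m + rankBelow x m m = m := by
  have h : Disjoint (Finset.univ.filter fun u : Fin n => u < m ∧ x.symm m < x.symm u)
      (Finset.univ.filter fun u : Fin n => (u : ℕ) < m ∧ x.symm u < x.symm m) := by
    rw [Finset.disjoint_left]
    intro u hu hu'
    simp only [Finset.mem_filter, Finset.mem_univ, true_and] at hu hu'
    exact lt_asymm hu.2 hu'.2
  rw [lehmer, rankBelow, ← Finset.card_union_of_disjoint h]
  have : (Finset.univ.filter fun u : Fin n => u < m ∧ x.symm m < x.symm u) ∪
      (Finset.univ.filter fun u : Fin n => (u : ℕ) < m ∧ x.symm u < x.symm m) =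
      Finset.Iio m := by
    ext u
    simp only [Finset.mem_union, Finset.mem_filter, Finset.mem_univ, true_and, Finset.mem_Iio,
      Fin.val_fin_lt]
    constructor
    · rintro (h | h) <;> exact h.1
    · intro h
      rcases lt_trichotomy (x.symm m) (x.symm u) with h' | h' | h'
      · exact Or.inl ⟨h, h'⟩
      · exact absurd (x.symm.injective h') (ne_of_gt h)
      · exact Or.inr ⟨h, h'⟩
  rw [this, Fin.card_Iio]

theorem lehmer_le {n : ℕ} (x : Equiv.Perm (Fin n)) (m : Fin n) : lehmer x m ≤ m := by
  have := lehmer_add_rankBelow x m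
  omega

theorem rankBelow_succ {n : ℕ} (x : Equiv.Perm (Fin n)) (m v : Fin n) :
    rankBelow x (m + 1) v = rankBelow x m v + if x.symm m < x.symm v then 1 else 0 := by
  have h : (Finset.univ.filter fun u : Fin n => (u : ℕ) < m + 1 ∧ x.symm u < x.symm v) =
      (Finset.univ.filter fun u : Fin n => (u : ℕ) < m ∧ x.symm u < x.symm v) ∪
        (if x.symm m < x.symm v then {m} else ∅) := by
    ext u
    by_cases hum : u = m
    · subst hum
      by_cases hv : x.symm u < x.symm v <;> simp [hv]
    · have h1 : (u : ℕ) ≠ m := fun h => hum (Fin.ext h)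
      have h2 : (u : ℕ) < m + 1 ↔ (u : ℕ) < m := by omega
      split_ifs <;> simp only [Finset.mem_union, Finset.mem_filter, Finset.mem_univ, true_and, h2,
        Finset.mem_singleton, hum, Finset.notMem_empty, or_false]
  rw [rankBelow, rankBelow, h, Finset.card_union_of_disjoint]
  · split_ifs <;> simp
  · split_ifs <;> simp

theorem rankBelow_lt {n : ℕ} (x : Equiv.Perm (Fin n)) (m : ℕ) (v : Fin n) (hv : (v : ℕ) < m) :
    rankBelow x m v < m := by
  have hmem : v ∈ Finset.univ.filter fun u : Fin n => (u : ℕ) < m := by simp [hv]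
  have hcard : (Finset.univ.filter fun u : Fin n => (u : ℕ) < m).card ≤ m := by
    have := Finset.card_le_card_of_injOn (s := Finset.univ.filter fun u : Fin n => (u : ℕ) < m)
      (t := Finset.range m) (fun u => (u : ℕ)) (fun u hu => by simpa using hu)
      (fun a _ b _ h => Fin.ext h)
    simpa using this
  refine lt_of_lt_of_le (Finset.card_lt_card ?_) hcard
  rw [Finset.ssubset_iff_of_subset (fun u hu => by
    simp only [Finset.mem_filter, Finset.mem_univ, true_and] at hu ⊢; exact hu.1)]
  exact ⟨v, hmem, by simp⟩

theorem rankBelow_mono {n : ℕ} (x : Equiv.Perm (Fin n)) (m : ℕ) {u v : Fin n}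
    (h : x.symm u < x.symm v) : rankBelow x m u ≤ rankBelow x m v := by
  refine Finset.card_le_card fun a ha => ?_
  simp only [Finset.mem_filter, Finset.mem_univ, true_and] at ha ⊢
  exact ⟨ha.1, ha.2.trans h⟩

theorem rankBelow_lt_rankBelow {n : ℕ} (x : Equiv.Perm (Fin n)) (m : ℕ) {u v : Fin n}
    (hu : (u : ℕ) < m) (h : x.symm u < x.symm v) : rankBelow x m u < rankBelow x m v := by
  refine Finset.card_lt_card ?_
  rw [Finset.ssubset_iff_of_subset (fun a ha => by
    simp only [Finset.mem_filter, Finset.mem_univ, true_and] at ha ⊢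
    exact ⟨ha.1, ha.2.trans h⟩)]
  exact ⟨u, by simp [hu, h], by simp⟩

theorem partialWord_apply {n : ℕ} (x : Equiv.Perm (Fin n)) (m : ℕ) (hm : m ≤ n) (v a : Fin n)
    (ha : (a : ℕ) = if (v : ℕ) < m then rankBelow x m v else v) :
    ((((List.finRange n).take m).flatMap fun m => (List.range (lehmer x m)).map
      fun t => (m : ℕ) - 1 - t).map (adjTransposition n)).prod a = v := by
  induction m generalizing a with
  | zero => simpa [Fin.ext_iff] using ha
  | succ m ih =>
    have hmn : m < n := hm
    rw [List.take_succ_eq_append_getElem (by simpa using hmn)]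
    rw [List.flatMap_append, List.map_append, List.prod_append, Equiv.Perm.mul_apply]
    apply ih (by omega)
    simp only [List.getElem_finRange, List.flatMap_cons, List.flatMap_nil, List.append_nil]
    rw [run_val (by simpa using hmn) _ (by exact lehmer_le x _)]
    set M : Fin n := ⟨m, hmn⟩ with hM
    have e1 : Fin.cast (by simp) (⟨m, by simpa using hmn⟩ : Fin (List.finRange n).length) = M := rfl
    have h1 := lehmer_add_rankBelow x M
    have hMv : (M : ℕ) = m := rfl
    simp only [e1, hMv] at h1 ⊢
    have h2 := rankBelow_succ x M v
    simp only [hMv] at h2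
    rcases lt_trichotomy (v : ℕ) m with hv | hv | hv
    · have hlt := rankBelow_lt x m v hv
      rw [if_pos (by omega)] at ha
      rw [if_pos hv]
      by_cases hw : x.symm M < x.symm v
      · have := rankBelow_mono x m hw
        rw [if_pos hw] at h2
        split_ifs <;> omega
      · have hne : x.symm v ≠ x.symm M := fun h => by
          have := x.symm.injective h
          rw [this] at hv
          omega
        have hw' : x.symm v < x.symm M := lt_of_le_of_ne (not_lt.mp hw) hne
        have := rankBelow_lt_rankBelow x m hv hw'
        rw [if_neg hw] at h2
        split_ifs <;> omega
    · have hvM : v = M := Fin.ext hv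
      rw [if_pos (by omega), h2, hvM] at ha
      simp only [lt_irrefl, if_false] at ha
      rw [if_pos (by omega), if_neg (by omega)]
      exact hv.symm
    · rw [if_neg (by omega)] at ha
      rw [if_neg (by omega : ¬ (v : ℕ) < m)]
      split_ifs <;> omega

theorem reducedWord_prod {n : ℕ} (x : Equiv.Perm (Fin n)) :
    ((reducedWord x).map (adjTransposition n)).prod = x := by
  ext a
  have h := partialWord_apply x n le_rfl (x a) a (by
    rw [if_pos (x a).2, rankBelow]
    simp only [Fin.is_lt, true_and, Equiv.symm_apply_apply]
    have : (Finset.univ.filter fun u : Fin n => x.symm u < a) = (Finset.Iio a).map x.toEmbedding := by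
      ext u
      simp
    rw [this, Finset.card_map, Fin.card_Iio])
  rw [List.take_of_length_le (by simp)] at h
  rw [reducedWord, h]

theorem reducedWord_letter {n : ℕ} (x : Equiv.Perm (Fin n)) {i : ℕ}
    (hi : i ∈ reducedWord x) : i + 1 < n := by
  simp only [reducedWord, List.mem_flatMap, List.mem_finRange, List.mem_map, List.mem_range,
    true_and] at hi
  obtain ⟨m, t, ht, rfl⟩ := hi
  have := lehmer_le x m
  have := m.2
  omega

/-- The inversions of `x`, as pairs of values. -/
def inversions {n : ℕ} (x : Equiv.Perm (Fin n)) : Finset (Fin n × Fin n) :=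
  Finset.univ.filter fun a => a.1 < a.2 ∧ x.symm a.2 < x.symm a.1

theorem reducedWord_length {n : ℕ} (x : Equiv.Perm (Fin n)) :
    (reducedWord x).length = (inversions x).card := by
  have h1 : (reducedWord x).length = ∑ m : Fin n, lehmer x m := by
    rw [reducedWord, List.length_flatMap, ← List.sum_ofFn, List.ofFn_eq_map]
    simp
  rw [h1, inversions, Finset.card_filter, Fintype.sum_prod_type, Finset.sum_comm]
  refine Finset.sum_congr rfl fun m _ => ?_
  rw [lehmer, Finset.card_filter]

theorem inversions_mul_le {n : ℕ} (i : ℕ) (y : Equiv.Perm (Fin n)) :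
    (inversions (adjTransposition n i * y)).card ≤ (inversions y).card + 1 := by
  by_cases hi : i + 1 < n
  · set τ := adjTransposition n i with hτ
    have hττ : ∀ a, τ (τ a) = a := fun a => by
      rw [hτ, adjTransposition, dif_pos hi]; simp
    have hsymm : ∀ a, (τ * y).symm a = y.symm (τ a) := fun a => by
      rw [Equiv.symm_apply_eq, Equiv.Perm.mul_apply, Equiv.apply_symm_apply, hττ]
    have hsub : inversions (τ * y) ⊆
        insert ((⟨i, by omega⟩ : Fin n), (⟨i + 1, hi⟩ : Fin n))
          ((inversions y).image fun a => (τ a.1, τ a.2)) := by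
      rintro ⟨u, m⟩ h
      simp only [inversions, Finset.mem_filter, Finset.mem_univ, true_and, hsymm] at h
      rw [Finset.mem_insert]
      by_cases hum : (u : ℕ) = i ∧ (m : ℕ) = i + 1
      · left
        exact Prod.ext (Fin.ext hum.1) (Fin.ext hum.2)
      · right
        rw [Finset.mem_image]
        refine ⟨(τ u, τ m), ?_, by simp [hττ]⟩
        simp only [inversions, Finset.mem_filter, Finset.mem_univ, true_and]
        refine ⟨?_, h.2⟩
        have h1 : (u : ℕ) < m := h.1
        rw [Fin.lt_def, hτ, adjTransposition_val hi, adjTransposition_val hi]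
        split_ifs <;> omega
    calc _ ≤ _ := Finset.card_le_card hsub
      _ ≤ _ := Finset.card_insert_le _ _
      _ ≤ _ := Nat.add_le_add_right Finset.card_image_le 1
  · simp [adjTransposition, hi]

theorem reducedWord_length_le {n : ℕ} (x : Equiv.Perm (Fin n)) (l : List ℕ)
    (hl : (l.map (adjTransposition n)).prod = x) : (reducedWord x).length ≤ l.length := by
  rw [reducedWord_length]
  induction l generalizing x with
  | nil =>
    subst hl
    simp only [inversions, List.map_nil, List.prod_nil, List.length_nil, Nat.le_zero,
      Finset.card_eq_zero, Finset.filter_eq_empty_iff]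
    rintro ⟨a, b⟩ - ⟨h, h'⟩
    exact lt_asymm h h'
  | cons i l ih =>
    subst hl
    rw [List.map_cons, List.prod_cons, List.length_cons]
    exact (inversions_mul_le i _).trans (Nat.add_le_add_right (ih _ rfl) 1)

section Braidings

variable {k : Type*} [Field k] {V : Type*} [AddCommGroup V] [Module k V]

/-! ### Braided pairs -/

/-- The braid equation `(c ⊗ id)(id ⊗ c)(c ⊗ id) = (id ⊗ c)(c ⊗ id)(id ⊗ c)` on `V ⊗ V ⊗ V`.
A braided pair is a pair `(V, c)` with `c` a linear automorphism of `V ⊗ V` which satisfies it. -/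
def BraidEquation (c : V ⊗[k] V ≃ₗ[k] V ⊗[k] V) : Prop :=
  let c₁ : (V ⊗[k] V) ⊗[k] V →ₗ[k] (V ⊗[k] V) ⊗[k] V := c.toLinearMap.rTensor V
  let a : (V ⊗[k] V) ⊗[k] V ≃ₗ[k] V ⊗[k] (V ⊗[k] V) := TensorProduct.assoc k V V V
  let c₂ : (V ⊗[k] V) ⊗[k] V →ₗ[k] (V ⊗[k] V) ⊗[k] V :=
    a.symm.toLinearMap ∘ₗ c.toLinearMap.lTensor V ∘ₗ a.toLinearMap
  c₁ ∘ₗ c₂ ∘ₗ c₁ = c₂ ∘ₗ c₁ ∘ₗ c₂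

/-- `x₁, …, x_n` is a braided basis with associated group-likes `g₁, …, g_n ∈ GL(V)`:
`c (x_i ⊗ x_j) = g_i (x_j) ⊗ x_i`. -/
def IsBraidedBasis (c : V ⊗[k] V ≃ₗ[k] V ⊗[k] V) {n : ℕ} (x : Module.Basis (Fin n) k V)
    (g : Fin n → (V ≃ₗ[k] V)) : Prop :=
  ∀ i j, c (x i ⊗ₜ[k] x j) = g i (x j) ⊗ₜ[k] x i

/-- Group type, with `Γ = ⟨g₁, …, g_n⟩ ⊆ GL(V)` finite. -/
def IsOfFiniteGroupType (c : V ⊗[k] V ≃ₗ[k] V ⊗[k] V) : Prop :=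
  ∃ (n : ℕ) (x : Module.Basis (Fin n) k V) (g : Fin n → (V ≃ₗ[k] V)),
    IsBraidedBasis c x g ∧ Finite (Subgroup.closure (Set.range g))

/-- Group type, with `Γ = ⟨g₁, …, g_n⟩ ⊆ GL(V)` acting diagonally on `V`. -/
def IsOfDiagonalGroupType (c : V ⊗[k] V ≃ₗ[k] V ⊗[k] V) : Prop :=
  ∃ (n : ℕ) (x : Module.Basis (Fin n) k V) (g : Fin n → (V ≃ₗ[k] V)),
    IsBraidedBasis c x g ∧
    ∃ e : Module.Basis (Fin n) k V, ∀ γ ∈ Subgroup.closure (Set.range g), ∀ j,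
      ∃ a : k, γ (e j) = a • e j

/-- `(V, c)` has the basis `x₁, …, x_n` and the matrix `(q_ij)`:
`c (x_i ⊗ x_j) = q_ij x_j ⊗ x_i`. -/
def HasDiagonalBraiding (c : V ⊗[k] V ≃ₗ[k] V ⊗[k] V) {n : ℕ} (x : Module.Basis (Fin n) k V)
    (q : Fin n → Fin n → kˣ) : Prop :=
  ∀ i j, c (x i ⊗ₜ[k] x j) = (q i j : k) • (x j ⊗ₜ[k] x i)

/-- The condition on the matrix of `(V, c)` for the Nichols algebra to be a
quantum linear space. -/
def IsQLSMatrix {n : ℕ} (q : Fin n → Fin n → kˣ) : Prop :=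
  ∀ i j, i ≠ j → q i j * q j i = 1

open Classical in
/-- `N(q)`: the order of `q` if `q ≠ 1` is a root of unity, and `∞` otherwise. -/
noncomputable def N (q : kˣ) : ℕ∞ :=
  if q = 1 ∨ ¬ IsOfFinOrder q then ⊤ else (orderOf q : ℕ∞)

/-! ### The action of the braid group on tensor powers -/

/-- The linear map `a ⊗ b ↦ v_0 ⊗ ⋯ ⊗ a ⊗ ⋯ ⊗ b ⊗ ⋯ ⊗ v_{n-1}`, with `a` and `b` put at the
places `i` and `j`. -/
noncomputable def insertTwo {n : ℕ} (i j : Fin n) (hij : i ≠ j) (v : Fin n → V) :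
    V ⊗[k] V →ₗ[k] ⨂[k]^n V :=
  TensorProduct.lift
    (LinearMap.mk₂ k
      (fun a b => PiTensorProduct.tprod k (Function.update (Function.update v i a) j b))
      (fun a a' b => by
        simp only [Function.update_comm hij]
        exact (PiTensorProduct.tprod k).map_update_add _ _ _ _)
      (fun r a b => by
        simp only [Function.update_comm hij]
        exact (PiTensorProduct.tprod k).map_update_smul _ _ _ _)
      (fun a b b' => (PiTensorProduct.tprod k).map_update_add _ _ _ _)
      (fun r a b => (PiTensorProduct.tprod k).map_update_smul _ _ _ _))

theorem insertTwo_tmul {n : ℕ} (i j : Fin n) (hij : i ≠ j) (v : Fin n → V) (a b : V) :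
    insertTwo (k := k) i j hij v (a ⊗ₜ[k] b) =
      PiTensorProduct.tprod k (Function.update (Function.update v i a) j b) := by
  simp [insertTwo]

theorem insertTwo_update_left {n : ℕ} (i j : Fin n) (hij : i ≠ j) (v : Fin n → V) (z : V) :
    insertTwo (k := k) i j hij (Function.update v i z) = insertTwo i j hij v := by
  refine TensorProduct.ext' fun a b => ?_
  rw [insertTwo_tmul, insertTwo_tmul, Function.update_idem]

theorem insertTwo_update_right {n : ℕ} (i j : Fin n) (hij : i ≠ j) (v : Fin n → V) (z : V) :
    insertTwo (k := k) i j hij (Function.update v j z) = insertTwo i j hij v := by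
  refine TensorProduct.ext' fun a b => ?_
  rw [insertTwo_tmul, insertTwo_tmul, Function.update_comm hij, Function.update_idem,
    Function.update_comm hij]

theorem insertTwo_update_add {n : ℕ} (i j : Fin n) (hij : i ≠ j) (v : Fin n → V) (l : Fin n)
    (hi : l ≠ i) (hj : l ≠ j) (y z : V) :
    insertTwo (k := k) i j hij (Function.update v l (y + z)) =
      insertTwo i j hij (Function.update v l y) + insertTwo i j hij (Function.update v l z) := by
  refine TensorProduct.ext' fun a b => ?_
  simp only [insertTwo_tmul, LinearMap.add_apply, Function.update_comm hi, Function.update_comm hj]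
  exact (PiTensorProduct.tprod k).map_update_add _ _ _ _

theorem insertTwo_update_smul {n : ℕ} (i j : Fin n) (hij : i ≠ j) (v : Fin n → V) (l : Fin n)
    (hi : l ≠ i) (hj : l ≠ j) (r : k) (z : V) :
    insertTwo (k := k) i j hij (Function.update v l (r • z)) =
      r • insertTwo i j hij (Function.update v l z) := by
  refine TensorProduct.ext' fun a b => ?_
  simp only [insertTwo_tmul, LinearMap.smul_apply, Function.update_comm hi,
    Function.update_comm hj]
  exact (PiTensorProduct.tprod k).map_update_smul _ _ _ _

/-- The multilinear map which applies `c` to the places `i` and `j` of `v_0 ⊗ ⋯ ⊗ v_{n-1}`. -/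
noncomputable def braidAtAux (c : V ⊗[k] V ≃ₗ[k] V ⊗[k] V) (n : ℕ) (i j : Fin n) (hij : i ≠ j) :
    MultilinearMap k (fun _ : Fin n => V) (⨂[k]^n V) where
  toFun v := insertTwo i j hij v (c (v i ⊗ₜ[k] v j))
  map_update_add' := by
    intro inst v l y z
    obtain rfl : inst = instDecidableEqFin n := Subsingleton.elim _ _
    by_cases hi : l = i
    · subst hi
      have hl : ∀ a : V, Function.update v l a j = v j := fun a =>
        Function.update_of_ne hij.symm a v
      simp only [insertTwo_update_left, Function.update_self, hl,
        TensorProduct.add_tmul, map_add]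
    · by_cases hj : l = j
      · subst hj
        have hl : ∀ a : V, Function.update v l a i = v i := fun a =>
          Function.update_of_ne hij a v
        simp only [insertTwo_update_right, Function.update_self, hl,
          TensorProduct.tmul_add, map_add]
      · have hli : ∀ a : V, Function.update v l a i = v i := fun a =>
          Function.update_of_ne (Ne.symm hi) a v
        have hlj : ∀ a : V, Function.update v l a j = v j := fun a =>
          Function.update_of_ne (Ne.symm hj) a v
        simp only [insertTwo_update_add i j hij v l hi hj, hli,
          hlj, LinearMap.add_apply]
  map_update_smul' := by
    intro inst v l r z
    obtain rfl : inst = instDecidableEqFin n := Subsingleton.elim _ _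
    by_cases hi : l = i
    · subst hi
      have hl : ∀ a : V, Function.update v l a j = v j := fun a =>
        Function.update_of_ne hij.symm a v
      simp only [insertTwo_update_left, Function.update_self, hl,
        ← TensorProduct.smul_tmul', map_smul]
    · by_cases hj : l = j
      · subst hj
        have hl : ∀ a : V, Function.update v l a i = v i := fun a =>
          Function.update_of_ne hij a v
        simp only [insertTwo_update_right, Function.update_self, hl,
          TensorProduct.tmul_smul, map_smul]
      · have hli : ∀ a : V, Function.update v l a i = v i := fun a =>
          Function.update_of_ne (Ne.symm hi) a v
        have hlj : ∀ a : V, Function.update v l a j = v j := fun a =>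
          Function.update_of_ne (Ne.symm hj) a v
        simp only [insertTwo_update_smul i j hij v l hi hj, hli,
          hlj, LinearMap.smul_apply]

/-- `σ_i = id ⊗ c ⊗ id` on `V^{⊗n}`, with `c` at the places `i, i+1` (counted from `0`),
for `i + 1 < n`. -/
noncomputable def braidAt (c : V ⊗[k] V ≃ₗ[k] V ⊗[k] V) (n i : ℕ) :
    Module.End k (⨂[k]^n V) :=
  if h : i + 1 < n then
    PiTensorProduct.lift (braidAtAux c n ⟨i, Nat.lt_of_succ_lt h⟩ ⟨i + 1, h⟩ (by simp))
  else 1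

/-- The action on `V^{⊗n}` of the braid `s(x) = σ_{i₁} ⋯ σ_{i_l}`, for
`x = τ_{i₁} ⋯ τ_{i_l}` reduced. -/
noncomputable def braidLift (c : V ⊗[k] V ≃ₗ[k] V ⊗[k] V) {n : ℕ} (x : Equiv.Perm (Fin n)) :
    Module.End k (⨂[k]^n V) :=
  ((reducedWord x).map (braidAt c n)).prod

/-- The quantum symmetrizer `𝔖^n = ∑_{x ∈ S_n} s(x)` on `V^{⊗n}`. -/
noncomputable def symmetrizerComponent (c : V ⊗[k] V ≃ₗ[k] V ⊗[k] V) (n : ℕ) :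
    Module.End k (⨂[k]^n V) :=
  ∑ x : Equiv.Perm (Fin n), braidLift c x

/-! ### Nichols algebras -/

variable (k V) in
/-- The tensor algebra `A V = ⨁ₙ V^{⊗n}`, with Mathlib's graded algebra structure. -/
abbrev TensorAlg : Type _ := ⨁ n : ℕ, ⨂[k]^n V

/-- An element of `V` as an element of degree one of the tensor algebra. -/
noncomputable def ofVector (v : V) : TensorAlg k V :=
  DirectSum.of (fun n : ℕ => ⨂[k]^n V) 1 (PiTensorProduct.tprod k fun _ => v)

/-- The quantum symmetrizer `𝔖 : A V → C V`, with graded components `𝔖^n` (as vector spaces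
`A V = C V = ⨁ₙ V^{⊗n}`). -/
noncomputable def symmetrizer (c : V ⊗[k] V ≃ₗ[k] V ⊗[k] V) :
    TensorAlg k V →ₗ[k] TensorAlg k V :=
  DirectSum.lmap (symmetrizerComponent c)

/-- The Nichols algebra of `(V, c)`, as a vector space: the image of `𝔖 : A V → C V`. -/
noncomputable def nicholsAlgebra (c : V ⊗[k] V ≃ₗ[k] V ⊗[k] V) : Submodule k (TensorAlg k V) :=
  LinearMap.range (symmetrizer c)

/-- The Nichols rank of `(V, c)`: the dimension of its Nichols algebra (as a cardinal). -/
noncomputable def nicholsRank (c : V ⊗[k] V ≃ₗ[k] V ⊗[k] V) : Cardinal :=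
  Module.rank k (nicholsAlgebra c)

/-- The product of the Nichols algebra is the one for which `𝔖`, from the tensor algebra onto its
image, is a morphism of algebras: `𝔖 a * 𝔖 b = 𝔖 (a * b)`.  So an isomorphism of algebras from the
Nichols algebra to `B` is the same as a surjective morphism of algebras from the tensor algebra to
`B` with the same kernel as `𝔖`.  This says that `φ` is such a morphism. -/
def IsNicholsAlgebraIso (c : V ⊗[k] V ≃ₗ[k] V ⊗[k] V) {B : Type*} [Ring B] [Algebra k B]
    (φ : TensorAlg k V →ₐ[k] B) : Prop :=
  Function.Surjective φ ∧ ∀ a, φ a = 0 ↔ symmetrizer c a = 0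

/-! ### The adjoint action and the Cartan matrix -/

/-- On `V ⊗ V^{⊗m} = V^{⊗(m+1)}` this is the braiding with `V^{⊗m}`, namely
`σ_{m-1} ⋯ σ_1 σ_0 : V ⊗ V^{⊗m} → V^{⊗m} ⊗ V`. -/
noncomputable def moveFirst (c : V ⊗[k] V ≃ₗ[k] V ⊗[k] V) : TensorAlg k V →ₗ[k] TensorAlg k V :=
  DirectSum.lmap fun n => (((List.range (n - 1)).reverse.map (braidAt c n)).prod :
    Module.End k (⨂[k]^n V))

/-- The braided adjoint action on the tensor algebra of the primitive element `v ∈ V`: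
`Ad_v (y) = v y - m (c (v ⊗ y))`. -/
noncomputable def adj (c : V ⊗[k] V ≃ₗ[k] V ⊗[k] V) (v : V) (y : TensorAlg k V) : TensorAlg k V :=
  ofVector v * y - moveFirst c (ofVector v * y)

/-- The nilpotency order of `Ad_v` on `w` in the Nichols algebra is `d`: `d = r + 1` with
`Ad_v^r (w) ≠ 0` and `Ad_v^{r+1} (w) = 0`.  (An element `a` of the tensor algebra is zero in the
Nichols algebra when `𝔖 a = 0`, and `𝔖` commutes with the adjoint actions.) -/
def IsAdNilpotencyOrder (c : V ⊗[k] V ≃ₗ[k] V ⊗[k] V) (v w : V) (d : ℕ) : Prop :=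
  ∃ r : ℕ, d = r + 1 ∧ symmetrizer c ((adj c v)^[r] (ofVector w)) ≠ 0 ∧
    symmetrizer c ((adj c v)^[r + 1] (ofVector w)) = 0

/-- The generalized Cartan matrix of `(V, c)` in the basis `x`: `a_ii = 2`, and `a_ij = 1 - d_ij`
for `i ≠ j`, with `d_ij` the nilpotency order of `Ad_{x_i}` on `x_j`. -/
def HasCartanMatrix (c : V ⊗[k] V ≃ₗ[k] V ⊗[k] V) {n : ℕ} (x : Module.Basis (Fin n) k V)
    (A : Matrix (Fin n) (Fin n) ℤ) : Prop :=
  (∀ i, A i i = 2) ∧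
    ∀ i j, i ≠ j → ∃ d : ℕ, IsAdNilpotencyOrder c (x i) (x j) d ∧ A i j = 1 - (d : ℤ)

/-- `(V, c)` is of type `A₂`. -/
def IsTypeA2 (c : V ⊗[k] V ≃ₗ[k] V ⊗[k] V) (x : Module.Basis (Fin 2) k V) : Prop :=
  HasCartanMatrix c x !![2, -1; -1, 2]

end Braidings

end NicholsAlg

/-!
Let `x` be a basis with `c (x i ⊗ x j) = g i (x j) ⊗ x i`. The proof never computes in the image of
the quantum symmetrizer: it works with the quotient of the tensor algebra by the kernel.

The symmetrizer of `n + 1` places factors as the symmetrizer of the first `n` places times a sum of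
shuffles (`symmetrizerComponent_succ`), and the components of the shuffle factor along the basis are
the derivations `der x g i` of the tensor algebra, twisted by the `g i` and dual to the `x i`
(`shuffleOp_eq`). Hence an element is killed by the symmetrizer if and only if all of its iterated
derivatives have constant term `0` (`symmetrizer_eq_zero_iff`). By the Yetter–Drinfeld condition,
which is what the braid equation says (`isYetterDrinfeld_of_braidEquation`), these elements form an
ideal which is stable under the `g i`, and the derivations descend to the quotient `B`, where only
the scalars have vanishing derivatives (`derivationSystem`). All the rest is deduced from the axioms
of a `DerivationSystem`.

On the span of the `x i` with a given `g i = γ` the operator `γ` is diagonalizable, so the basis may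
be chosen such that `g i (x i) = q i • x i` (`exists_selfEigenbasis`). Multiplication on the right
by `x i` and the derivation `d i` then satisfy the `q`-Weyl relation `D R = 1 + q R D`. It follows
that the product of the orders of the `q i` is at most `dim B` (`IsEigen.prod_orderOf_le`), and that
each of these orders divides `dim B`, because `B` is a free module over `k[d i] / (d i ^ N)`
(`IsEigen.orderOf_dvd`). When `dim B = p ^ 3`, the order of `q i` is therefore `p ^ e i` with
`e i ≥ 1` and `∑ e i ≤ 3`, so that `dim V ≤ 3`.

If `∑ e i = 3`, the lower bound is attained, and `x j * x i` is a combination of the ordered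
monomials `x i ^ a * x j ^ b` (`IsEigen.mul_mem_span`). The second derivatives of this relation show
that the `g i` commute (`commute_of_dim`) and that `q_ij q_ji = 1` (`mul_eq_one_of_dim`). If
`dim V ≤ 2`, the `g i` commute for trivial reasons. In both cases the braiding is diagonal
(`exists_diagonalBasis`).

What remains is `dim V = 2` and `e = (1, 1)`, and `dim V = 1`. In the former case `B` is
the product of `k[x i] / (x i ^ p)` and of a subalgebra of dimension `p ^ 2` generated by the
root vectors `ad (x i) ^ m (x j)`. Each root vector has a twisted derivation of its own, so that the
bounds above apply to root vectors as well, and they leave room only for `m = 0` and `m = 1`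
(`IsDiagonal.rank_two`). The derivatives of the vanishing element `ad (x i) ^ 2 (x j)` give
the matrix of type `A₂` (`IsDiagonal.rank_two_matrix`). In dimension one, `x 0 ^ N = 0`
for the order `N` of `q 0`, which forces `N = p ^ 3` and makes `B` a truncated polynomial algebra
(`exists_isNicholsAlgebraIso`).
-/

namespace NicholsAlg

/-! ### Dimension counts for pairs of operators obeying a `q`-Weyl relation -/

section LinearAlgebra

variable {k : Type*} [Field k] {W : Type*} [AddCommGroup W] [Module k W]

/-- An operator which lowers the powers `R ^ i` on a vector `s` it kills: the value of `D ^ m` on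
`R ^ i s`. -/
theorem pow_apply_pow_of_lower (D R : Module.End k W) (c : ℕ → k) (s : W) (h0 : D s = 0)
    (h1 : ∀ i, D ((R ^ (i + 1)) s) = c (i + 1) • (R ^ i) s) (m i : ℕ) :
    (D ^ m) ((R ^ i) s) =
      if m ≤ i then (∏ l ∈ Finset.range m, c (i - l)) • (R ^ (i - m)) s else 0 := by
  induction m with
  | zero => simp
  | succ m ih =>
    rw [pow_succ', Module.End.mul_apply, ih]
    rcases lt_trichotomy m i with h | h | h
    · obtain ⟨j, rfl⟩ : ∃ j, i = m + j + 1 := ⟨i - m - 1, by omega⟩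
      rw [if_pos (by omega), if_pos (by omega), map_smul, show m + j + 1 - m = j + 1 by omega, h1,
        Finset.prod_range_succ, smul_smul, show m + j + 1 - m = j + 1 by omega,
        show m + j + 1 - (m + 1) = j by omega]
    · subst h
      simp [h0]
    · rw [if_neg (by omega), if_neg (by omega), map_zero]

/-- If `D` lowers the powers `R ^ i` on `S ≤ ker D` with nonzero coefficients for `0 < i < L`, then
the spaces `S, R S, …, R ^ (L - 1) S` are independent copies of `S`. -/
theorem mul_finrank_le [FiniteDimensional k W] (D R : Module.End k W) (c : ℕ → k)
    (S S' : Submodule k W) (L : ℕ) (h0 : ∀ s ∈ S, D s = 0)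
    (h1 : ∀ s ∈ S, ∀ i, D ((R ^ (i + 1)) s) = c (i + 1) • (R ^ i) s)
    (hc : ∀ i, i + 1 < L → c (i + 1) ≠ 0) (hS' : ∀ s ∈ S, ∀ i < L, (R ^ i) s ∈ S') :
    L * Module.finrank k S ≤ Module.finrank k S' := by
  have key : ∀ L' ≤ L, ∀ f : ℕ → S, ∑ i ∈ Finset.range L', (R ^ i) (f i : W) = 0 →
      ∀ i < L', f i = 0 := by
    intro L'
    induction L' with
    | zero => intro _ f _ i hi; omega
    | succ L' ih =>
      intro hL' f hf
      -- `D ^ L'` kills all the summands but the last one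
      have htop : f L' = 0 := by
        have h2 := congrArg (D ^ L') hf
        rw [map_sum, map_zero, Finset.sum_range_succ, Finset.sum_eq_zero, zero_add,
          pow_apply_pow_of_lower D R c _ (h0 _ (f L').2) (h1 _ (f L').2), if_pos le_rfl,
          Nat.sub_self, pow_zero, Module.End.one_apply, smul_eq_zero] at h2
        · rcases h2 with h2 | h2
          · rw [Finset.prod_eq_zero_iff] at h2
            obtain ⟨l, hl, h2⟩ := h2
            rw [Finset.mem_range] at hl
            obtain ⟨j, hj⟩ : ∃ j, L' - l = j + 1 := ⟨L' - l - 1, by omega⟩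
            rw [hj] at h2
            exact absurd h2 (hc j (by omega))
          · exact Subtype.ext h2
        · intro i hi
          rw [Finset.mem_range] at hi
          rw [pow_apply_pow_of_lower D R c _ (h0 _ (f i).2) (h1 _ (f i).2), if_neg (by omega)]
      intro i hi
      rcases Nat.lt_succ_iff_lt_or_eq.mp hi with hi | rfl
      · refine ih (by omega) f ?_ i hi
        rw [Finset.sum_range_succ, htop] at hf
        simpa using hf
      · exact htop
  let Φ : (Fin L → S) →ₗ[k] S' :=
    { toFun := fun f => ⟨∑ i : Fin L, (R ^ (i : ℕ)) (f i : W),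
        Submodule.sum_mem _ fun i _ => hS' _ (f i).2 i i.2⟩
      map_add' := fun f f' => Subtype.ext (by simp [Finset.sum_add_distrib])
      map_smul' := fun r f => Subtype.ext (by simp [Finset.smul_sum]) }
  have hinj : Function.Injective Φ := by
    rw [← LinearMap.ker_eq_bot, LinearMap.ker_eq_bot']
    intro f hf
    have h2 : ∑ i : Fin L, (R ^ (i : ℕ)) (f i : W) = 0 := congrArg Subtype.val hf
    funext i
    have h3 := key L le_rfl (fun j => if h : j < L then f ⟨j, h⟩ else 0) (by
      rw [← Fin.sum_univ_eq_sum_range (fun j => (R ^ j)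
        (((if h : j < L then f ⟨j, h⟩ else 0 : S)) : W)) L]
      simpa using h2) i i.2
    simpa using h3
  simpa [Module.finrank_pi_fintype] using LinearMap.finrank_le_finrank_of_injective hinj

theorem finrank_ker_pow_le [FiniteDimensional k W] (D : Module.End k W) (m : ℕ) :
    Module.finrank k (LinearMap.ker (D ^ m)) ≤ m * Module.finrank k (LinearMap.ker D) := by
  induction m with
  | zero => simp [Module.End.one_eq_id]
  | succ m ih =>
    let f : LinearMap.ker (D ^ (m + 1)) →ₗ[k] LinearMap.ker D :=
      LinearMap.codRestrict _ ((D ^ m) ∘ₗ (LinearMap.ker (D ^ (m + 1))).subtype) (by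
        rintro ⟨w, hw⟩
        rw [LinearMap.mem_ker, pow_succ', Module.End.mul_apply] at hw
        simpa using hw)
    have h1 := LinearMap.finrank_range_add_finrank_ker f
    have h2 : Module.finrank k (LinearMap.range f) ≤ Module.finrank k (LinearMap.ker D) :=
      Submodule.finrank_le _
    let e : LinearMap.ker f →ₗ[k] LinearMap.ker (D ^ m) :=
      LinearMap.codRestrict _
        ((LinearMap.ker (D ^ (m + 1))).subtype ∘ₗ (LinearMap.ker f).subtype) (by
        rintro ⟨w, hw⟩
        exact congrArg Subtype.val hw)
    have h3 : Module.finrank k (LinearMap.ker f) ≤ Module.finrank k (LinearMap.ker (D ^ m)) :=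
      LinearMap.finrank_le_finrank_of_injective (f := e) (by
        intro a b hab
        exact Subtype.ext (Subtype.ext (congrArg (fun z : LinearMap.ker (D ^ m) => (z : W)) hab)))
    rw [Nat.add_mul, one_mul]
    omega

/-- The `q`-integer `1 + q + ⋯ + q ^ (m - 1)`. -/
def qInt (q : k) (m : ℕ) : k := ∑ i ∈ Finset.range m, q ^ i

@[simp] theorem qInt_one (q : k) : qInt q 1 = 1 := by simp [qInt]

theorem qInt_succ (q : k) (m : ℕ) : qInt q (m + 1) = 1 + q * qInt q m := by
  rw [qInt, qInt, Finset.sum_range_succ', Finset.mul_sum, add_comm]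
  simp [pow_succ']

theorem qInt_orderOf {q : k} (hq : q ≠ 1) : qInt q (orderOf q) = 0 := by
  have h := mul_neg_geom_sum q (orderOf q)
  rw [pow_orderOf_eq_one, sub_self, mul_eq_zero] at h
  exact h.resolve_left (sub_ne_zero.mpr hq.symm)

theorem qInt_ne_zero_of_lt {q : k} {m : ℕ} (h0 : m ≠ 0) (hm : m < orderOf q) :
    qInt q m ≠ 0 := by
  intro h
  have h2 := mul_neg_geom_sum q m
  rw [← qInt, h, mul_zero, eq_comm, sub_eq_zero, eq_comm] at h2
  exact pow_ne_one_of_lt_orderOf h0 hm h2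

theorem qInt_one_ne_zero [CharZero k] {m : ℕ} (h0 : m ≠ 0) : qInt (1 : k) m ≠ 0 := by
  simp [qInt, h0]

/-- Under the relation `D R = 1 + t R D`, the operator `D` lowers the powers of `R` on a vector which
it kills, with the `t`-integers as coefficients. -/
theorem lower_pow (D R : Module.End k W) (t : k) (w : W) (h0 : D w = 0)
    (h : ∀ i, D (R ((R ^ i) w)) = (R ^ i) w + t • R (D ((R ^ i) w))) (i : ℕ) :
    D ((R ^ (i + 1)) w) = qInt t (i + 1) • (R ^ i) w := by
  induction i with
  | zero => simpa [h0] using h 0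
  | succ i ih =>
    rw [pow_succ', Module.End.mul_apply, h, ih, map_smul, ← Module.End.mul_apply R, ← pow_succ',
      smul_smul, qInt_succ t (i + 1), add_smul, one_smul]

/-- A finite-dimensional representation of the relation `D R = 1 + t R D`, with `t` of order `N`
and `D ^ N = 0`, is free over `k[D] / (D ^ N)`: all the Jordan blocks of `D` have size `N`. -/
theorem orderOf_dvd_finrank [FiniteDimensional k W] (D R : Module.End k W) (t : k)
    (h : ∀ w, D (R w) = w + t • R (D w)) (hN : D ^ orderOf t = 0) :
    orderOf t ∣ Module.finrank k W := by
  have h1 := mul_finrank_le D R (qInt t) (LinearMap.ker D) ⊤ (orderOf t)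
    (fun s hs => hs) (fun s hs i => lower_pow D R t s hs (fun i => h _) i)
    (fun i hi => qInt_ne_zero_of_lt (Nat.succ_ne_zero i) hi) (fun _ _ _ _ => trivial)
  have h2 := finrank_ker_pow_le D (orderOf t)
  rw [hN, LinearMap.ker_zero] at h2
  rw [finrank_top] at h1 h2
  exact ⟨_, le_antisymm h2 h1⟩

end LinearAlgebra

/-! ### Induction on words in the generators of an algebra -/

section Words

variable {k : Type*} [Field k] {A : Type*} [Ring A] [Algebra k A]

theorem mem_of_mul_mem_right {s : Set A} (S : Submodule k A) (h1 : (1 : A) ∈ S)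
    (hS : ∀ a ∈ S, ∀ y ∈ s, a * y ∈ S) {z : A} (hz : z ∈ Algebra.adjoin k s) : z ∈ S := by
  suffices ∀ a ∈ S, a * z ∈ S by simpa using this 1 h1
  induction hz using Algebra.adjoin_induction with
  | mem x hx => exact fun a ha => hS a ha x hx
  | algebraMap r =>
    intro a ha
    rw [← Algebra.commutes, ← Algebra.smul_def]
    exact S.smul_mem r ha
  | add x y _ _ hx hy => exact fun a ha => mul_add a x y ▸ S.add_mem (hx a ha) (hy a ha)
  | mul x y _ _ hx hy => exact fun a ha => mul_assoc a x y ▸ hy _ (hx a ha)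

theorem mem_of_mul_mem_left {s : Set A} (S : Submodule k A) (h1 : (1 : A) ∈ S)
    (hS : ∀ a ∈ S, ∀ y ∈ s, y * a ∈ S) {z : A} (hz : z ∈ Algebra.adjoin k s) : z ∈ S := by
  suffices ∀ a ∈ S, z * a ∈ S by simpa using this 1 h1
  induction hz using Algebra.adjoin_induction with
  | mem x hx => exact fun a ha => hS a ha x hx
  | algebraMap r =>
    intro a ha
    rw [← Algebra.smul_def]
    exact S.smul_mem r ha
  | add x y _ _ hx hy => exact fun a ha => add_mul x y a ▸ S.add_mem (hx a ha) (hy a ha)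
  | mul x y _ _ hx hy => exact fun a ha => (mul_assoc x y a).symm ▸ hx _ (hy a ha)

end Words

/-! ### Twisted derivations -/

section TwistedDerivation

variable {k : Type*} [Field k] {B : Type*} [Ring B] [Algebra k B]

theorem mulRight_pow_apply (u b : B) (i : ℕ) : (LinearMap.mulRight k u ^ i) b = b * u ^ i := by
  rw [LinearMap.pow_mulRight, LinearMap.mulRight_apply]

/-- The freeness of an algebra `A` over the truncated polynomial algebra generated by `u`, in terms
of dimensions: `D` is a derivation of `A` twisted by `γ` which takes the value `1` on the
eigenvector `u` of `γ` and vanishes on the other generators and their images under `γ`. -/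
theorem orderOf_dvd_finrank_adjoin [FiniteDimensional k B] (s : Set B) (D : Module.End k B)
    (γ : B →ₐ[k] B) (u : B) (t : k) (hu : u ∈ Algebra.adjoin k s)
    (hD : ∀ a ∈ Algebra.adjoin k s, ∀ b ∈ Algebra.adjoin k s, D (a * b) = a * D b + D a * γ b)
    (hγ : ∀ y ∈ s, γ y ∈ Algebra.adjoin k s) (hDu : D u = 1) (hγu : γ u = t • u)
    (hs : ∀ y ∈ s, y = u ∨ ∀ m : ℕ, D ((γ ^ m) y) = 0) (ht : t ≠ 1) (ht0 : orderOf t ≠ 0) :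
    orderOf t ∣ Module.finrank k (Algebra.adjoin k s) := by
  set A := Algebra.adjoin k s with hA
  have hγA : ∀ a ∈ A, γ a ∈ A := by
    intro a ha
    have : A ≤ A.comap γ := Algebra.adjoin_le fun y hy => hγ y hy
    exact this ha
  have hγmA : ∀ m : ℕ, ∀ a ∈ A, (γ ^ m) a ∈ A := by
    intro m
    induction m with
    | zero => intro a ha; simpa using ha
    | succ m ih =>
      intro a ha
      rw [pow_succ', AlgHom.mul_apply]
      exact hγA _ (ih a ha)
  have hD1 : D 1 = 0 := by
    have := hD 1 A.one_mem 1 A.one_mem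
    simpa using this
  have hDA : ∀ a ∈ A, D a ∈ A := by
    intro a ha
    have : a ∈ Subalgebra.toSubmodule A ⊓ (Subalgebra.toSubmodule A).comap D := by
      refine mem_of_mul_mem_right (s := s) _ (Submodule.mem_inf.mpr ⟨A.one_mem, ?_⟩) ?_ ha
      · change D 1 ∈ A
        rw [hD1]
        exact A.zero_mem
      · rintro a ⟨ha, ha'⟩ y hy
        have hyA : y ∈ A := Algebra.subset_adjoin hy
        refine ⟨A.mul_mem ha hyA, ?_⟩
        change D (a * y) ∈ A
        rw [hD a ha y hyA]
        refine A.add_mem (A.mul_mem ha ?_) (A.mul_mem ha' (hγA y hyA))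
        rcases hs y hy with rfl | h
        · rw [hDu]; exact A.one_mem
        · have := h 0
          rw [pow_zero, AlgHom.one_apply] at this
          rw [this]; exact A.zero_mem
    exact this.2
  have hDmA : ∀ m : ℕ, ∀ a ∈ A, (D ^ m) a ∈ A := by
    intro m
    induction m with
    | zero => intro a ha; simpa using ha
    | succ m ih =>
      intro a ha
      rw [pow_succ', Module.End.mul_apply]
      exact hDA _ (ih a ha)
  have hmulu : ∀ a ∈ A, D (a * u) = a + t • (D a * u) := by
    intro a ha
    rw [hD a ha u hu, hDu, mul_one, hγu, mul_smul_comm]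
  have hpowu : ∀ m : ℕ, ∀ a ∈ A,
      (D ^ (m + 1)) (a * u) = t ^ (m + 1) • ((D ^ (m + 1)) a * u) + qInt t (m + 1) • (D ^ m) a := by
    intro m a ha
    induction m with
    | zero => simp [hmulu a ha, add_comm]
    | succ m ih =>
      rw [pow_succ', Module.End.mul_apply, ih, map_add, map_smul, map_smul, hmulu _ (hDmA _ a ha),
        ← Module.End.mul_apply D, ← pow_succ', ← Module.End.mul_apply D, ← pow_succ']
      have : qInt t (m + 1 + 1) = t ^ (m + 1) + qInt t (m + 1) := by
        rw [qInt, Finset.sum_range_succ, add_comm, qInt]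
      rw [this]
      module
  have hpowy : ∀ y ∈ s, (∀ m : ℕ, D ((γ ^ m) y) = 0) → ∀ m : ℕ, ∀ a ∈ A,
      (D ^ m) (a * y) = (D ^ m) a * (γ ^ m) y := by
    intro y hy hy0 m a ha
    induction m with
    | zero => simp
    | succ m ih =>
      rw [pow_succ', Module.End.mul_apply, ih,
        hD _ (hDmA _ a ha) _ (hγmA _ _ (Algebra.subset_adjoin hy)), hy0, mul_zero, zero_add,
        Module.End.mul_apply, pow_succ' γ, AlgHom.mul_apply]
  have hDN : ∀ a ∈ A, (D ^ orderOf t) a = 0 := by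
    obtain ⟨N, hN⟩ := Nat.exists_eq_succ_of_ne_zero ht0
    intro a ha
    have : a ∈ Subalgebra.toSubmodule A ⊓ LinearMap.ker (D ^ orderOf t) := by
      refine mem_of_mul_mem_right (s := s) _ (Submodule.mem_inf.mpr ⟨A.one_mem, ?_⟩) ?_ ha
      · change (D ^ orderOf t) 1 = 0
        rw [hN, pow_succ, Module.End.mul_apply, hD1, map_zero]
      · rintro a ⟨ha, ha'⟩ y hy
        refine ⟨A.mul_mem ha (Algebra.subset_adjoin hy), ?_⟩
        change (D ^ orderOf t) (a * y) = 0
        change (D ^ orderOf t) a = 0 at ha'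
        rcases hs y hy with rfl | h
        · have h0 := qInt_orderOf ht
          rw [hN] at ha' h0 ⊢
          rw [hpowu N a ha, ha', h0, zero_mul, smul_zero, zero_smul, add_zero]
        · rw [hpowy y hy h _ a ha, ha', zero_mul]
    exact this.2
  let D' : Module.End k A := D.restrict (p := Subalgebra.toSubmodule A)
    (q := Subalgebra.toSubmodule A) hDA
  refine orderOf_dvd_finrank D' (LinearMap.mulRight k (⟨u, hu⟩ : A)) t ?_ ?_
  · rintro ⟨a, ha⟩
    exact Subtype.ext (hmulu a ha)
  · have hcoe : ∀ (m : ℕ) (a : A), (((D' ^ m) a : A) : B) = (D ^ m) (a : B) := by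
      intro m a
      induction m with
      | zero => rfl
      | succ m ih =>
        rw [pow_succ', Module.End.mul_apply, pow_succ', Module.End.mul_apply, ← ih]
        rfl
    ext a
    rw [hcoe, hDN a a.2]
    rfl

/-- In characteristic `0` the parameter of the `q`-Weyl relation cannot be `1` on a
finite-dimensional space which contains a vacuum vector. -/
theorem ne_one_of_lower [CharZero k] {W : Type*} [AddCommGroup W] [Module k W]
    [FiniteDimensional k W] (D R : Module.End k W) (t : k)
    (w : W) (hw : w ≠ 0) (h0 : D w = 0)
    (h : ∀ i, D (R ((R ^ i) w)) = (R ^ i) w + t • R (D ((R ^ i) w))) : t ≠ 1 := by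
  rintro rfl
  have hspan : ∀ s ∈ Submodule.span k {w}, ∃ r : k, s = r • w := fun s hs => by
    obtain ⟨r, rfl⟩ := Submodule.mem_span_singleton.mp hs
    exact ⟨r, rfl⟩
  have h1 := mul_finrank_le D R (qInt 1) (Submodule.span k {w}) ⊤ (Module.finrank k W + 1)
    (fun s hs => by obtain ⟨r, rfl⟩ := hspan s hs; simp [h0])
    (fun s hs i => by
      obtain ⟨r, rfl⟩ := hspan s hs
      rw [map_smul, map_smul, map_smul, lower_pow D R 1 w h0 h, smul_comm])
    (fun i _ => qInt_one_ne_zero (Nat.succ_ne_zero i)) (fun _ _ _ _ => trivial)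
  rw [finrank_span_singleton hw, finrank_top] at h1
  omega

end TwistedDerivation

/-! ### Algebras with a system of twisted derivations -/

/-- An algebra generated by `x₁, …, x_n` with derivations `d i` twisted by the algebra
endomorphisms `g i`, dual to the generators, and with an augmentation `ε` such that only `0` is
killed by `ε` and by all of the `d i`.  It abstracts the Nichols algebra of a braided pair of group
type, where `c (x_i ⊗ x_j) = g_i (x_j) ⊗ x_i`; the matrix of `g i` on the generators is `M i`. -/
structure DerivationSystem (k : Type*) [Field k] (B : Type*) [Ring B] [Algebra k B] (n : ℕ) where
  x : Fin n → B
  d : Fin n → Module.End k B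
  g : Fin n → B →ₐ[k] B
  ε : B →ₐ[k] k
  M : Fin n → Fin n → Fin n → k
  d_mul : ∀ i a b, d i (a * b) = a * d i b + d i a * g i b
  d_x : ∀ i j, d i (x j) = if i = j then 1 else 0
  g_x : ∀ i j, g i (x j) = ∑ l, M i l j • x l
  ε_x : ∀ i, ε (x i) = 0
  adjoin_x : Algebra.adjoin k (Set.range x) = ⊤
  eq_zero : ∀ b, ε b = 0 → (∀ i, d i b = 0) → b = 0

namespace DerivationSystem

variable {k : Type*} [Field k] {B : Type*} [Ring B] [Algebra k B] {n : ℕ}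
  (𝒟 : DerivationSystem k B n)

@[simp] theorem d_one (i : Fin n) : 𝒟.d i 1 = 0 := by
  have := 𝒟.d_mul i 1 1
  simpa using this

@[simp] theorem d_x_self (i : Fin n) : 𝒟.d i (𝒟.x i) = 1 := by simp [𝒟.d_x]

theorem d_x_of_ne {i j : Fin n} (h : i ≠ j) : 𝒟.d i (𝒟.x j) = 0 := by simp [𝒟.d_x, h]

theorem ε_g (i : Fin n) (b : B) : 𝒟.ε (𝒟.g i b) = 𝒟.ε b := by
  have h : 𝒟.ε.comp (𝒟.g i) = 𝒟.ε := by
    refine AlgHom.ext_of_adjoin_eq_top 𝒟.adjoin_x ?_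
    rintro _ ⟨j, rfl⟩
    simp [𝒟.g_x, 𝒟.ε_x]
  exact DFunLike.congr_fun h b

theorem one_ne_zero (𝒟 : DerivationSystem k B n) : (1 : B) ≠ 0 := by
  intro h
  have := congrArg 𝒟.ε h
  simp at this

theorem x_ne_zero (i : Fin n) : 𝒟.x i ≠ 0 := by
  intro h
  have := congrArg (𝒟.d i) h
  rw [𝒟.d_x_self, map_zero] at this
  exact 𝒟.one_ne_zero this

/-- Each generator `x i` is an eigenvector of `g i`, with eigenvalue `q i`, and `g i` preserves the
span of the others. -/
structure IsEigen (q : Fin n → k) : Prop where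
  g_self : ∀ i, 𝒟.g i (𝒟.x i) = q i • 𝒟.x i
  M_eq_zero : ∀ i j, j ≠ i → 𝒟.M i i j = 0

variable {𝒟} {q : Fin n → k}

theorem IsEigen.d_g_pow (h : 𝒟.IsEigen q) {i j : Fin n} (hij : j ≠ i) (m : ℕ) :
    𝒟.d i ((𝒟.g i ^ m) (𝒟.x j)) = 0 := by
  have hmem : (𝒟.g i ^ m) (𝒟.x j) ∈ Submodule.span k (𝒟.x '' {l | l ≠ i}) := by
    induction m with
    | zero => exact Submodule.subset_span ⟨j, hij, by simp⟩
    | succ m ih =>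
      rw [pow_succ', AlgHom.mul_apply]
      have hle : Submodule.span k (𝒟.x '' {l | l ≠ i}) ≤
          (Submodule.span k (𝒟.x '' {l | l ≠ i})).comap (𝒟.g i).toLinearMap := by
        rw [Submodule.span_le]
        rintro _ ⟨l, hl, rfl⟩
        change 𝒟.g i (𝒟.x l) ∈ Submodule.span k (𝒟.x '' {l | l ≠ i})
        rw [𝒟.g_x]
        refine Submodule.sum_mem _ fun r _ => ?_
        by_cases hr : r = i
        · rw [hr, h.M_eq_zero i l hl, zero_smul]
          exact Submodule.zero_mem _
        · exact Submodule.smul_mem _ _ (Submodule.subset_span ⟨r, hr, rfl⟩)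
      exact hle ih
  have hle : Submodule.span k (𝒟.x '' {l | l ≠ i}) ≤ LinearMap.ker (𝒟.d i) := by
    rw [Submodule.span_le]
    rintro _ ⟨l, hl, rfl⟩
    exact 𝒟.d_x_of_ne (Ne.symm hl)
  exact hle hmem

theorem IsEigen.d_mul_x (h : 𝒟.IsEigen q) (i : Fin n) (b : B) :
    𝒟.d i (b * 𝒟.x i) = b + q i • (𝒟.d i b * 𝒟.x i) := by
  rw [𝒟.d_mul, 𝒟.d_x_self, mul_one, h.g_self, mul_smul_comm]

theorem IsEigen.d_mul_x_pow (h : 𝒟.IsEigen q) (i : Fin n) (b : B) (hb : 𝒟.d i b = 0) (m : ℕ) :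
    𝒟.d i (b * 𝒟.x i ^ (m + 1)) = qInt (q i) (m + 1) • (b * 𝒟.x i ^ m) := by
  have := lower_pow (𝒟.d i) (LinearMap.mulRight k (𝒟.x i)) (q i) b hb
    (fun j => h.d_mul_x i _) m
  simpa only [mulRight_pow_apply] using this

theorem IsEigen.d_x_pow (h : 𝒟.IsEigen q) (i : Fin n) (m : ℕ) :
    𝒟.d i (𝒟.x i ^ (m + 1)) = qInt (q i) (m + 1) • 𝒟.x i ^ m := by
  simpa using h.d_mul_x_pow i 1 (𝒟.d_one i) m

theorem IsEigen.ne_one [CharZero k] [FiniteDimensional k B] (h : 𝒟.IsEigen q) (i : Fin n) :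
    q i ≠ 1 :=
  ne_one_of_lower (𝒟.d i) (LinearMap.mulRight k (𝒟.x i)) (q i) 1 𝒟.one_ne_zero (𝒟.d_one i)
    (fun _ => h.d_mul_x i _)

/-- The operators `d i` and multiplication by `x i` make the algebra a free module over
`k[d i] / (d i ^ N)`, where `N` is the order of `q i`. -/
theorem IsEigen.orderOf_dvd [CharZero k] [FiniteDimensional k B] (h : 𝒟.IsEigen q) (i : Fin n)
    (hi : IsOfFinOrder (q i)) : orderOf (q i) ∣ Module.finrank k B := by
  have := orderOf_dvd_finrank_adjoin (Set.range 𝒟.x) (𝒟.d i) (𝒟.g i) (𝒟.x i) (q i)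
    (Algebra.subset_adjoin ⟨i, rfl⟩) (fun a _ b _ => 𝒟.d_mul i a b)
    (fun y _ => 𝒟.adjoin_x ▸ Algebra.mem_top) (𝒟.d_x_self i) (h.g_self i)
    (by
      rintro _ ⟨j, rfl⟩
      by_cases hj : j = i
      · exact Or.inl (by rw [hj])
      · exact Or.inr (h.d_g_pow hj))
    (h.ne_one i) (orderOf_pos_iff.mpr hi).ne'
  rw [𝒟.adjoin_x] at this
  rwa [← Subalgebra.finrank_toSubmodule, Algebra.top_toSubmodule, finrank_top] at this

theorem d_eq_zero_of_mem_adjoin {s : Set (Fin n)} {i : Fin n} (hi : i ∉ s) {a : B}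
    (ha : a ∈ Algebra.adjoin k (𝒟.x '' s)) : 𝒟.d i a = 0 := by
  have := mem_of_mul_mem_right (s := 𝒟.x '' s) (LinearMap.ker (𝒟.d i)) (𝒟.d_one i) (by
    rintro b hb _ ⟨j, hj, rfl⟩
    rw [LinearMap.mem_ker] at hb ⊢
    rw [𝒟.d_mul, hb, 𝒟.d_x_of_ne (fun h : i = j => hi (h ▸ hj)), mul_zero, zero_mul, add_zero]) ha
  exact this

/-- Multiplication on the right by the powers of `x i` gives `orderOf (q i)` independent copies of
a subspace which does not involve `x i`. -/
theorem IsEigen.mul_finrank_le [FiniteDimensional k B] (h : 𝒟.IsEigen q) (i : Fin n)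
    (S S' : Submodule k B) (hS : ∀ a ∈ S, 𝒟.d i a = 0)
    (hS' : ∀ a ∈ S, ∀ m, a * 𝒟.x i ^ m ∈ S') :
    orderOf (q i) * Module.finrank k S ≤ Module.finrank k S' :=
  NicholsAlg.mul_finrank_le (𝒟.d i) (LinearMap.mulRight k (𝒟.x i)) (qInt (q i)) S S' _ hS
    (fun s hs m => lower_pow _ _ _ s (hS s hs) (fun _ => h.d_mul_x i _) m)
    (fun m hm => qInt_ne_zero_of_lt (Nat.succ_ne_zero m) hm)
    (fun s hs m _ => by rw [mulRight_pow_apply]; exact hS' s hs m)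

/-- The ordered products of powers of the `x i`, `i ∈ s`, give independent copies of a subspace which
does not involve these `x i`. -/
theorem IsEigen.prod_mul_finrank_le [FiniteDimensional k B] (h : 𝒟.IsEigen q) (t : Set (Fin n))
    (S : Submodule k B) (hS : ∀ a ∈ S, a ∈ Algebra.adjoin k (𝒟.x '' t)) (s : Finset (Fin n))
    (hst : ∀ i ∈ s, i ∉ t) :
    (∏ i ∈ s, orderOf (q i)) * Module.finrank k S ≤ Module.finrank k B := by
  suffices ∃ S' : Submodule k B, (∀ a ∈ S', a ∈ Algebra.adjoin k (𝒟.x '' (t ∪ s))) ∧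
      (∏ i ∈ s, orderOf (q i)) * Module.finrank k S ≤ Module.finrank k S' by
    obtain ⟨S', _, hS'⟩ := this
    exact hS'.trans (Submodule.finrank_le _)
  induction s using Finset.induction_on with
  | empty => exact ⟨S, by simpa using hS, by simp⟩
  | insert i s hi ih =>
    obtain ⟨S', h1, h2⟩ := ih fun j hj => hst j (Finset.mem_insert_of_mem hj)
    refine ⟨Subalgebra.toSubmodule (Algebra.adjoin k (𝒟.x '' (t ∪ (insert i s : Finset _)))),
      fun a ha => ha, ?_⟩
    have h3 := h.mul_finrank_le i S'
      (Subalgebra.toSubmodule (Algebra.adjoin k (𝒟.x '' (t ∪ (insert i s : Finset _)))))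
      (fun a ha => d_eq_zero_of_mem_adjoin (s := t ∪ s) (by
        rintro (h | h)
        · exact hst i (Finset.mem_insert_self _ _) h
        · exact hi h) (h1 a ha))
      (fun a ha m => by
        refine Subalgebra.mul_mem _ ?_ (Subalgebra.pow_mem _ ?_ m)
        · refine Algebra.adjoin_mono (Set.image_mono ?_) (h1 a ha)
          rw [Finset.coe_insert]
          exact Set.union_subset_union_right _ (Set.subset_insert _ _)
        · exact Algebra.subset_adjoin ⟨i, Or.inr (by simp), rfl⟩)
    rw [Finset.prod_insert hi, mul_assoc]
    exact (Nat.mul_le_mul_left _ h2).trans h3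

theorem IsEigen.prod_orderOf_le [FiniteDimensional k B] (h : 𝒟.IsEigen q) :
    ∏ i, orderOf (q i) ≤ Module.finrank k B := by
  have := h.prod_mul_finrank_le ∅ (Submodule.span k {1}) (fun a ha => by
    obtain ⟨r, rfl⟩ := Submodule.mem_span_singleton.mp ha
    exact Subalgebra.smul_mem _ (Subalgebra.one_mem _) r) Finset.univ (fun _ _ h => h)
  rwa [finrank_span_singleton 𝒟.one_ne_zero, mul_one] at this

end DerivationSystem

namespace DerivationSystem

variable {k : Type*} [Field k] {B : Type*} [Ring B] [Algebra k B] {n : ℕ}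
  {𝒟 : DerivationSystem k B n} {q : Fin n → k}

theorem ε_d_mul (l : Fin n) (a b : B) :
    𝒟.ε (𝒟.d l (a * b)) = 𝒟.ε a * 𝒟.ε (𝒟.d l b) + 𝒟.ε (𝒟.d l a) * 𝒟.ε b := by
  rw [𝒟.d_mul, map_add, map_mul, map_mul, 𝒟.ε_g]

theorem ε_d_x (l i : Fin n) : 𝒟.ε (𝒟.d l (𝒟.x i)) = if l = i then 1 else 0 := by
  rw [𝒟.d_x]
  split_ifs <;> simp

theorem ε_d_g_x (l i j : Fin n) : 𝒟.ε (𝒟.d l (𝒟.g i (𝒟.x j))) = 𝒟.M i l j := by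
  simp [𝒟.g_x, ε_d_x]

theorem ε_pow {y : B} (hy : 𝒟.ε y = 0) (m : ℕ) : 𝒟.ε (y ^ m) = if m = 0 then 1 else 0 := by
  rw [map_pow, hy]
  split_ifs with h <;> simp [h]

theorem ε_d_pow {y : B} (hy : 𝒟.ε y = 0) (l : Fin n) (m : ℕ) :
    𝒟.ε (𝒟.d l (y ^ m)) = if m = 1 then 𝒟.ε (𝒟.d l y) else 0 := by
  cases m with
  | zero => simp
  | succ m =>
    rw [pow_succ, ε_d_mul, hy, ε_pow hy, mul_zero, add_zero]
    by_cases h : m = 0 <;> simp [h]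

theorem d_x_pow_of_ne {i j : Fin n} (hij : i ≠ j) (m : ℕ) : 𝒟.d i (𝒟.x j ^ m) = 0 := by
  induction m with
  | zero => simp
  | succ m ih => rw [pow_succ, 𝒟.d_mul, ih, 𝒟.d_x_of_ne hij, mul_zero, zero_mul, add_zero]

/-- The part of degree two of a relation between ordered monomials in two generators, read off from
its derivatives. -/
theorem IsEigen.relation_of_mem_span (h : 𝒟.IsEigen q) {i j : Fin n} (hij : i ≠ j) {w : B}
    (hw : w ∈ Submodule.span k (Set.range fun a : ℕ × ℕ => 𝒟.x i ^ a.1 * 𝒟.x j ^ a.2)) :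
    ∃ α β γ : k, ∀ l,
      𝒟.ε (𝒟.d l (𝒟.d i w)) = α * 𝒟.M i l j + β * (if l = i then 1 else 0) ∧
      𝒟.ε (𝒟.d l (𝒟.d j w)) = α * (if l = i then 1 else 0) + γ * (if l = j then 1 else 0) := by
  induction hw using Submodule.span_induction with
  | mem w hw =>
    obtain ⟨⟨a, b⟩, rfl⟩ := hw
    refine ⟨if a = 1 ∧ b = 1 then 1 else 0, if a = 2 ∧ b = 0 then qInt (q i) 2 else 0,
      if a = 0 ∧ b = 2 then qInt (q j) 2 else 0, fun l => ⟨?_, ?_⟩⟩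
    · have hg : 𝒟.ε (𝒟.g i (𝒟.x j)) = 0 := by rw [𝒟.ε_g, 𝒟.ε_x]
      dsimp only
      rw [𝒟.d_mul, d_x_pow_of_ne hij, mul_zero, zero_add, map_pow (𝒟.g i)]
      rcases a with _ | a
      · simp
      · rw [h.d_x_pow, smul_mul_assoc, map_smul, map_smul, ε_d_mul, ε_pow hg, ε_d_pow hg,
          ε_pow (𝒟.ε_x i), ε_d_pow (𝒟.ε_x i), ε_d_g_x, ε_d_x]
        rcases a with _ | _ | a <;> simp <;> split_ifs <;> rfl
    · dsimp only
      rcases b with _ | b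
      · simp [d_x_pow_of_ne (Ne.symm hij)]
      · rw [h.d_mul_x_pow j _ (d_x_pow_of_ne (Ne.symm hij) _), map_smul, map_smul, ε_d_mul,
          ε_pow (𝒟.ε_x i), ε_d_pow (𝒟.ε_x i), ε_pow (𝒟.ε_x j), ε_d_pow (𝒟.ε_x j), ε_d_x, ε_d_x]
        rcases b with _ | _ | b <;> simp <;> split_ifs <;> rfl
  | zero => exact ⟨0, 0, 0, by simp⟩
  | add w w' _ _ hw hw' =>
    obtain ⟨α, β, γ, h⟩ := hw
    obtain ⟨α', β', γ', h'⟩ := hw'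
    refine ⟨α + α', β + β', γ + γ', fun l => ?_⟩
    simp only [map_add, (h l).1, (h l).2, (h' l).1, (h' l).2]
    constructor <;> ring
  | smul r w _ hw =>
    obtain ⟨α, β, γ, h⟩ := hw
    refine ⟨r * α, r * β, r * γ, fun l => ?_⟩
    simp only [map_smul, (h l).1, (h l).2, smul_eq_mul]
    constructor <;> ring

/-- If the dimension is as small as the orders of the `q i` allow, then the ordered monomials in two
generators span a subspace which contains `x j * x i`. -/
theorem IsEigen.mul_mem_span [FiniteDimensional k B] (h : 𝒟.IsEigen q)
    (hdim : ∏ i, orderOf (q i) = Module.finrank k B) {i j : Fin n} (hij : i ≠ j) :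
    𝒟.x j * 𝒟.x i ∈ Submodule.span k (Set.range fun a : ℕ × ℕ => 𝒟.x i ^ a.1 * 𝒟.x j ^ a.2) := by
  by_contra hmem
  set S := Submodule.span k (Set.range fun a : ℕ × ℕ => 𝒟.x i ^ a.1 * 𝒟.x j ^ a.2) with hS
  set A := Algebra.adjoin k (𝒟.x '' ({i, j} : Set (Fin n))) with hA
  have hxi : 𝒟.x i ∈ A := Algebra.subset_adjoin ⟨i, by simp, rfl⟩
  have hxj : 𝒟.x j ∈ A := Algebra.subset_adjoin ⟨j, by simp, rfl⟩
  have h1 : orderOf (q i) ≤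
      Module.finrank k (Submodule.span k (Set.range fun a : ℕ => 𝒟.x i ^ a)) := by
    have := h.mul_finrank_le i (Submodule.span k {1})
      (Submodule.span k (Set.range fun a : ℕ => 𝒟.x i ^ a)) (fun a ha => by
        obtain ⟨r, rfl⟩ := Submodule.mem_span_singleton.mp ha
        simp) (fun a ha m => by
        obtain ⟨r, rfl⟩ := Submodule.mem_span_singleton.mp ha
        rw [smul_mul_assoc, one_mul]
        exact Submodule.smul_mem _ _ (Submodule.subset_span ⟨m, rfl⟩))
    rwa [finrank_span_singleton 𝒟.one_ne_zero, mul_one] at this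
  have h2 : orderOf (q j) * orderOf (q i) ≤ Module.finrank k S := by
    refine (Nat.mul_le_mul_left _ h1).trans (h.mul_finrank_le j _ _ (fun a ha => ?_) fun a ha m => ?_)
    · have hle : Submodule.span k (Set.range fun a : ℕ => 𝒟.x i ^ a) ≤
          LinearMap.ker (𝒟.d j) := by
        rw [Submodule.span_le]
        rintro _ ⟨a, rfl⟩
        exact d_x_pow_of_ne (Ne.symm hij) _
      exact hle ha
    · have hle : Submodule.span k (Set.range fun a : ℕ => 𝒟.x i ^ a) ≤
          S.comap (LinearMap.mulRight k (𝒟.x j ^ m)) := by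
        rw [Submodule.span_le]
        rintro _ ⟨a, rfl⟩
        exact Submodule.subset_span ⟨(a, m), rfl⟩
      exact hle ha
  have h3 : Module.finrank k S < Module.finrank k
      (S ⊔ Submodule.span k {𝒟.x j * 𝒟.x i} : Submodule k B) := by
    refine Submodule.finrank_lt_finrank_of_lt (lt_of_le_of_ne le_sup_left fun heq => hmem ?_)
    rw [heq]
    exact Submodule.mem_sup_right (Submodule.mem_span_singleton_self _)
  have h4 := h.prod_mul_finrank_le {i, j} (S ⊔ Submodule.span k {𝒟.x j * 𝒟.x i}) (by
    have hle : S ⊔ Submodule.span k {𝒟.x j * 𝒟.x i} ≤ Subalgebra.toSubmodule A := by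
      rw [sup_le_iff, Submodule.span_le, Submodule.span_le]
      constructor
      · rintro _ ⟨a, rfl⟩
        exact A.mul_mem (A.pow_mem hxi _) (A.pow_mem hxj _)
      · rintro _ rfl
        exact A.mul_mem hxj hxi
    exact fun a ha => hle ha) (Finset.univ \ {i, j}) (by simp)
  have h5 : (∏ l ∈ Finset.univ \ {i, j}, orderOf (q l)) * (orderOf (q i) * orderOf (q j)) =
      Module.finrank k B := by
    rw [← hdim, ← Finset.prod_sdiff (Finset.subset_univ ({i, j} : Finset (Fin n))),
      Finset.prod_pair hij]
  have hpos : 0 < Module.finrank k B :=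
    Module.finrank_pos_iff_exists_ne_zero.mpr ⟨1, 𝒟.one_ne_zero⟩
  have h6 : 0 < ∏ l ∈ Finset.univ \ {i, j}, orderOf (q l) := by
    rcases Nat.eq_zero_or_pos (∏ l ∈ Finset.univ \ {i, j}, orderOf (q l)) with h0 | h0
    · rw [h0, zero_mul] at h5
      omega
    · exact h0
  rw [← h5] at h4
  have h7 := Nat.le_of_mul_le_mul_left h4 h6
  rw [mul_comm (orderOf (q i))] at h7
  omega

/-- The coefficients of `x j * x i` as a combination of ordered monomials: the second derivatives of
both sides, evaluated at `0`. -/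
theorem IsEigen.exists_relation [FiniteDimensional k B] (h : 𝒟.IsEigen q)
    (hdim : ∏ i, orderOf (q i) = Module.finrank k B) {i j : Fin n} (hij : i ≠ j) :
    ∃ α β γ : k, ∀ l,
      (if l = j then 1 else 0) = α * 𝒟.M i l j + β * (if l = i then 1 else 0) ∧
      𝒟.M j l i = α * (if l = i then 1 else 0) + γ * (if l = j then 1 else 0) := by
  obtain ⟨α, β, γ, hrel⟩ := h.relation_of_mem_span hij (h.mul_mem_span hdim hij)
  refine ⟨α, β, γ, fun l => ?_⟩
  have h1 := hrel l
  rw [𝒟.d_mul, 𝒟.d_mul, 𝒟.d_x_self, 𝒟.d_x_self, 𝒟.d_x_of_ne hij, 𝒟.d_x_of_ne (Ne.symm hij),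
    mul_one, zero_mul, add_zero, mul_zero, zero_add, one_mul, ε_d_x, ε_d_g_x] at h1
  exact h1

theorem IsEigen.x_pow_eq_zero (h : 𝒟.IsEigen q) (i : Fin n) (hq : q i ≠ 1)
    (h0 : orderOf (q i) ≠ 0) : 𝒟.x i ^ orderOf (q i) = 0 := by
  refine 𝒟.eq_zero _ (by rw [map_pow, 𝒟.ε_x, zero_pow h0]) fun j => ?_
  by_cases hj : j = i
  · subst hj
    obtain ⟨N, hN⟩ := Nat.exists_eq_succ_of_ne_zero h0
    have h1 := qInt_orderOf hq
    rw [hN] at h1 ⊢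
    rw [h.d_x_pow, h1, zero_smul]
  · exact d_x_pow_of_ne hj _

theorem IsEigen.x_pow_ne_zero (h : 𝒟.IsEigen q) (i : Fin n) {m : ℕ} (hm : m < orderOf (q i)) :
    𝒟.x i ^ m ≠ 0 := by
  induction m with
  | zero => simpa using 𝒟.one_ne_zero
  | succ m ih =>
    intro h0
    have h1 := congrArg (𝒟.d i) h0
    rw [h.d_x_pow, map_zero, smul_eq_zero] at h1
    exact h1.elim (qInt_ne_zero_of_lt (Nat.succ_ne_zero m) hm) (ih (by omega))

theorem finrank_adjoin_singleton_le (u : B) (N : ℕ) (hN : u ^ N = 0) :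
    Module.finrank k (Algebra.adjoin k {u}) ≤ N := by
  set S := Submodule.span k (Set.range fun i : Fin N => u ^ (i : ℕ)) with hS
  have hpow : ∀ m : ℕ, u ^ m ∈ S := by
    intro m
    by_cases hm : m < N
    · exact Submodule.subset_span ⟨⟨m, hm⟩, rfl⟩
    · rw [pow_eq_zero_of_le (not_lt.mp hm) hN]
      exact S.zero_mem
  have hle : Subalgebra.toSubmodule (Algebra.adjoin k {u}) ≤ S := by
    rw [Algebra.adjoin_singleton_eq_range_aeval]
    rintro _ ⟨P, rfl⟩
    change Polynomial.aeval u P ∈ S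
    rw [Polynomial.aeval_eq_sum_range]
    exact Submodule.sum_mem _ fun i _ => S.smul_mem _ (hpow i)
  have : FiniteDimensional k S := FiniteDimensional.span_of_finite k (Set.finite_range _)
  rw [← Subalgebra.finrank_toSubmodule]
  refine (Submodule.finrank_mono hle).trans ?_
  have hcard := finrank_range_le_card (R := k) (fun i : Fin N => u ^ (i : ℕ))
  simpa [Set.finrank] using hcard

end DerivationSystem

/-! ### Systems of rank two with diagonal braiding -/

namespace DerivationSystem

section Diagonal

variable {k : Type*} [Field k] {B : Type*} [Ring B] [Algebra k B] {n : ℕ}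
  (𝒟 : DerivationSystem k B n)

/-- The `g i` act diagonally on the generators, with the matrix `Q`. -/
def IsDiagonal (Q : Fin n → Fin n → k) : Prop := ∀ i l j, 𝒟.M i l j = if l = j then Q i j else 0

/-- The braided adjoint action of the generator `x i`. -/
noncomputable def ad (i : Fin n) : Module.End k B :=
  LinearMap.mulLeft k (𝒟.x i) - LinearMap.mulRight k (𝒟.x i) ∘ₗ (𝒟.g i).toLinearMap

theorem ad_apply (i : Fin n) (b : B) : 𝒟.ad i b = 𝒟.x i * b - 𝒟.g i b * 𝒟.x i := rfl

theorem ad_mul (i : Fin n) (a b : B) : 𝒟.ad i (a * b) = 𝒟.ad i a * b + 𝒟.g i a * 𝒟.ad i b := by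
  simp only [ad_apply, map_mul]
  noncomm_ring

variable {𝒟} {Q : Fin n → Fin n → k}

theorem IsDiagonal.g_x (h : 𝒟.IsDiagonal Q) (i j : Fin n) : 𝒟.g i (𝒟.x j) = Q i j • 𝒟.x j := by
  simp [DerivationSystem.g_x, h i]

theorem IsDiagonal.isEigen (h : 𝒟.IsDiagonal Q) : 𝒟.IsEigen fun i => Q i i where
  g_self i := h.g_x i i
  M_eq_zero i j hij := by simp [h i, hij.symm]

theorem IsDiagonal.g_ad_pow (h : 𝒟.IsDiagonal Q) (l i j : Fin n) (m : ℕ) :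
    𝒟.g l ((𝒟.ad i ^ m) (𝒟.x j)) = (Q l i ^ m * Q l j) • (𝒟.ad i ^ m) (𝒟.x j) := by
  induction m with
  | zero => simp [h.g_x]
  | succ m ih =>
    rw [pow_succ' (𝒟.ad i), Module.End.mul_apply]
    set u := (𝒟.ad i ^ m) (𝒟.x j) with hu
    have hgg : 𝒟.g l (𝒟.g i u) = 𝒟.g i (𝒟.g l u) := by
      have hc : (𝒟.g l).comp (𝒟.g i) = (𝒟.g i).comp (𝒟.g l) := by
        refine AlgHom.ext_of_adjoin_eq_top 𝒟.adjoin_x ?_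
        rintro _ ⟨r, rfl⟩
        simp [h.g_x, smul_smul, mul_comm]
      exact DFunLike.congr_fun hc u
    rw [ad_apply, map_sub, map_mul, map_mul, hgg, ih, h.g_x, map_smul, smul_mul_smul_comm,
      smul_mul_smul_comm, smul_sub]
    congr 2 <;> ring

theorem IsDiagonal.d_ad_pow_self (h : 𝒟.IsDiagonal Q) {i j : Fin n} (hij : i ≠ j) (m : ℕ) :
    𝒟.d i ((𝒟.ad i ^ m) (𝒟.x j)) = 0 := by
  induction m with
  | zero => simp [𝒟.d_x_of_ne hij]
  | succ m ih =>
    rw [pow_succ' (𝒟.ad i), Module.End.mul_apply, ad_apply, h.g_ad_pow, map_sub, 𝒟.d_mul,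
      𝒟.d_mul, map_smul, ih, 𝒟.d_x_self, h.g_ad_pow]
    simp

/-- `∏ (1 - q_ii ^ l q_ij q_ji)` over `l < m`: the derivative along `x j` of `ad (x i) ^ m (x j)` is
this multiple of `x i ^ m`. -/
noncomputable def adCoeff (Q : Fin n → Fin n → k) (i j : Fin n) (m : ℕ) : k :=
  ∏ l ∈ Finset.range m, (1 - Q i i ^ l * (Q i j * Q j i))

theorem adCoeff_succ (Q : Fin n → Fin n → k) (i j : Fin n) (m : ℕ) :
    adCoeff Q i j (m + 1) = adCoeff Q i j m * (1 - Q i i ^ m * (Q i j * Q j i)) :=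
  Finset.prod_range_succ _ _

theorem IsDiagonal.d_ad_pow (h : 𝒟.IsDiagonal Q) {i j : Fin n} (hij : i ≠ j) (m : ℕ) :
    𝒟.d j ((𝒟.ad i ^ m) (𝒟.x j)) = adCoeff Q i j m • 𝒟.x i ^ m := by
  induction m with
  | zero => simp [adCoeff]
  | succ m ih =>
    rw [pow_succ' (𝒟.ad i), Module.End.mul_apply, ad_apply, h.g_ad_pow, map_sub, 𝒟.d_mul,
      𝒟.d_mul, map_smul, ih, 𝒟.d_x_of_ne (Ne.symm hij), h.g_x, adCoeff_succ]
    simp only [mul_smul_comm, smul_mul_assoc, zero_mul, add_zero, mul_zero, zero_add,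
      smul_smul, ← pow_succ, ← pow_succ', ← sub_smul]
    congr 1
    ring

theorem ε_ad_pow (i j : Fin n) (m : ℕ) : 𝒟.ε ((𝒟.ad i ^ m) (𝒟.x j)) = 0 := by
  cases m with
  | zero => simp [𝒟.ε_x]
  | succ m => simp [pow_succ' (𝒟.ad i), ad_apply, 𝒟.ε_x]

theorem IsDiagonal.d_ad_pow_of_ne (h : 𝒟.IsDiagonal Q) {i j l : Fin n} (hi : l ≠ i) (hj : l ≠ j)
    (m : ℕ) : 𝒟.d l ((𝒟.ad i ^ m) (𝒟.x j)) = 0 := by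
  induction m with
  | zero => simp [𝒟.d_x_of_ne hj]
  | succ m ih =>
    rw [pow_succ' (𝒟.ad i), Module.End.mul_apply, ad_apply, h.g_ad_pow, map_sub, 𝒟.d_mul,
      𝒟.d_mul, map_smul, ih, 𝒟.d_x_of_ne hi]
    simp

theorem IsDiagonal.ad_pow_eq_zero_iff (h : 𝒟.IsDiagonal Q) {i j : Fin n} (hij : i ≠ j) (m : ℕ) :
    (𝒟.ad i ^ m) (𝒟.x j) = 0 ↔ adCoeff Q i j m = 0 ∨ 𝒟.x i ^ m = 0 := by
  rw [← smul_eq_zero, ← h.d_ad_pow hij]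
  constructor
  · intro h0
    rw [h0, map_zero]
  · intro h0
    refine 𝒟.eq_zero _ (ε_ad_pow i j m) fun l => ?_
    by_cases hi : l = i
    · rw [hi, h.d_ad_pow_self hij]
    · by_cases hj : l = j
      · rw [hj, h0]
      · exact h.d_ad_pow_of_ne hi hj m

/-- The subalgebra generated by the `ad (x i) ^ m (x j)`, `m ≥ 0`. -/
noncomputable def adSubalgebra (𝒟 : DerivationSystem k B n) (i j : Fin n) : Subalgebra k B :=
  Algebra.adjoin k (Set.range fun m : ℕ => (𝒟.ad i ^ m) (𝒟.x j))

theorem ad_pow_mem_adSubalgebra (i j : Fin n) (m : ℕ) :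
    (𝒟.ad i ^ m) (𝒟.x j) ∈ 𝒟.adSubalgebra i j := Algebra.subset_adjoin ⟨m, rfl⟩

theorem IsDiagonal.g_mem_adSubalgebra (h : 𝒟.IsDiagonal Q) (l i j : Fin n) {a : B}
    (ha : a ∈ 𝒟.adSubalgebra i j) : 𝒟.g l a ∈ 𝒟.adSubalgebra i j := by
  have : 𝒟.adSubalgebra i j ≤ (𝒟.adSubalgebra i j).comap (𝒟.g l) := by
    refine Algebra.adjoin_le ?_
    rintro _ ⟨m, rfl⟩
    change 𝒟.g l ((𝒟.ad i ^ m) (𝒟.x j)) ∈ 𝒟.adSubalgebra i j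
    rw [h.g_ad_pow]
    exact Subalgebra.smul_mem _ (ad_pow_mem_adSubalgebra i j m) _
  exact this ha

theorem IsDiagonal.d_adSubalgebra (h : 𝒟.IsDiagonal Q) {i j : Fin n} (hij : i ≠ j) {a : B}
    (ha : a ∈ 𝒟.adSubalgebra i j) : 𝒟.d i a = 0 := by
  refine mem_of_mul_mem_right (LinearMap.ker (𝒟.d i)) (𝒟.d_one i) ?_ ha
  rintro b hb _ ⟨m, rfl⟩
  rw [LinearMap.mem_ker] at hb ⊢
  rw [𝒟.d_mul, hb, h.d_ad_pow_self hij, mul_zero, zero_mul, add_zero]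

theorem IsDiagonal.ad_mem_adSubalgebra (h : 𝒟.IsDiagonal Q) {i j : Fin n} {a : B}
    (ha : a ∈ 𝒟.adSubalgebra i j) : 𝒟.ad i a ∈ 𝒟.adSubalgebra i j := by
  have : a ∈ Subalgebra.toSubmodule (𝒟.adSubalgebra i j) ⊓
      (Subalgebra.toSubmodule (𝒟.adSubalgebra i j)).comap (𝒟.ad i) := by
    refine mem_of_mul_mem_right _ (Submodule.mem_inf.mpr ⟨Subalgebra.one_mem _, ?_⟩) ?_ ha
    · change 𝒟.ad i 1 ∈ 𝒟.adSubalgebra i j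
      rw [ad_apply, map_one, mul_one, one_mul, sub_self]
      exact Subalgebra.zero_mem _
    · rintro b ⟨hb, hb'⟩ _ ⟨m, rfl⟩
      refine ⟨Subalgebra.mul_mem _ hb (ad_pow_mem_adSubalgebra i j m), ?_⟩
      change 𝒟.ad i (b * (𝒟.ad i ^ m) (𝒟.x j)) ∈ 𝒟.adSubalgebra i j
      rw [ad_mul, ← Module.End.mul_apply (𝒟.ad i), ← pow_succ']
      exact Subalgebra.add_mem _ (Subalgebra.mul_mem _ hb' (ad_pow_mem_adSubalgebra i j m))
        (Subalgebra.mul_mem _ (h.g_mem_adSubalgebra i i j hb) (ad_pow_mem_adSubalgebra i j _))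
  exact this.2

/-- For two generators, the algebra is the product of the subalgebra generated by the
`ad (x i) ^ m (x j)` and of the truncated polynomial algebra generated by `x i`. -/
theorem IsDiagonal.finrank_eq_mul [FiniteDimensional k B] (h : 𝒟.IsDiagonal Q) {i j : Fin n}
    (hij : i ≠ j) (huniv : ∀ l, l = i ∨ l = j) (hq : Q i i ≠ 1) (h0 : orderOf (Q i i) ≠ 0) :
    Module.finrank k B = orderOf (Q i i) * Module.finrank k (𝒟.adSubalgebra i j) := by
  set A := 𝒟.adSubalgebra i j with hA
  set N := orderOf (Q i i) with hN
  refine le_antisymm ?_ ?_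
  · have hxN : 𝒟.x i ^ N = 0 := h.isEigen.x_pow_eq_zero i hq h0
    let Φ : (Fin N → A) →ₗ[k] B :=
      { toFun := fun f => ∑ m : Fin N, (f m : B) * 𝒟.x i ^ (m : ℕ)
        map_add' := fun f f' => by simp [Finset.sum_add_distrib, add_mul]
        map_smul' := fun r f => by simp [Finset.smul_sum] }
    have hmem : ∀ a ∈ A, ∀ m : ℕ, a * 𝒟.x i ^ m ∈ LinearMap.range Φ := by
      intro a ha m
      by_cases hm : m < N
      · refine ⟨fun l => if (l : ℕ) = m then ⟨a, ha⟩ else 0, ?_⟩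
        change ∑ l : Fin N, _ = _
        rw [Finset.sum_eq_single ⟨m, hm⟩]
        · simp
        · intro l _ hl
          have : (l : ℕ) ≠ m := fun h => hl (Fin.ext h)
          simp [this]
        · simp
      · rw [pow_eq_zero_of_le (not_lt.mp hm) hxN, mul_zero]
        exact Submodule.zero_mem _
    have htop : LinearMap.range Φ = ⊤ := by
      rw [eq_top_iff]
      intro b _
      have hb : b ∈ Algebra.adjoin k (Set.range 𝒟.x) := 𝒟.adjoin_x ▸ Algebra.mem_top
      refine mem_of_mul_mem_left (LinearMap.range Φ) ?_ ?_ hb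
      · simpa using hmem 1 A.one_mem 0
      · rintro _ ⟨f, rfl⟩ _ ⟨l, rfl⟩
        change 𝒟.x l * ∑ m : Fin N, (f m : B) * 𝒟.x i ^ (m : ℕ) ∈ _
        rw [Finset.mul_sum]
        refine Submodule.sum_mem _ fun m _ => ?_
        rcases huniv l with rfl | rfl
        · have hcomm : 𝒟.x l * ((f m : B) * 𝒟.x l ^ (m : ℕ)) =
              𝒟.ad l (f m) * 𝒟.x l ^ (m : ℕ) + 𝒟.g l (f m) * 𝒟.x l ^ ((m : ℕ) + 1) := by
            rw [ad_apply, pow_succ', sub_mul, ← mul_assoc, ← mul_assoc, sub_add_cancel]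
          rw [hcomm]
          exact Submodule.add_mem _ (hmem _ (h.ad_mem_adSubalgebra (f m).2) _)
            (hmem _ (h.g_mem_adSubalgebra _ _ _ (f m).2) _)
        · rw [← mul_assoc]
          exact hmem _ (A.mul_mem (ad_pow_mem_adSubalgebra i l 0) (f m).2) _
    have h1 := LinearMap.finrank_range_le Φ
    rw [htop, finrank_top] at h1
    simpa [Module.finrank_pi_fintype] using h1
  · have h1 := h.isEigen.mul_finrank_le i (Subalgebra.toSubmodule A) ⊤
      (fun a ha => h.d_adSubalgebra hij ha) (fun _ _ _ => trivial)
    rw [finrank_top] at h1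
    exact h1

variable (𝒟) in
/-- The derivation `d_i ^ m ∘ d_j`, dual to `ad (x i) ^ m (x j)`. -/
noncomputable def dRoot (i j : Fin n) (m : ℕ) : Module.End k B := 𝒟.d i ^ m * 𝒟.d j

variable (𝒟) in
/-- The endomorphism which twists `dRoot`. -/
noncomputable def gRoot (i j : Fin n) (m : ℕ) : B →ₐ[k] B := 𝒟.g i ^ m * 𝒟.g j

/-- The scalar by which `gRoot` acts on `ad (x i) ^ m (x j)`. -/
noncomputable def qRoot (Q : Fin n → Fin n → k) (i j : Fin n) (m : ℕ) : k :=
  (Q i i ^ m * Q i j) ^ m * (Q j i ^ m * Q j j)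

theorem IsDiagonal.gRoot_ad_pow (h : 𝒟.IsDiagonal Q) (i j : Fin n) (m l : ℕ) :
    𝒟.gRoot i j m ((𝒟.ad i ^ l) (𝒟.x j)) =
      ((Q i i ^ l * Q i j) ^ m * (Q j i ^ l * Q j j)) • (𝒟.ad i ^ l) (𝒟.x j) := by
  rw [gRoot, AlgHom.mul_apply, h.g_ad_pow, map_smul,
    mul_comm ((Q i i ^ l * Q i j) ^ m), mul_smul (Q j i ^ l * Q j j)]
  congr 1
  induction m with
  | zero => simp
  | succ m ih => rw [pow_succ', AlgHom.mul_apply, ih, map_smul, h.g_ad_pow, smul_smul, ← pow_succ]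

theorem IsDiagonal.gRoot_mem_adSubalgebra (h : 𝒟.IsDiagonal Q) (i j : Fin n) (m : ℕ) {a : B}
    (ha : a ∈ 𝒟.adSubalgebra i j) : 𝒟.gRoot i j m a ∈ 𝒟.adSubalgebra i j := by
  rw [gRoot, AlgHom.mul_apply]
  have h1 := h.g_mem_adSubalgebra j i j ha
  induction m with
  | zero => simpa using h1
  | succ m ih =>
    rw [pow_succ', AlgHom.mul_apply]
    exact h.g_mem_adSubalgebra i i j ih

theorem IsDiagonal.dRoot_mul (h : 𝒟.IsDiagonal Q) {i j : Fin n} (hij : i ≠ j) (m : ℕ) {a b : B}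
    (ha : a ∈ 𝒟.adSubalgebra i j) (hb : b ∈ 𝒟.adSubalgebra i j) :
    𝒟.dRoot i j m (a * b) = a * 𝒟.dRoot i j m b + 𝒟.dRoot i j m a * 𝒟.gRoot i j m b := by
  induction m with
  | zero => simp [dRoot, gRoot, 𝒟.d_mul]
  | succ m ih =>
    have hd : ∀ z, 𝒟.dRoot i j (m + 1) z = 𝒟.d i (𝒟.dRoot i j m z) := fun z => by
      rw [dRoot, pow_succ', mul_assoc, Module.End.mul_apply, dRoot]
    have hg : 𝒟.gRoot i j (m + 1) b = 𝒟.g i (𝒟.gRoot i j m b) := by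
      rw [gRoot, pow_succ', mul_assoc, AlgHom.mul_apply, gRoot]
    rw [hd, ih, map_add, 𝒟.d_mul, 𝒟.d_mul, h.d_adSubalgebra hij ha,
      h.d_adSubalgebra hij (h.gRoot_mem_adSubalgebra i j m hb), hd, hd, hg]
    simp

theorem IsDiagonal.dRoot_ad_pow (h : 𝒟.IsDiagonal Q) {i j : Fin n} (hij : i ≠ j) (m l : ℕ)
    (hlm : l ≤ m) : 𝒟.dRoot i j m ((𝒟.ad i ^ l) (𝒟.x j)) = if m = l then
      algebraMap k B (adCoeff Q i j m * ∏ z ∈ Finset.range m, qInt (Q i i) (m - z)) else 0 := by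
  have h1 := pow_apply_pow_of_lower (𝒟.d i) (LinearMap.mulRight k (𝒟.x i)) (qInt (Q i i)) 1
    (𝒟.d_one i) (fun r => lower_pow _ _ _ 1 (𝒟.d_one i) (fun _ => h.isEigen.d_mul_x i _) r) m l
  simp only [mulRight_pow_apply, one_mul] at h1
  rw [dRoot, Module.End.mul_apply, h.d_ad_pow hij, map_smul, h1]
  by_cases hml : m = l
  · subst hml
    simp [Algebra.algebraMap_eq_smul_one, smul_smul]
  · rw [if_neg hml, if_neg (by omega), smul_zero]

end Diagonal

end DerivationSystem

namespace DerivationSystem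

section RankTwo

variable {k : Type*} [Field k] {B : Type*} [Ring B] [Algebra k B] {n : ℕ}
  {𝒟 : DerivationSystem k B n} {Q : Fin n → Fin n → k}

/-- If `u = ad (x i) ^ m (x j)` is nonzero, then `dRoot`, suitably normalized, is a twisted
derivation with value `1` on `u` and `0` on the lower powers of `ad (x i)`. -/
theorem IsDiagonal.exists_rootDerivation (h : 𝒟.IsDiagonal Q) {i j : Fin n} (hij : i ≠ j)
    (hq : Q i i ≠ 1) (h0 : orderOf (Q i i) ≠ 0) {m : ℕ} (hm : (𝒟.ad i ^ m) (𝒟.x j) ≠ 0) :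
    ∃ D : Module.End k B,
      (∀ a ∈ 𝒟.adSubalgebra i j, ∀ b ∈ 𝒟.adSubalgebra i j,
        D (a * b) = a * D b + D a * 𝒟.gRoot i j m b) ∧
      D ((𝒟.ad i ^ m) (𝒟.x j)) = 1 ∧ ∀ l < m, D ((𝒟.ad i ^ l) (𝒟.x j)) = 0 := by
  rw [Ne, h.ad_pow_eq_zero_iff hij, not_or] at hm
  have hlt : m < orderOf (Q i i) := by
    by_contra hle
    exact hm.2 (pow_eq_zero_of_le (not_lt.mp hle) (h.isEigen.x_pow_eq_zero i hq h0))
  set β : k := adCoeff Q i j m * ∏ z ∈ Finset.range m, qInt (Q i i) (m - z) with hβ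
  have hβ0 : β ≠ 0 := by
    refine mul_ne_zero hm.1 (Finset.prod_ne_zero_iff.mpr fun z hz => ?_)
    rw [Finset.mem_range] at hz
    exact qInt_ne_zero_of_lt (by omega) (by omega)
  refine ⟨β⁻¹ • 𝒟.dRoot i j m, fun a ha b hb => ?_, ?_, fun l hl => ?_⟩
  · rw [LinearMap.smul_apply, h.dRoot_mul hij m ha hb, smul_add, LinearMap.smul_apply,
      LinearMap.smul_apply, mul_smul_comm, smul_mul_assoc]
  · rw [LinearMap.smul_apply, h.dRoot_ad_pow hij m m le_rfl, if_pos rfl, ← hβ,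
      Algebra.algebraMap_eq_smul_one, smul_smul, inv_mul_cancel₀ hβ0, one_smul]
  · rw [LinearMap.smul_apply, h.dRoot_ad_pow hij m l hl.le, if_neg (by omega), smul_zero]

theorem IsDiagonal.qRoot_eq (h : 𝒟.IsDiagonal Q) (i j : Fin n) (m : ℕ) :
    𝒟.gRoot i j m ((𝒟.ad i ^ m) (𝒟.x j)) = qRoot Q i j m • (𝒟.ad i ^ m) (𝒟.x j) :=
  h.gRoot_ad_pow i j m m

theorem IsDiagonal.qRoot_ne_one [CharZero k] [FiniteDimensional k B] (h : 𝒟.IsDiagonal Q)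
    {i j : Fin n} (hij : i ≠ j) (hq : Q i i ≠ 1) (h0 : orderOf (Q i i) ≠ 0) {m : ℕ}
    (hm : (𝒟.ad i ^ m) (𝒟.x j) ≠ 0) : qRoot Q i j m ≠ 1 := by
  obtain ⟨D, hD, hDu, -⟩ := h.exists_rootDerivation hij hq h0 hm
  have hu := ad_pow_mem_adSubalgebra (𝒟 := 𝒟) i j m
  refine ne_one_of_lower D (LinearMap.mulRight k ((𝒟.ad i ^ m) (𝒟.x j))) _ 1 𝒟.one_ne_zero ?_
    fun l => ?_
  · have := hD 1 (Subalgebra.one_mem _) 1 (Subalgebra.one_mem _)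
    simpa using this
  · rw [mulRight_pow_apply, one_mul, LinearMap.mulRight_apply,
      hD _ (Subalgebra.pow_mem _ hu l) _ hu, hDu, mul_one, h.qRoot_eq, mul_smul_comm,
      LinearMap.mulRight_apply]

/-- The powers of the root vector `ad (x i) ^ m (x j)` give independent copies of a subalgebra
generated by lower root vectors. -/
theorem IsDiagonal.mul_finrank_le_root [FiniteDimensional k B] (h : 𝒟.IsDiagonal Q)
    {i j : Fin n} (hij : i ≠ j) (hq : Q i i ≠ 1) (h0 : orderOf (Q i i) ≠ 0) {m : ℕ}
    (hm : (𝒟.ad i ^ m) (𝒟.x j) ≠ 0) (L : ℕ) (hL : ∀ l, l + 1 < L → qInt (qRoot Q i j m) (l + 1) ≠ 0)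
    (s : Set ℕ) (hs : ∀ l ∈ s, l < m) (S' : Subalgebra k B)
    (hS : Algebra.adjoin k ((fun l : ℕ => (𝒟.ad i ^ l) (𝒟.x j)) '' s) ≤ S')
    (hS' : (𝒟.ad i ^ m) (𝒟.x j) ∈ S') :
    L * Module.finrank k (Algebra.adjoin k ((fun l : ℕ => (𝒟.ad i ^ l) (𝒟.x j)) '' s)) ≤
      Module.finrank k S' := by
  obtain ⟨D, hD, hDu, hDl⟩ := h.exists_rootDerivation hij hq h0 hm
  have hu := ad_pow_mem_adSubalgebra (𝒟 := 𝒟) i j m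
  have hkill : ∀ a ∈ Algebra.adjoin k ((fun l : ℕ => (𝒟.ad i ^ l) (𝒟.x j)) '' s),
      a ∈ 𝒟.adSubalgebra i j ∧ D a = 0 := by
    intro a ha
    have : a ∈ Subalgebra.toSubmodule (𝒟.adSubalgebra i j) ⊓ LinearMap.ker D := by
      refine mem_of_mul_mem_right _ (Submodule.mem_inf.mpr ⟨Subalgebra.one_mem _, ?_⟩) ?_ ha
      · have := hD 1 (Subalgebra.one_mem _) 1 (Subalgebra.one_mem _)
        simpa using this
      · rintro b ⟨hb, hb'⟩ _ ⟨l, hl, rfl⟩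
        refine ⟨Subalgebra.mul_mem _ hb (ad_pow_mem_adSubalgebra i j l), ?_⟩
        change D b = 0 at hb'
        change D (b * (𝒟.ad i ^ l) (𝒟.x j)) = 0
        rw [hD _ hb _ (ad_pow_mem_adSubalgebra i j l), hDl l (hs l hl), hb', mul_zero, zero_mul,
          add_zero]
    exact this
  refine NicholsAlg.mul_finrank_le D (LinearMap.mulRight k ((𝒟.ad i ^ m) (𝒟.x j)))
    (qInt (qRoot Q i j m)) (Subalgebra.toSubmodule
      (Algebra.adjoin k ((fun l : ℕ => (𝒟.ad i ^ l) (𝒟.x j)) '' s))) (Subalgebra.toSubmodule S') L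
    (fun a ha => (hkill a ha).2) (fun a ha => lower_pow _ _ _ a (hkill a ha).2 fun l => ?_) hL
    (fun a ha l _ => ?_)
  · rw [mulRight_pow_apply, LinearMap.mulRight_apply,
      hD _ (Subalgebra.mul_mem _ (hkill a ha).1 (Subalgebra.pow_mem _ hu l)) _ hu, hDu, mul_one,
      h.qRoot_eq, mul_smul_comm, LinearMap.mulRight_apply]
  · rw [mulRight_pow_apply]
    exact S'.mul_mem (hS ha) (S'.pow_mem hS' l)

/-- Freeness over the root vector of the highest root. -/
theorem IsDiagonal.orderOf_qRoot_dvd [CharZero k] [FiniteDimensional k B] (h : 𝒟.IsDiagonal Q)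
    {i j : Fin n} (hij : i ≠ j) (hq : Q i i ≠ 1) (h0 : orderOf (Q i i) ≠ 0) {m : ℕ}
    (hm : (𝒟.ad i ^ m) (𝒟.x j) ≠ 0) (hm' : (𝒟.ad i ^ (m + 1)) (𝒟.x j) = 0)
    (hfin : orderOf (qRoot Q i j m) ≠ 0) :
    orderOf (qRoot Q i j m) ∣ Module.finrank k (𝒟.adSubalgebra i j) := by
  obtain ⟨D, hD, hDu, hDl⟩ := h.exists_rootDerivation hij hq h0 hm
  refine orderOf_dvd_finrank_adjoin _ D (𝒟.gRoot i j m) ((𝒟.ad i ^ m) (𝒟.x j)) _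
    (ad_pow_mem_adSubalgebra i j m) hD ?_ hDu (h.qRoot_eq i j m) ?_
    (h.qRoot_ne_one hij hq h0 hm) hfin
  · rintro _ ⟨l, rfl⟩
    exact h.gRoot_mem_adSubalgebra i j m (ad_pow_mem_adSubalgebra i j l)
  · rintro _ ⟨l, rfl⟩
    dsimp only
    rcases lt_trichotomy l m with hl | rfl | hl
    · refine Or.inr fun r => ?_
      suffices ∃ c : k, (𝒟.gRoot i j m ^ r) ((𝒟.ad i ^ l) (𝒟.x j)) = c • (𝒟.ad i ^ l) (𝒟.x j) by
        obtain ⟨c, hc⟩ := this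
        rw [hc, map_smul, hDl l hl, smul_zero]
      induction r with
      | zero => exact ⟨1, by simp⟩
      | succ r ih =>
        obtain ⟨c, hc⟩ := ih
        exact ⟨_, by rw [pow_succ', AlgHom.mul_apply, hc, map_smul, h.gRoot_ad_pow, smul_smul]⟩
    · exact Or.inl rfl
    · refine Or.inr fun r => ?_
      obtain ⟨t, rfl⟩ : ∃ t, l = t + (m + 1) := ⟨l - (m + 1), by omega⟩
      rw [pow_add, Module.End.mul_apply, hm', map_zero, map_zero, map_zero]

/-- In rank two, if both generators have order `p` and the dimension is `p ^ 3`, then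
`ad (x i) (x j)` is the only root vector besides the generators. -/
theorem IsDiagonal.rank_two [CharZero k] [FiniteDimensional k B] (h : 𝒟.IsDiagonal Q)
    (hQ : ∀ a b, IsOfFinOrder (Q a b)) {i j : Fin n} (hij : i ≠ j) (huniv : ∀ l, l = i ∨ l = j)
    {p : ℕ} (hp : p.Prime) (hi : orderOf (Q i i) = p) (hj : orderOf (Q j j) = p)
    (hdim : Module.finrank k B = p ^ 3) :
    (𝒟.ad i ^ 1) (𝒟.x j) ≠ 0 ∧ (𝒟.ad i ^ 2) (𝒟.x j) = 0 ∧ orderOf (qRoot Q i j 1) = p := by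
  have hq : Q i i ≠ 1 := fun h1 => hp.ne_one (by rw [← hi, h1, orderOf_one])
  have h0 : orderOf (Q i i) ≠ 0 := by rw [hi]; exact hp.ne_zero
  have hqj : Q j j ≠ 1 := fun h1 => hp.ne_one (by rw [← hj, h1, orderOf_one])
  have h0j : orderOf (Q j j) ≠ 0 := by rw [hj]; exact hp.ne_zero
  have hA : Module.finrank k (𝒟.adSubalgebra i j) = p ^ 2 := by
    have := h.finrank_eq_mul hij huniv hq h0
    rw [hdim, hi, pow_succ'] at this
    exact (Nat.eq_of_mul_eq_mul_left hp.pos this).symm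
  -- the highest power `M` of `ad (x i)` which does not kill `x j`
  have hex : ∃ m, (𝒟.ad i ^ m) (𝒟.x j) = 0 :=
    ⟨p, (h.ad_pow_eq_zero_iff hij p).mpr (Or.inr (hi ▸ h.isEigen.x_pow_eq_zero i hq h0))⟩
  classical
  obtain ⟨M, hM⟩ : ∃ M, Nat.find hex = M + 1 := by
    refine Nat.exists_eq_succ_of_ne_zero fun hz => ?_
    have := Nat.find_spec hex
    rw [hz] at this
    exact 𝒟.x_ne_zero j (by simpa using this)
  have hM0 : (𝒟.ad i ^ (M + 1)) (𝒟.x j) = 0 := hM ▸ Nat.find_spec hex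
  have hlow : ∀ m ≤ M, (𝒟.ad i ^ m) (𝒟.x j) ≠ 0 := fun m hm => Nat.find_min hex (by omega)
  have hfin : ∀ m, orderOf (qRoot Q i j m) ≠ 0 := fun m =>
    (orderOf_pos_iff.mpr ((((hQ i i).pow.mul (hQ i j)).pow).mul ((hQ j i).pow.mul (hQ j j)))).ne'
  have hdvd := h.orderOf_qRoot_dvd hij hq h0 (hlow M le_rfl) hM0 (hfin M)
  rw [hA] at hdvd
  have hge : orderOf (qRoot Q i j M) = p ∨ orderOf (qRoot Q i j M) = p ^ 2 := by
    obtain ⟨e, he, he'⟩ := (Nat.dvd_prime_pow hp).mp hdvd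
    interval_cases e
    · exact absurd (orderOf_eq_one_iff.mp (by simpa using he'))
        (h.qRoot_ne_one hij hq h0 (hlow M le_rfl))
    · exact Or.inl (by simpa using he')
    · exact Or.inr he'
  have hp2 := hp.two_le
  have hgeM : p ≤ orderOf (qRoot Q i j M) := by
    rcases hge with h1 | h1 <;> rw [h1]
    nlinarith
  -- the subalgebra generated by `x j` alone
  set A₀ := Algebra.adjoin k ((fun l : ℕ => (𝒟.ad i ^ l) (𝒟.x j)) '' {0}) with hA₀
  have himg : (fun l : ℕ => (𝒟.ad i ^ l) (𝒟.x j)) '' {0} = {𝒟.x j} := by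
    rw [Set.image_singleton]
    simp
  have hA₀p : p ≤ Module.finrank k A₀ := by
    have := h.isEigen.mul_finrank_le j (Submodule.span k {1}) (Subalgebra.toSubmodule A₀)
      (fun a ha => by
        obtain ⟨r, rfl⟩ := Submodule.mem_span_singleton.mp ha
        simp) (fun a ha m => by
        obtain ⟨r, rfl⟩ := Submodule.mem_span_singleton.mp ha
        rw [smul_mul_assoc, one_mul]
        refine Submodule.smul_mem _ _ (Subalgebra.pow_mem A₀ ?_ m)
        rw [hA₀, himg]
        exact Algebra.subset_adjoin rfl)
    rwa [finrank_span_singleton 𝒟.one_ne_zero, mul_one, hj] at this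
  have hsub : ∀ s : Set ℕ, Algebra.adjoin k ((fun l : ℕ => (𝒟.ad i ^ l) (𝒟.x j)) '' s) ≤
      𝒟.adSubalgebra i j := fun s => Algebra.adjoin_mono (Set.image_subset_range _ _)
  have hqne : ∀ m l, l + 1 < orderOf (qRoot Q i j m) → qInt (qRoot Q i j m) (l + 1) ≠ 0 :=
    fun m l hl => qInt_ne_zero_of_lt (Nat.succ_ne_zero l) hl
  obtain rfl : M = 1 := by
    rcases Nat.lt_trichotomy M 1 with hM1 | hM1 | hM1
    · -- for `M = 0` the subalgebra is generated by `x j`, and is too small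
      exfalso
      obtain rfl : M = 0 := by omega
      have hle : 𝒟.adSubalgebra i j ≤ Algebra.adjoin k {𝒟.x j} := by
        refine Algebra.adjoin_le ?_
        rintro _ ⟨m, rfl⟩
        rcases m with _ | m
        · exact Algebra.subset_adjoin (by simp)
        · dsimp only
          rw [pow_add, Module.End.mul_apply, show (𝒟.ad i ^ 1) (𝒟.x j) = 0 from hM0, map_zero]
          exact Subalgebra.zero_mem _
      have h1 : Module.finrank k (𝒟.adSubalgebra i j) ≤ p :=
        (Submodule.finrank_mono (s := Subalgebra.toSubmodule (𝒟.adSubalgebra i j))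
          (t := Subalgebra.toSubmodule (Algebra.adjoin k {𝒟.x j})) hle).trans
          (finrank_adjoin_singleton_le _ _ (hj ▸ h.isEigen.x_pow_eq_zero j hqj h0j))
      rw [hA] at h1
      nlinarith
    · exact hM1
    · -- for `M ≥ 2` the powers of the root vectors `x j`, `ad (x i) (x j)`, `ad (x i) ^ M (x j)` give too much
      exfalso
      have h1 := h.mul_finrank_le_root hij hq h0 (hlow 1 hM1.le) 2
        (fun l hl => by
          obtain rfl : l = 0 := by omega
          simp) {0} (by simp)
        (Algebra.adjoin k ((fun l : ℕ => (𝒟.ad i ^ l) (𝒟.x j)) '' {0, 1}))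
        (Algebra.adjoin_mono (Set.image_mono (by simp)))
        (Algebra.subset_adjoin ⟨1, by simp, rfl⟩)
      have h2 := h.mul_finrank_le_root hij hq h0 (hlow M le_rfl) _ (hqne M) {0, 1}
        (by
          rintro l (rfl | rfl)
          · omega
          · exact hM1) (𝒟.adSubalgebra i j) (hsub _) (ad_pow_mem_adSubalgebra i j M)
      rw [hA] at h2
      have h3 : p * (2 * p) ≤ p ^ 2 :=
        (Nat.mul_le_mul hgeM ((Nat.mul_le_mul_left 2 hA₀p).trans h1)).trans h2
      nlinarith
  refine ⟨hlow 1 le_rfl, hM0, ?_⟩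
  have h1 := h.mul_finrank_le_root hij hq h0 (hlow 1 le_rfl) _ (hqne 1) {0} (by simp)
    (𝒟.adSubalgebra i j) (hsub _) (ad_pow_mem_adSubalgebra i j 1)
  rw [hA] at h1
  rcases hge with h2 | h2
  · exact h2
  · exfalso
    rw [h2] at h1
    have h3 : p ^ 2 * p ≤ p ^ 2 := (Nat.mul_le_mul_left _ hA₀p).trans h1
    have h4 : 0 < p ^ 2 := pow_pos hp.pos 2
    nlinarith

/-- The entries of the braiding matrix of a system of rank two and dimension `p ^ 3` whose
generators have order `p` are those of type `A₂`. -/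
theorem IsDiagonal.rank_two_matrix [CharZero k] [FiniteDimensional k B] (h : 𝒟.IsDiagonal Q)
    (hQ : ∀ a b, IsOfFinOrder (Q a b)) {i j : Fin n} (hij : i ≠ j) (huniv : ∀ l, l = i ∨ l = j)
    {p : ℕ} (hp : p.Prime) (hi : orderOf (Q i i) = p) (hj : orderOf (Q j j) = p)
    (hdim : Module.finrank k B = p ^ 3) : Q i i * (Q i j * Q j i) = 1 := by
  obtain ⟨h1, h2, h3⟩ := h.rank_two hQ hij huniv hp hi hj hdim
  have hq : Q i i ≠ 1 := fun h1 => hp.ne_one (by rw [← hi, h1, orderOf_one])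
  rcases hp.eq_two_or_odd' with rfl | hodd
  · -- here `q_ii = q_jj = -1`, and the root vector has order `2` as well
    have hneg : ∀ z : k, orderOf z = 2 → z = -1 := fun z hz => by
      have hz2 : z ^ 2 = 1 := hz ▸ pow_orderOf_eq_one z
      rw [sq] at hz2
      refine (mul_self_eq_one_iff.mp hz2).resolve_left ?_
      rintro rfl
      simp at hz
    have h4 := hneg _ h3
    rw [qRoot, pow_one, pow_one, pow_one, hneg _ hi, hneg _ hj] at h4
    rw [hneg _ hi]
    linear_combination -h4
  · -- for odd `p` the square of `x i` is nonzero, so the last factor of `adCoeff Q i j 2` vanishes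
    rw [Ne, h.ad_pow_eq_zero_iff hij, not_or] at h1
    rw [h.ad_pow_eq_zero_iff hij] at h2
    have hx : 𝒟.x i ^ 2 ≠ 0 := h.isEigen.x_pow_ne_zero i (by
      rw [hi]
      have := hp.two_le
      rcases hodd with ⟨e, he⟩
      omega)
    have h4 := h2.resolve_right hx
    rw [adCoeff_succ, mul_eq_zero] at h4
    have h5 := h4.resolve_left h1.1
    rw [pow_one, sub_eq_zero] at h5
    exact h5.symm

end RankTwo

end DerivationSystem

/-! ### Twisted derivations of the tensor algebra -/

section TensorAlgebra

variable {k : Type*} [Field k] {V : Type*} [AddCommGroup V] [Module k V]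

theorem tensorAlgebra_mem_of_mul_ι_mem (S : Submodule k (TensorAlgebra k V)) (h1 : 1 ∈ S)
    (hS : ∀ a ∈ S, ∀ v, a * TensorAlgebra.ι k v ∈ S) (a : TensorAlgebra k V) : a ∈ S := by
  refine mem_of_mul_mem_right (s := Set.range (TensorAlgebra.ι k (M := V))) S h1 ?_ ?_
  · rintro b hb _ ⟨v, rfl⟩
    exact hS b hb v
  · rw [TensorAlgebra.adjoin_range_ι]
    exact Algebra.mem_top

theorem tensorAlgebra_mem_of_ι_mul_mem (S : Submodule k (TensorAlgebra k V)) (h1 : 1 ∈ S)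
    (hS : ∀ a ∈ S, ∀ v, TensorAlgebra.ι k v * a ∈ S) (a : TensorAlgebra k V) : a ∈ S := by
  refine mem_of_mul_mem_left (s := Set.range (TensorAlgebra.ι k (M := V))) S h1 ?_ ?_
  · rintro b hb _ ⟨v, rfl⟩
    exact hS b hb v
  · rw [TensorAlgebra.adjoin_range_ι]
    exact Algebra.mem_top

/-- The morphism from the tensor algebra to upper triangular matrices which is the identity and `γ`
on the diagonal; its upper right corner is the derivation twisted by `γ` which extends the
functional `f`. -/
noncomputable def triangularLift (γ : TensorAlgebra k V →ₐ[k] TensorAlgebra k V) (f : V →ₗ[k] k) :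
    TensorAlgebra k V →ₐ[k] Matrix (Fin 2) (Fin 2) (TensorAlgebra k V) :=
  TensorAlgebra.lift k
    { toFun := fun v => !![TensorAlgebra.ι k v, algebraMap k _ (f v); 0, γ (TensorAlgebra.ι k v)]
      map_add' := fun v w => by
        ext i j
        fin_cases i <;> fin_cases j <;> simp
      map_smul' := fun r v => by
        ext i j
        fin_cases i <;> fin_cases j <;> simp [Algebra.smul_def] }

theorem triangularLift_ι (γ : TensorAlgebra k V →ₐ[k] TensorAlgebra k V) (f : V →ₗ[k] k) (v : V) :
    triangularLift γ f (TensorAlgebra.ι k v) =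
      !![TensorAlgebra.ι k v, algebraMap k _ (f v); 0, γ (TensorAlgebra.ι k v)] :=
  TensorAlgebra.lift_ι_apply _ _

theorem triangularLift_entries (γ : TensorAlgebra k V →ₐ[k] TensorAlgebra k V) (f : V →ₗ[k] k)
    (a : TensorAlgebra k V) : triangularLift γ f a 0 0 = a ∧ triangularLift γ f a 1 0 = 0 ∧
      triangularLift γ f a 1 1 = γ a := by
  induction a using TensorAlgebra.induction with
  | algebraMap r => simp [Matrix.algebraMap_matrix_apply]
  | ι v => simp [triangularLift_ι]
  | mul a b ha hb => simp [Matrix.mul_apply, Fin.sum_univ_two, ha, hb]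
  | add a b ha hb => simp [ha, hb]

/-- The derivation of the tensor algebra twisted by `γ` which extends the functional `f`. -/
noncomputable def twistedDer (γ : TensorAlgebra k V →ₐ[k] TensorAlgebra k V) (f : V →ₗ[k] k) :
    Module.End k (TensorAlgebra k V) where
  toFun a := triangularLift γ f a 0 1
  map_add' a b := by simp
  map_smul' r a := by simp

theorem twistedDer_mul (γ : TensorAlgebra k V →ₐ[k] TensorAlgebra k V) (f : V →ₗ[k] k)
    (a b : TensorAlgebra k V) :
    twistedDer γ f (a * b) = a * twistedDer γ f b + twistedDer γ f a * γ b := by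
  have ha := triangularLift_entries γ f a
  have hb := triangularLift_entries γ f b
  simp [twistedDer, Matrix.mul_apply, Fin.sum_univ_two, ha, hb]

theorem twistedDer_ι (γ : TensorAlgebra k V →ₐ[k] TensorAlgebra k V) (f : V →ₗ[k] k) (v : V) :
    twistedDer γ f (TensorAlgebra.ι k v) = algebraMap k _ (f v) := by
  simp [twistedDer, triangularLift_ι]

@[simp] theorem twistedDer_one (γ : TensorAlgebra k V →ₐ[k] TensorAlgebra k V) (f : V →ₗ[k] k) :
    twistedDer γ f 1 = 0 := by
  simp [twistedDer]

theorem twistedDer_mul_ι (γ : TensorAlgebra k V →ₐ[k] TensorAlgebra k V) (f : V →ₗ[k] k)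
    (a : TensorAlgebra k V) (v : V) : twistedDer γ f (a * TensorAlgebra.ι k v) =
      f v • a + twistedDer γ f a * γ (TensorAlgebra.ι k v) := by
  rw [twistedDer_mul, twistedDer_ι, ← Algebra.commutes, ← Algebra.smul_def]

end TensorAlgebra

/-! ### The defining ideal of the Nichols algebra -/

section DefiningIdeal

variable {k : Type*} [Field k] {V : Type*} [AddCommGroup V] [Module k V] {n : ℕ}
  (x : Module.Basis (Fin n) k V) (g : Fin n → (V ≃ₗ[k] V))

/-- The compatibility of the `g i` with the grading of `V` in which `x j` has degree `g j`: if `x l`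
occurs in `g i (x j)`, then `g l = g i * g j * (g i)⁻¹`. -/
def IsYetterDrinfeld : Prop :=
  ∀ i j l, x.repr (g i (x j)) l ≠ 0 → g l * g i = g i * g j

/-- The action of `g i` on the tensor algebra. -/
noncomputable def gAct (i : Fin n) : TensorAlgebra k V →ₐ[k] TensorAlgebra k V :=
  TensorAlgebra.lift k (TensorAlgebra.ι k ∘ₗ (g i).toLinearMap)

theorem gAct_ι (i : Fin n) (v : V) :
    gAct g i (TensorAlgebra.ι k v) = TensorAlgebra.ι k (g i v) := by
  simp [gAct]

/-- The derivation twisted by `g i` and dual to `x i`. -/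
noncomputable def der (i : Fin n) : Module.End k (TensorAlgebra k V) :=
  twistedDer (gAct g i) (x.coord i)

theorem der_mul (i : Fin n) (a b : TensorAlgebra k V) :
    der x g i (a * b) = a * der x g i b + der x g i a * gAct g i b := twistedDer_mul _ _ _ _

theorem der_ι (i : Fin n) (v : V) :
    der x g i (TensorAlgebra.ι k v) = algebraMap k _ (x.repr v i) := by
  rw [der, twistedDer_ι, Module.Basis.coord_apply]

@[simp] theorem der_one (i : Fin n) : der x g i 1 = 0 := twistedDer_one _ _

theorem der_mul_ι (i : Fin n) (a : TensorAlgebra k V) (v : V) :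
    der x g i (a * TensorAlgebra.ι k v) =
      x.repr v i • a + der x g i a * TensorAlgebra.ι k (g i v) := by
  rw [der, twistedDer_mul_ι, Module.Basis.coord_apply, gAct_ι]

theorem der_ι_mul (i : Fin n) (a : TensorAlgebra k V) (v : V) :
    der x g i (TensorAlgebra.ι k v * a) =
      TensorAlgebra.ι k v * der x g i a + x.repr v i • gAct g i a := by
  rw [der_mul, der_ι, Algebra.smul_def]

/-- The derivations transform under `g i` by the matrix of `g i` on `V`. -/
theorem der_gAct (hYD : IsYetterDrinfeld x g) (i j : Fin n) (a : TensorAlgebra k V) :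
    der x g j (gAct g i a) = ∑ l, x.repr (g i (x l)) j • gAct g i (der x g l a) := by
  have hcomm : ∀ l v, x.repr (g i (x l)) j ≠ 0 → g j (g i v) = g i (g l v) := fun l v h =>
    LinearEquiv.congr_fun (hYD i l j h) v
  let S : Submodule k (TensorAlgebra k V) := LinearMap.ker
    (der x g j ∘ₗ (gAct g i).toLinearMap -
      ∑ l, x.repr (g i (x l)) j • (gAct g i).toLinearMap ∘ₗ der x g l)
  have hmem : ∀ a, a ∈ S ↔
      der x g j (gAct g i a) = ∑ l, x.repr (g i (x l)) j • gAct g i (der x g l a) := by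
    intro a
    rw [LinearMap.mem_ker, LinearMap.sub_apply, sub_eq_zero]
    simp
  rw [← hmem]
  refine tensorAlgebra_mem_of_mul_ι_mem S ((hmem _).mpr (by simp)) (fun b hb v => ?_) a
  rw [hmem] at hb ⊢
  rw [map_mul, gAct_ι, der_mul_ι, hb]
  simp only [der_mul_ι, map_add, map_smul, map_mul, gAct_ι, smul_add, Finset.sum_add_distrib,
    Finset.sum_mul]
  congr 1
  · have hv : x.repr (g i v) j = ∑ l, x.repr (g i (x l)) j * x.repr v l := by
      conv_lhs => rw [← x.sum_repr v]
      rw [map_sum, map_sum, Finsupp.finsetSum_apply]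
      simp only [map_smul, Finsupp.smul_apply, smul_eq_mul, mul_comm]
    rw [hv, Finset.sum_smul]
    exact Finset.sum_congr rfl fun l _ => mul_smul _ _ _
  · refine Finset.sum_congr rfl fun l _ => ?_
    by_cases h : x.repr (g i (x l)) j = 0
    · simp [h]
    · rw [hcomm l v h, smul_mul_assoc]

/-- The elements whose derivatives of order `m` all have constant term `0`. -/
noncomputable def jetKernel : ℕ → Submodule k (TensorAlgebra k V)
  | 0 => LinearMap.ker (TensorAlgebra.algebraMapInv (R := k) (M := V)).toLinearMap
  | m + 1 => ⨅ i, (jetKernel m).comap (der x g i)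

theorem mem_jetKernel_zero (a : TensorAlgebra k V) :
    a ∈ jetKernel x g 0 ↔ TensorAlgebra.algebraMapInv a = 0 := Iff.rfl

theorem mem_jetKernel_succ (m : ℕ) (a : TensorAlgebra k V) :
    a ∈ jetKernel x g (m + 1) ↔ ∀ i, der x g i a ∈ jetKernel x g m := by
  simp [jetKernel]

/-- The elements all of whose iterated derivatives have constant term `0`. -/
noncomputable def allJetsKernel : Submodule k (TensorAlgebra k V) := ⨅ m, jetKernel x g m

theorem mem_allJetsKernel (a : TensorAlgebra k V) :
    a ∈ allJetsKernel x g ↔ ∀ m, a ∈ jetKernel x g m := by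
  simp [allJetsKernel]

theorem mem_allJetsKernel_iff (a : TensorAlgebra k V) :
    a ∈ allJetsKernel x g ↔
      TensorAlgebra.algebraMapInv a = 0 ∧ ∀ i, der x g i a ∈ allJetsKernel x g := by
  simp only [mem_allJetsKernel]
  constructor
  · exact fun h => ⟨h 0, fun i m => (mem_jetKernel_succ x g m a).mp (h (m + 1)) i⟩
  · rintro ⟨h0, h1⟩ (_ | m)
    · exact h0
    · exact (mem_jetKernel_succ x g m a).mpr fun i => h1 i m

/-- The elements killed by all derivatives of order `m`. -/
noncomputable def derKernel : ℕ → Submodule k (TensorAlgebra k V)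
  | 0 => ⊥
  | m + 1 => ⨅ i, (derKernel m).comap (der x g i)

theorem mem_derKernel_succ (m : ℕ) (a : TensorAlgebra k V) :
    a ∈ derKernel x g (m + 1) ↔ ∀ i, der x g i a ∈ derKernel x g m := by
  simp [derKernel]

theorem derKernel_le_succ (m : ℕ) : derKernel x g m ≤ derKernel x g (m + 1) := by
  induction m with
  | zero => exact bot_le
  | succ m ih =>
    intro a ha
    rw [mem_derKernel_succ] at ha ⊢
    exact fun i => ih (ha i)

theorem mul_ι_mem_derKernel (m : ℕ) : ∀ a ∈ derKernel x g m, ∀ v,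
    a * TensorAlgebra.ι k v ∈ derKernel x g (m + 1) := by
  induction m with
  | zero =>
    intro a ha v
    rw [derKernel, Submodule.mem_bot] at ha
    rw [ha, zero_mul]
    exact Submodule.zero_mem _
  | succ m ih =>
    intro a ha v
    rw [mem_derKernel_succ]
    intro i
    rw [der_mul_ι]
    exact Submodule.add_mem _ (Submodule.smul_mem _ _ ha)
      (ih _ ((mem_derKernel_succ x g m a).mp ha i) _)

theorem exists_mem_derKernel (a : TensorAlgebra k V) : ∃ m, a ∈ derKernel x g m := by
  have hmono : Monotone (derKernel x g) := monotone_nat_of_le_succ (derKernel_le_succ x g)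
  rw [← Submodule.mem_iSup_of_directed _ hmono.directed_le]
  refine tensorAlgebra_mem_of_mul_ι_mem _ ?_ (fun b hb v => ?_) a
  · refine Submodule.mem_iSup_of_mem 1 ((mem_derKernel_succ x g 0 1).mpr fun i => ?_)
    rw [der_one]
    exact Submodule.zero_mem _
  · rw [Submodule.mem_iSup_of_directed _ hmono.directed_le] at hb
    obtain ⟨m, hm⟩ := hb
    exact Submodule.mem_iSup_of_mem (m + 1) (mul_ι_mem_derKernel x g m b hm v)

/-- The derivations are locally nilpotent, so the space of the elements whose iterated derivatives
have no constant term is characterized by the equivalence of `mem_allJetsKernel_iff`. -/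
theorem eq_allJetsKernel (I : Submodule k (TensorAlgebra k V))
    (hI : ∀ a, a ∈ I ↔ TensorAlgebra.algebraMapInv a = 0 ∧ ∀ i, der x g i a ∈ I) :
    I = allJetsKernel x g := by
  refine le_antisymm (fun a ha => ?_) fun a ha => ?_
  · rw [mem_allJetsKernel]
    intro m
    induction m generalizing a with
    | zero => exact ((hI a).mp ha).1
    | succ m ih =>
      rw [mem_jetKernel_succ]
      exact fun i => ih _ (((hI a).mp ha).2 i)
  · obtain ⟨m, hm⟩ := exists_mem_derKernel x g a
    induction m generalizing a with
    | zero =>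
      rw [derKernel, Submodule.mem_bot] at hm
      rw [hm]
      exact I.zero_mem
    | succ m ih =>
      rw [mem_allJetsKernel_iff] at ha
      rw [mem_derKernel_succ] at hm
      exact (hI a).mpr ⟨ha.1, fun i => ih _ (ha.2 i) (hm i)⟩

theorem algebraMapInv_gAct (i : Fin n) (a : TensorAlgebra k V) :
    TensorAlgebra.algebraMapInv (gAct g i a) = TensorAlgebra.algebraMapInv a := by
  have h : (TensorAlgebra.algebraMapInv (R := k) (M := V)).comp (gAct g i) =
      TensorAlgebra.algebraMapInv := by
    ext v
    simp [gAct_ι, TensorAlgebra.algebraMapInv]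
  exact DFunLike.congr_fun h a

theorem algebraMapInv_ι (v : V) : TensorAlgebra.algebraMapInv (TensorAlgebra.ι k v) = 0 := by
  simp [TensorAlgebra.algebraMapInv]

variable {x g}

theorem gAct_mem_allJetsKernel (hYD : IsYetterDrinfeld x g) (i : Fin n) {a : TensorAlgebra k V}
    (ha : a ∈ allJetsKernel x g) : gAct g i a ∈ allJetsKernel x g := by
  rw [mem_allJetsKernel]
  intro m
  induction m generalizing a with
  | zero =>
    rw [mem_jetKernel_zero, algebraMapInv_gAct]
    exact ((mem_allJetsKernel_iff x g a).mp ha).1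
  | succ m ih =>
    rw [mem_jetKernel_succ]
    intro j
    rw [der_gAct x g hYD]
    exact Submodule.sum_mem _ fun l _ => Submodule.smul_mem _ _
      (ih (((mem_allJetsKernel_iff x g a).mp ha).2 l))

theorem mul_ι_mem_allJetsKernel {a : TensorAlgebra k V} (ha : a ∈ allJetsKernel x g) (v : V) :
    a * TensorAlgebra.ι k v ∈ allJetsKernel x g := by
  rw [mem_allJetsKernel]
  intro m
  induction m generalizing a v with
  | zero =>
    rw [mem_jetKernel_zero, map_mul, algebraMapInv_ι, mul_zero]
  | succ m ih =>
    rw [mem_jetKernel_succ]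
    intro j
    rw [der_mul_ι]
    exact Submodule.add_mem _ (Submodule.smul_mem _ _ ((mem_allJetsKernel x g a).mp ha m))
      (ih (((mem_allJetsKernel_iff x g a).mp ha).2 j) _)

theorem ι_mul_mem_allJetsKernel (hYD : IsYetterDrinfeld x g) {a : TensorAlgebra k V}
    (ha : a ∈ allJetsKernel x g) (v : V) : TensorAlgebra.ι k v * a ∈ allJetsKernel x g := by
  rw [mem_allJetsKernel]
  intro m
  induction m generalizing a v with
  | zero =>
    rw [mem_jetKernel_zero, map_mul, algebraMapInv_ι, zero_mul]
  | succ m ih =>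
    rw [mem_jetKernel_succ]
    intro j
    rw [der_ι_mul]
    exact Submodule.add_mem _ (ih (((mem_allJetsKernel_iff x g a).mp ha).2 j) _)
      (Submodule.smul_mem _ _ ((mem_allJetsKernel x g _).mp (gAct_mem_allJetsKernel hYD j ha) m))

variable (x g) in
/-- The defining ideal of the Nichols algebra. -/
noncomputable def nicholsIdeal (hYD : IsYetterDrinfeld x g) : Ideal (TensorAlgebra k V) where
  carrier := allJetsKernel x g
  add_mem' ha hb := Submodule.add_mem _ ha hb
  zero_mem' := Submodule.zero_mem _
  smul_mem' b a ha := by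
    have := tensorAlgebra_mem_of_ι_mul_mem
      ((allJetsKernel x g).comap (LinearMap.mulRight k a)) (by simpa using ha)
      (fun c hc v => by
        rw [Submodule.mem_comap, LinearMap.mulRight_apply, mul_assoc] at *
        exact ι_mul_mem_allJetsKernel hYD hc v) b
    simpa using this

theorem mem_nicholsIdeal (hYD : IsYetterDrinfeld x g) (a : TensorAlgebra k V) :
    a ∈ nicholsIdeal x g hYD ↔ a ∈ allJetsKernel x g := Iff.rfl

instance nicholsIdeal_isTwoSided (hYD : IsYetterDrinfeld x g) :
    (nicholsIdeal x g hYD).IsTwoSided where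
  mul_mem_of_left {a} b ha := by
    have := tensorAlgebra_mem_of_mul_ι_mem
      ((allJetsKernel x g).comap (LinearMap.mulLeft k a)) (by
        rw [Submodule.mem_comap, LinearMap.mulLeft_apply, mul_one]
        exact ha)
      (fun c hc v => by
        rw [Submodule.mem_comap, LinearMap.mulLeft_apply, ← mul_assoc] at *
        exact mul_ι_mem_allJetsKernel hc v) b
    simpa [mem_nicholsIdeal] using this

theorem exists_descend (hYD : IsYetterDrinfeld x g) (f : Module.End k (TensorAlgebra k V))
    (hf : ∀ a ∈ allJetsKernel x g, f a ∈ allJetsKernel x g) :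
    ∃ f' : Module.End k (TensorAlgebra k V ⧸ nicholsIdeal x g hYD),
      ∀ a, f' (Ideal.Quotient.mkₐ k _ a) = Ideal.Quotient.mkₐ k _ (f a) := by
  set π := Ideal.Quotient.mkₐ k (nicholsIdeal x g hYD) with hπ
  have hsurj : Function.Surjective π := Ideal.Quotient.mkₐ_surjective _ _
  obtain ⟨s, hs⟩ := π.toLinearMap.exists_rightInverse_of_surjective
    (LinearMap.range_eq_top.mpr hsurj)
  refine ⟨π.toLinearMap ∘ₗ f ∘ₗ s, fun a => ?_⟩
  have h1 : π (s (π a)) = π a := LinearMap.congr_fun hs (π a)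
  have h2 : s (π a) - a ∈ allJetsKernel x g := by
    rw [← mem_nicholsIdeal hYD]
    exact Ideal.Quotient.eq.mp h1
  have h3 := hf _ h2
  rw [map_sub] at h3
  exact Ideal.Quotient.eq.mpr h3

/-- The quotient of the tensor algebra by the defining ideal of the Nichols algebra, with the
derivations and automorphisms induced by those of the tensor algebra. -/
noncomputable def derivationSystem (hYD : IsYetterDrinfeld x g) :
    DerivationSystem k (TensorAlgebra k V ⧸ nicholsIdeal x g hYD) n :=
  have hd := fun i => exists_descend hYD (der x g i)
    fun a ha => ((mem_allJetsKernel_iff x g a).mp ha).2 i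
  have hsurj : Function.Surjective (Ideal.Quotient.mkₐ k (nicholsIdeal x g hYD)) :=
    Ideal.Quotient.mkₐ_surjective _ _
  { x := fun i => Ideal.Quotient.mkₐ k _ (TensorAlgebra.ι k (x i))
    d := fun i => (hd i).choose
    g := fun i => Ideal.Quotient.liftₐ _ ((Ideal.Quotient.mkₐ k _).comp (gAct g i)) fun a ha =>
      Ideal.Quotient.eq_zero_iff_mem.mpr (gAct_mem_allJetsKernel hYD i ha)
    ε := Ideal.Quotient.liftₐ _ TensorAlgebra.algebraMapInv fun a ha =>
      ((mem_allJetsKernel_iff x g a).mp ha).1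
    M := fun i l j => x.repr (g i (x j)) l
    d_mul := fun i a b => by
      obtain ⟨a, rfl⟩ := hsurj a
      obtain ⟨b, rfl⟩ := hsurj b
      rw [← map_mul, (hd i).choose_spec, (hd i).choose_spec, (hd i).choose_spec, der_mul, map_add,
        map_mul, map_mul]
      rfl
    d_x := fun i j => by
      rw [(hd i).choose_spec, der_ι, x.repr_self_apply]
      by_cases h : i = j
      · simp [h]
      · simp [h, Ne.symm h]
    g_x := fun i j => by
      change Ideal.Quotient.mkₐ k _ (gAct g i (TensorAlgebra.ι k (x j))) = _
      rw [gAct_ι]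
      conv_lhs => rw [← x.sum_repr (g i (x j))]
      simp only [map_sum, map_smul]
    ε_x := fun i => algebraMapInv_ι (x i)
    adjoin_x := by
      rw [eq_top_iff]
      rintro b -
      obtain ⟨a, rfl⟩ := hsurj b
      refine tensorAlgebra_mem_of_mul_ι_mem ((Subalgebra.toSubmodule (Algebra.adjoin k
        (Set.range fun i => Ideal.Quotient.mkₐ k (nicholsIdeal x g hYD)
          (TensorAlgebra.ι k (x i))))).comap (Ideal.Quotient.mkₐ k _).toLinearMap) ?_ ?_ a
      · rw [Submodule.mem_comap, AlgHom.toLinearMap_apply, map_one]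
        exact Subalgebra.one_mem (Algebra.adjoin k _)
      · intro c hc v
        rw [← x.sum_repr v]
        simp only [Submodule.mem_comap, AlgHom.toLinearMap_apply, map_mul, map_sum, map_smul] at *
        exact Subalgebra.mul_mem _ hc (Subalgebra.sum_mem _ fun i _ =>
          Subalgebra.smul_mem _ (Algebra.subset_adjoin (Set.mem_range_self i)) _)
    eq_zero := fun b hb hdb => by
      obtain ⟨a, rfl⟩ := hsurj b
      refine Ideal.Quotient.eq_zero_iff_mem.mpr ((mem_allJetsKernel_iff x g a).mpr ⟨hb, fun i => ?_⟩)
      have := hdb i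
      rw [(hd i).choose_spec] at this
      exact Ideal.Quotient.eq_zero_iff_mem.mp this }

theorem derivationSystem_g (hYD : IsYetterDrinfeld x g) (i : Fin n) (a : TensorAlgebra k V) :
    (derivationSystem hYD).g i (Ideal.Quotient.mkₐ k _ a) = Ideal.Quotient.mkₐ k _ (gAct g i a) :=
  rfl

theorem derivationSystem_x (hYD : IsYetterDrinfeld x g) (i : Fin n) :
    (derivationSystem hYD).x i = Ideal.Quotient.mkₐ k _ (TensorAlgebra.ι k (x i)) := rfl

theorem derivationSystem_M (hYD : IsYetterDrinfeld x g) (i l j : Fin n) :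
    (derivationSystem hYD).M i l j = x.repr (g i (x j)) l := rfl

end DefiningIdeal

/-! ### The quantum symmetrizer as an ordered product -/

section Words

theorem sum_prod_ofFn {A : Type*} [Ring A] (R : ℕ → ℕ → A) (n : ℕ) :
    ∑ φ : (m : Fin n) → Fin ((m : ℕ) + 1), (List.ofFn fun m => R m (φ m)).prod =
      (List.ofFn fun m : Fin n => ∑ l ∈ Finset.range ((m : ℕ) + 1), R m l).prod := by
  induction n with
  | zero => simp
  | succ n ih =>
    rw [List.ofFn_succ', List.concat_eq_append, List.prod_append, List.prod_singleton]
    simp only [Fin.val_castSucc, Fin.val_last]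
    rw [← ih, ← (Fin.snocEquiv fun m : Fin (n + 1) => Fin ((m : ℕ) + 1)).sum_comp,
      Fintype.sum_prod_type, Finset.sum_comm, Finset.sum_mul]
    refine Finset.sum_congr rfl fun φ _ => ?_
    rw [← Fin.sum_univ_eq_sum_range (fun l => R n l) (n + 1), Finset.mul_sum]
    refine Finset.sum_congr rfl fun l _ => ?_
    rw [List.ofFn_succ', List.concat_eq_append, List.prod_append, List.prod_singleton]
    simp [Fin.snocEquiv]

/-- The Lehmer code is a bijection from the permutations to the product of the sets
`{0, …, m}`, `m < n`. -/
theorem lehmer_bijective (n : ℕ) : Function.Bijective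
    fun (x : Equiv.Perm (Fin n)) (m : Fin n) =>
      (⟨lehmer x m, Nat.lt_succ_of_le (lehmer_le x m)⟩ : Fin ((m : ℕ) + 1)) := by
  rw [Fintype.bijective_iff_injective_and_card]
  constructor
  · intro x y hxy
    have h : lehmer x = lehmer y := funext fun m => congrArg Fin.val (congrFun hxy m)
    rw [← reducedWord_prod x, ← reducedWord_prod y, reducedWord, reducedWord, h]
  · rw [Fintype.card_perm, Fintype.card_pi, Fintype.card_fin]
    simp only [Fintype.card_fin]
    rw [Fin.prod_univ_eq_prod_range (fun m => m + 1) n, Finset.prod_range_add_one_eq_factorial]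

/-- The sum over all permutations of the products along their reduced words is an ordered product,
with one factor for each digit of the Lehmer code. -/
theorem sum_reducedWord {A : Type*} [Ring A] (f : ℕ → A) (n : ℕ) :
    ∑ x : Equiv.Perm (Fin n), ((reducedWord x).map f).prod =
      ((List.range n).map fun m => ∑ l ∈ Finset.range (m + 1),
        ((List.range l).map fun t => f (m - 1 - t)).prod).prod := by
  have h1 : ((List.range n).map fun m => ∑ l ∈ Finset.range (m + 1),
        ((List.range l).map fun t => f (m - 1 - t)).prod) =
      List.ofFn fun m : Fin n => ∑ l ∈ Finset.range ((m : ℕ) + 1),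
        ((List.range l).map fun t => f ((m : ℕ) - 1 - t)).prod := by
    rw [List.ofFn_eq_map, ← List.map_coe_finRange_eq_range, List.map_map]
    rfl
  rw [h1, ← sum_prod_ofFn (fun m l => ((List.range l).map fun t => f (m - 1 - t)).prod) n,
    ← (Equiv.ofBijective _ (lehmer_bijective n)).sum_comp]
  refine Finset.sum_congr rfl fun x _ => ?_
  rw [reducedWord, List.ofFn_eq_map, List.map_flatMap, List.flatMap_def, List.prod_flatten,
    List.map_map]
  simp [Function.comp_def]

end Words

section TensorPowers

variable {k : Type*} [Field k] {V : Type*} [AddCommGroup V] [Module k V]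
  (c : V ⊗[k] V ≃ₗ[k] V ⊗[k] V)

/-- The map `b ↦ b ⊗ v` from `V^{⊗n}` to `V^{⊗(n+1)}`. -/
noncomputable def rmul (n : ℕ) (v : V) : (⨂[k]^n V) →ₗ[k] (⨂[k]^(n + 1) V) :=
  (TensorPower.mulEquiv (R := k) (M := V) (n := n) (m := 1)).toLinearMap ∘ₗ
    (TensorProduct.mk k (⨂[k]^n V) (⨂[k]^1 V)).flip (PiTensorProduct.tprod k fun _ => v)

theorem of_rmul (n : ℕ) (v : V) (b : ⨂[k]^n V) :
    DirectSum.of (fun n : ℕ => ⨂[k]^n V) (n + 1) (rmul n v b) =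
      DirectSum.of (fun n : ℕ => ⨂[k]^n V) n b * ofVector v := by
  rw [ofVector, DirectSum.of_mul_of]
  rfl

theorem rmul_tprod (n : ℕ) (v : V) (a : Fin n → V) :
    rmul n v (PiTensorProduct.tprod k a) =
      PiTensorProduct.tprod k (Fin.snoc (α := fun _ => V) a v) := by
  change GradedMonoid.GMul.mul (A := fun n : ℕ => ⨂[k]^n V) (PiTensorProduct.tprod k a)
    (PiTensorProduct.tprod k fun _ : Fin 1 => v) = _
  rw [TensorPower.tprod_mul_tprod, Fin.append_right_eq_snoc]

theorem tensorPower_induction {n : ℕ} {W : Type*} [AddCommGroup W] [Module k W]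
    {f f' : (⨂[k]^n V) →ₗ[k] W}
    (h : ∀ a : Fin n → V, f (PiTensorProduct.tprod k a) = f' (PiTensorProduct.tprod k a))
    (b : ⨂[k]^n V) : f b = f' b := by
  have : f = f' := PiTensorProduct.ext (MultilinearMap.ext h)
  rw [this]

theorem braidAt_tprod {n i : ℕ} (h : i + 1 < n) (a : Fin n → V) :
    braidAt c n i (PiTensorProduct.tprod k a) =
      insertTwo ⟨i, Nat.lt_of_succ_lt h⟩ ⟨i + 1, h⟩ (by simp) a
        (c (a ⟨i, Nat.lt_of_succ_lt h⟩ ⊗ₜ[k] a ⟨i + 1, h⟩)) := by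
  rw [braidAt, dif_pos h, PiTensorProduct.lift.tprod]
  rfl

theorem braidAt_of_not_lt {n i : ℕ} (h : ¬ i + 1 < n) : braidAt c n i = 1 := dif_neg h

theorem rmul_insertTwo {n : ℕ} (i j : Fin n) (hij : i ≠ j) (a : Fin n → V) (v : V)
    (y : V ⊗[k] V) : rmul n v (insertTwo i j hij a y) =
      insertTwo i.castSucc j.castSucc (fun h => hij (Fin.castSucc_injective n h))
        (Fin.snoc (α := fun _ => V) a v) y := by
  induction y using TensorProduct.induction_on with
  | zero => simp
  | tmul p q =>
    rw [insertTwo_tmul, insertTwo_tmul, rmul_tprod, Fin.snoc_update, Fin.snoc_update]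
  | add y z hy hz => simp [hy, hz]

theorem braidAt_rmul {n i : ℕ} (h : i + 1 < n) (v : V) (b : ⨂[k]^n V) :
    braidAt c (n + 1) i (rmul n v b) = rmul n v (braidAt c n i b) := by
  refine tensorPower_induction (f := braidAt c (n + 1) i ∘ₗ rmul n v)
    (f' := rmul n v ∘ₗ braidAt c n i) (fun a => ?_) b
  rw [LinearMap.comp_apply, LinearMap.comp_apply, rmul_tprod, braidAt_tprod c (by omega),
    braidAt_tprod c h, rmul_insertTwo]
  have h1 : Fin.snoc (α := fun _ => V) a v ⟨i, by omega⟩ = a ⟨i, by omega⟩ :=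
    Fin.snoc_castSucc (α := fun _ => V) v a ⟨i, by omega⟩
  have h2 : Fin.snoc (α := fun _ => V) a v ⟨i + 1, by omega⟩ = a ⟨i + 1, by omega⟩ :=
    Fin.snoc_castSucc (α := fun _ => V) v a ⟨i + 1, by omega⟩
  rw [h1, h2]
  rfl

theorem braidAt_rmul_rmul {n : ℕ} {u v u' v' : V} (h : c (u ⊗ₜ[k] v) = v' ⊗ₜ[k] u')
    (b : ⨂[k]^n V) :
    braidAt c (n + 2) n (rmul (n + 1) v (rmul n u b)) = rmul (n + 1) u' (rmul n v' b) := by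
  refine tensorPower_induction (f := braidAt c (n + 2) n ∘ₗ rmul (n + 1) v ∘ₗ rmul n u)
    (f' := rmul (n + 1) u' ∘ₗ rmul n v') (fun a => ?_) b
  simp only [LinearMap.comp_apply, rmul_tprod]
  rw [braidAt_tprod c (by omega)]
  have h1 : Fin.snoc (α := fun _ => V) (Fin.snoc (α := fun _ => V) a u : Fin (n + 1) → V) v
      (⟨n, by omega⟩ : Fin (n + 2)) = u := by
    have := Fin.snoc_castSucc (α := fun _ => V) v (Fin.snoc (α := fun _ => V) a u) (Fin.last n)
    rw [Fin.snoc_last] at this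
    exact this
  have h2 : Fin.snoc (α := fun _ => V) (Fin.snoc (α := fun _ => V) a u : Fin (n + 1) → V) v
      (⟨n + 1, by omega⟩ : Fin (n + 2)) = v := Fin.snoc_last (α := fun _ => V) v _
  rw [h1, h2, h, insertTwo_tmul]
  congr 1
  have h3 : (⟨n, by omega⟩ : Fin (n + 2)) = (Fin.last n).castSucc := rfl
  have h4 : (⟨n + 1, by omega⟩ : Fin (n + 2)) = Fin.last (n + 1) := rfl
  rw [h3, h4, ← Fin.snoc_update, Fin.update_snoc_last, Fin.update_snoc_last]

/-- The sum `1 + σ_{m-1} + σ_{m-1} σ_{m-2} + ⋯ + σ_{m-1} ⋯ σ_0` on `V^{⊗n}`. -/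
noncomputable def shuffleLast (n m : ℕ) : Module.End k (⨂[k]^n V) :=
  ∑ l ∈ Finset.range (m + 1), ((List.range l).map fun t => braidAt c n (m - 1 - t)).prod

/-- The product of the factors `shuffleLast c n m`, `m < r`, of the quantum symmetrizer. -/
noncomputable def partialSymmetrizer (n r : ℕ) : Module.End k (⨂[k]^n V) :=
  ((List.range r).map (shuffleLast c n)).prod

theorem symmetrizerComponent_eq (n : ℕ) :
    symmetrizerComponent c n = partialSymmetrizer c n n := by
  rw [symmetrizerComponent, partialSymmetrizer]
  exact sum_reducedWord (braidAt c n) n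

theorem symmetrizerComponent_succ (n : ℕ) : symmetrizerComponent c (n + 1) =
    partialSymmetrizer c (n + 1) n * shuffleLast c (n + 1) n := by
  rw [symmetrizerComponent_eq, partialSymmetrizer, List.range_succ, List.map_append,
    List.prod_append, partialSymmetrizer, List.map_singleton, List.prod_singleton]

theorem shuffleLast_rmul {n m : ℕ} (hm : m < n) (v : V) (b : ⨂[k]^n V) :
    shuffleLast c (n + 1) m (rmul n v b) = rmul n v (shuffleLast c n m b) := by
  rw [shuffleLast, shuffleLast, LinearMap.sum_apply, LinearMap.sum_apply, map_sum]
  refine Finset.sum_congr rfl fun l hl => ?_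
  rw [Finset.mem_range] at hl
  have : ∀ L : List ℕ, (∀ t ∈ L, t < m) →
      (L.map fun t => braidAt c (n + 1) (m - 1 - t)).prod (rmul n v b) =
        rmul n v ((L.map fun t => braidAt c n (m - 1 - t)).prod b) := by
    intro L hL
    induction L with
    | nil => rfl
    | cons t L ih =>
      rw [List.map_cons, List.prod_cons, Module.End.mul_apply,
        ih fun s hs => hL s (List.mem_cons_of_mem _ hs), List.map_cons, List.prod_cons,
        Module.End.mul_apply, braidAt_rmul]
      have := hL t List.mem_cons_self
      omega
  exact this _ fun t ht => by
    rw [List.mem_range] at ht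
    omega

theorem partialSymmetrizer_rmul {n : ℕ} (v : V) (b : ⨂[k]^n V) :
    partialSymmetrizer c (n + 1) n (rmul n v b) = rmul n v (symmetrizerComponent c n b) := by
  rw [symmetrizerComponent_eq, partialSymmetrizer, partialSymmetrizer]
  have : ∀ L : List ℕ, (∀ m ∈ L, m < n) →
      (L.map (shuffleLast c (n + 1))).prod (rmul n v b) =
        rmul n v ((L.map (shuffleLast c n)).prod b) := by
    intro L hL
    induction L with
    | nil => rfl
    | cons m L ih =>
      rw [List.map_cons, List.prod_cons, Module.End.mul_apply,
        ih fun s hs => hL s (List.mem_cons_of_mem _ hs), List.map_cons, List.prod_cons,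
        Module.End.mul_apply, shuffleLast_rmul c (hL m List.mem_cons_self)]
  exact this _ fun m hm => List.mem_range.mp hm

theorem shuffleLast_succ_rmul (n : ℕ) (v : V) (b : ⨂[k]^(n + 1) V) :
    shuffleLast c (n + 2) (n + 1) (rmul (n + 1) v b) =
      rmul (n + 1) v b + braidAt c (n + 2) n (rmul (n + 1) v (shuffleLast c (n + 1) n b)) := by
  have h : shuffleLast c (n + 2) n (rmul (n + 1) v b) =
      rmul (n + 1) v (shuffleLast c (n + 1) n b) := shuffleLast_rmul c (Nat.lt_add_one n) v b
  rw [← h, shuffleLast, Finset.sum_range_succ', LinearMap.add_apply]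
  refine (add_comm _ _).trans ?_
  congr 1
  rw [shuffleLast, LinearMap.sum_apply, LinearMap.sum_apply, map_sum]
  refine Finset.sum_congr rfl fun l _ => ?_
  rw [List.range_succ_eq_map, List.map_cons, List.prod_cons, Module.End.mul_apply, List.map_map]
  congr 3
  refine List.map_congr_left fun t _ => ?_
  simp only [Function.comp_apply]
  congr 1
  omega

end TensorPowers

/-! ### The quantum symmetrizer in terms of twisted derivations -/

section Bridge

variable {k : Type*} [Field k] {V : Type*} [AddCommGroup V] [Module k V]
  (c : V ⊗[k] V ≃ₗ[k] V ⊗[k] V)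

/-- On `V^{⊗(m+1)}` this is `shuffleLast`, the right factor of the quantum symmetrizer. -/
noncomputable def shuffleOp : TensorAlg k V →ₗ[k] TensorAlg k V :=
  DirectSum.lmap fun n => match n with
    | 0 => (0 : Module.End k (⨂[k]^0 V))
    | m + 1 => shuffleLast c (m + 1) m

/-- On `V^{⊗(m+1)}` this is the quantum symmetrizer of the first `m` places. -/
noncomputable def initSymmetrizer : TensorAlg k V →ₗ[k] TensorAlg k V :=
  DirectSum.lmap fun n => match n with
    | 0 => (1 : Module.End k (⨂[k]^0 V))
    | m + 1 => partialSymmetrizer c (m + 1) m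

/-- The braiding of the last two places. -/
noncomputable def braidLast : TensorAlg k V →ₗ[k] TensorAlg k V :=
  DirectSum.lmap fun n => braidAt c n (n - 2)

theorem shuffleOp_mul (y : TensorAlg k V) (v : V) : shuffleOp c (y * ofVector v) =
    y * ofVector v + braidLast c (shuffleOp c y * ofVector v) := by
  induction y using DirectSum.induction_on with
  | zero => simp
  | of n b =>
    cases n with
    | zero =>
      rw [← of_rmul, shuffleOp, DirectSum.lmap_of, DirectSum.lmap_of]
      have h1 : shuffleLast c 1 0 = (1 : Module.End k (⨂[k]^1 V)) := by simp [shuffleLast]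
      simp [h1]
    | succ n =>
      rw [← of_rmul, shuffleOp, DirectSum.lmap_of, DirectSum.lmap_of, ← of_rmul, braidLast,
        DirectSum.lmap_of, ← map_add]
      congr 1
      exact shuffleLast_succ_rmul c n v b
  | add y z hy hz =>
    rw [add_mul, map_add, hy, hz, map_add, add_mul, map_add]
    abel

variable {c} in
theorem braidLast_mul_mul {u v u' v' : V} (h : c (u ⊗ₜ[k] v) = v' ⊗ₜ[k] u') (y : TensorAlg k V) :
    braidLast c (y * ofVector u * ofVector v) = y * ofVector v' * ofVector u' := by
  induction y using DirectSum.induction_on with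
  | zero => simp
  | of n b =>
    rw [← of_rmul, ← of_rmul, ← of_rmul, ← of_rmul, braidLast, DirectSum.lmap_of]
    congr 1
    exact braidAt_rmul_rmul c h b
  | add y z hy hz => simp only [add_mul, map_add, hy, hz]

theorem initSymmetrizer_mul (y : TensorAlg k V) (v : V) :
    initSymmetrizer c (y * ofVector v) = symmetrizer c y * ofVector v := by
  induction y using DirectSum.induction_on with
  | zero => simp
  | of n b =>
    rw [← of_rmul, initSymmetrizer, DirectSum.lmap_of, symmetrizer, DirectSum.lmap_of, ← of_rmul]
    congr 1
    exact partialSymmetrizer_rmul c v b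
  | add y z hy hz => simp only [add_mul, map_add, hy, hz]

theorem symmetrizer_mul (y : TensorAlg k V) (v : V) :
    symmetrizer c (y * ofVector v) = initSymmetrizer c (shuffleOp c (y * ofVector v)) := by
  induction y using DirectSum.induction_on with
  | zero => simp
  | of n b =>
    rw [← of_rmul, symmetrizer, shuffleOp, initSymmetrizer, DirectSum.lmap_of, DirectSum.lmap_of,
      DirectSum.lmap_of]
    congr 1
    rw [symmetrizerComponent_succ, Module.End.mul_apply]
  | add y z hy hz => simp only [add_mul, map_add, hy, hz]

theorem one_eq_of : (1 : TensorAlg k V) = DirectSum.of (fun n : ℕ => ⨂[k]^n V) 0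
    (PiTensorProduct.tprod k Fin.elim0) := rfl

theorem symmetrizer_one : symmetrizer c (1 : TensorAlg k V) = 1 := by
  rw [one_eq_of, symmetrizer, DirectSum.lmap_of, symmetrizerComponent_eq]
  rfl

theorem shuffleOp_one : shuffleOp c (1 : TensorAlg k V) = 0 := by
  rw [one_eq_of, shuffleOp, DirectSum.lmap_of]
  exact map_zero _

theorem moveFirst_mul (y : TensorAlg k V) (v : V) :
    moveFirst c (y * ofVector v) = braidLast c (moveFirst c y * ofVector v) := by
  induction y using DirectSum.induction_on with
  | zero => simp
  | of n b =>
    rw [← of_rmul, moveFirst, DirectSum.lmap_of, DirectSum.lmap_of, ← of_rmul, braidLast,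
      DirectSum.lmap_of]
    congr 1
    cases n with
    | zero =>
      rw [braidAt_of_not_lt c (by omega)]
      rfl
    | succ n =>
      have : ∀ L : List ℕ, (∀ t ∈ L, t < n) →
          (L.map (braidAt c (n + 1 + 1))).prod (rmul (n + 1) v b) =
            rmul (n + 1) v ((L.map (braidAt c (n + 1))).prod b) := by
        intro L hL
        induction L with
        | nil => rfl
        | cons t L ih =>
          rw [List.map_cons, List.prod_cons, Module.End.mul_apply,
            ih fun s hs => hL s (List.mem_cons_of_mem _ hs), List.map_cons, List.prod_cons,
            Module.End.mul_apply, braidAt_rmul]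
          have := hL t List.mem_cons_self
          omega
      simp only [Nat.add_sub_cancel]
      rw [← this _ (by simp), List.range_succ, List.reverse_append, List.reverse_singleton,
        List.singleton_append, List.map_cons, List.prod_cons, Module.End.mul_apply]
      rfl
  | add y z hy hz => simp only [add_mul, map_add, hy, hz]

theorem moveFirst_ofVector (v : V) : moveFirst c (ofVector v) = ofVector v := by
  rw [ofVector, moveFirst, DirectSum.lmap_of]
  rfl

theorem equivDirectSum_ι (v : V) :
    TensorAlgebra.equivDirectSum (TensorAlgebra.ι k v) = ofVector v :=
  TensorAlgebra.toDirectSum_ι v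

variable {n : ℕ} {x : Module.Basis (Fin n) k V} {g : Fin n → (V ≃ₗ[k] V)} {c}

theorem IsBraidedBasis.apply (h : IsBraidedBasis c x g) (i : Fin n) (v : V) :
    c (x i ⊗ₜ[k] v) = g i v ⊗ₜ[k] x i := by
  have : c.toLinearMap ∘ₗ TensorProduct.mk k V V (x i) =
      (TensorProduct.mk k V V).flip (x i) ∘ₗ (g i).toLinearMap := x.ext fun j => h i j
  exact LinearMap.congr_fun this v

/-- The right factor of the quantum symmetrizer splits off the last place: its components along the
basis are the twisted derivations. -/
theorem shuffleOp_eq (h : IsBraidedBasis c x g) (a : TensorAlgebra k V) :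
    shuffleOp c (TensorAlgebra.equivDirectSum a) =
      ∑ j, TensorAlgebra.equivDirectSum (der x g j a) * ofVector (x j) := by
  let S : Submodule k (TensorAlgebra k V) := LinearMap.ker
    (shuffleOp c ∘ₗ TensorAlgebra.equivDirectSum.toLinearMap -
      ∑ j, LinearMap.mulRight k (ofVector (x j)) ∘ₗ TensorAlgebra.equivDirectSum.toLinearMap ∘ₗ
        der x g j)
  have hmem : ∀ a, a ∈ S ↔ shuffleOp c (TensorAlgebra.equivDirectSum a) =
      ∑ j, TensorAlgebra.equivDirectSum (der x g j a) * ofVector (x j) := by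
    intro a
    rw [LinearMap.mem_ker, LinearMap.sub_apply, sub_eq_zero]
    simp
  rw [← hmem]
  refine tensorAlgebra_mem_of_mul_ι_mem S ((hmem _).mpr (by simp [shuffleOp_one]))
    (fun b hb v => ?_) a
  rw [hmem] at hb ⊢
  rw [map_mul, equivDirectSum_ι, shuffleOp_mul, hb]
  simp only [der_mul_ι, map_add, map_smul, map_mul, equivDirectSum_ι, add_mul,
    Finset.sum_add_distrib, Finset.sum_mul, map_sum, braidLast_mul_mul (h.apply _ v)]
  congr 1
  conv_lhs => rw [← x.sum_repr v]
  rw [← equivDirectSum_ι, map_sum, map_sum, Finset.mul_sum]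
  simp only [map_smul, equivDirectSum_ι, mul_smul_comm, smul_mul_assoc]

/-- The symmetrizer of `a` in terms of the symmetrizers of the derivatives of `a`. -/
theorem symmetrizer_eq (h : IsBraidedBasis c x g) (a : TensorAlgebra k V) :
    symmetrizer c (TensorAlgebra.equivDirectSum a) =
      algebraMap k _ (TensorAlgebra.algebraMapInv a) +
        ∑ j, symmetrizer c (TensorAlgebra.equivDirectSum (der x g j a)) * ofVector (x j) := by
  have h1 : initSymmetrizer c (shuffleOp c (TensorAlgebra.equivDirectSum a)) =
      ∑ j, symmetrizer c (TensorAlgebra.equivDirectSum (der x g j a)) * ofVector (x j) := by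
    simp only [shuffleOp_eq h, map_sum, initSymmetrizer_mul]
  rw [← h1]
  let S : Submodule k (TensorAlgebra k V) := LinearMap.ker
    (symmetrizer c ∘ₗ TensorAlgebra.equivDirectSum.toLinearMap -
      (Algebra.linearMap k (TensorAlg k V) ∘ₗ TensorAlgebra.algebraMapInv.toLinearMap +
        initSymmetrizer c ∘ₗ shuffleOp c ∘ₗ TensorAlgebra.equivDirectSum.toLinearMap))
  have hmem : ∀ a, a ∈ S ↔ symmetrizer c (TensorAlgebra.equivDirectSum a) =
      algebraMap k _ (TensorAlgebra.algebraMapInv a) +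
        initSymmetrizer c (shuffleOp c (TensorAlgebra.equivDirectSum a)) := by
    intro a
    rw [LinearMap.mem_ker, LinearMap.sub_apply, sub_eq_zero]
    simp
  rw [← hmem]
  refine tensorAlgebra_mem_of_mul_ι_mem S ((hmem _).mpr (by simp [shuffleOp_one, symmetrizer_one]))
    (fun b _ v => ?_) a
  rw [hmem, map_mul TensorAlgebra.equivDirectSum, equivDirectSum_ι, symmetrizer_mul,
    map_mul TensorAlgebra.algebraMapInv, algebraMapInv_ι, mul_zero,
    map_zero, zero_add]

/-- The tensor algebra is the direct sum of the scalars and of the free left module on a basis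
of `V`. -/
theorem eq_zero_of_sum_mul_ι (x : Module.Basis (Fin n) k V) (r : k) (b : Fin n → TensorAlgebra k V)
    (h : algebraMap k _ r + ∑ j, b j * TensorAlgebra.ι k (x j) = 0) :
    r = 0 ∧ ∀ i, b i = 0 := by
  constructor
  · have := congrArg TensorAlgebra.algebraMapInv h
    simpa [algebraMapInv_ι, TensorAlgebra.algebraMap_leftInverse V r] using this
  · intro i
    have h1 := congrArg (twistedDer
      ((Algebra.ofId k (TensorAlgebra k V)).comp TensorAlgebra.algebraMapInv) (x.coord i)) h
    rw [map_add, map_sum, map_zero, Algebra.algebraMap_eq_smul_one, map_smul, twistedDer_one,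
      smul_zero, zero_add] at h1
    simpa [twistedDer_mul_ι, algebraMapInv_ι, Finsupp.single_apply] using h1

/-- The kernel of the quantum symmetrizer is the defining ideal of the Nichols algebra. -/
theorem symmetrizer_eq_zero_iff (h : IsBraidedBasis c x g) (a : TensorAlgebra k V) :
    symmetrizer c (TensorAlgebra.equivDirectSum a) = 0 ↔ a ∈ allJetsKernel x g := by
  rw [← eq_allJetsKernel x g
    (LinearMap.ker (symmetrizer c ∘ₗ TensorAlgebra.equivDirectSum.toLinearMap)) fun a => ?_]
  · rfl
  · change symmetrizer c (TensorAlgebra.equivDirectSum a) = 0 ↔ _ ∧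
      ∀ j, symmetrizer c (TensorAlgebra.equivDirectSum (der x g j a)) = 0
    rw [symmetrizer_eq h]
    constructor
    · intro h0
      have h1 := congrArg TensorAlgebra.equivDirectSum.symm h0
      simp only [map_add, map_sum, map_mul, map_zero, ← equivDirectSum_ι,
        AlgEquiv.symm_apply_apply, AlgEquiv.commutes] at h1
      obtain ⟨h2, h3⟩ := eq_zero_of_sum_mul_ι x _ _ h1
      exact ⟨h2, fun i => (map_eq_zero_iff _ TensorAlgebra.equivDirectSum.symm.injective).mp (h3 i)⟩
    · rintro ⟨h0, h1⟩
      rw [h0, map_zero, zero_add]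
      exact Finset.sum_eq_zero fun j _ => by rw [h1, zero_mul]

/-- Moving the first factor `x i` to the end lets `g i` act on all the others. -/
theorem moveFirst_eq (h : IsBraidedBasis c x g) (i : Fin n) (a : TensorAlgebra k V) :
    moveFirst c (ofVector (x i) * TensorAlgebra.equivDirectSum a) =
      TensorAlgebra.equivDirectSum (gAct g i a) * ofVector (x i) := by
  let S : Submodule k (TensorAlgebra k V) := LinearMap.ker
    (moveFirst c ∘ₗ LinearMap.mulLeft k (ofVector (x i)) ∘ₗ
      TensorAlgebra.equivDirectSum.toLinearMap - LinearMap.mulRight k (ofVector (x i)) ∘ₗ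
        TensorAlgebra.equivDirectSum.toLinearMap ∘ₗ (gAct g i).toLinearMap)
  have hmem : ∀ a, a ∈ S ↔ moveFirst c (ofVector (x i) * TensorAlgebra.equivDirectSum a) =
      TensorAlgebra.equivDirectSum (gAct g i a) * ofVector (x i) := by
    intro a
    rw [LinearMap.mem_ker, LinearMap.sub_apply, sub_eq_zero]
    simp
  rw [← hmem]
  refine tensorAlgebra_mem_of_mul_ι_mem S ((hmem _).mpr (by simp [moveFirst_ofVector]))
    (fun b hb v => ?_) a
  rw [hmem] at hb ⊢
  rw [map_mul TensorAlgebra.equivDirectSum, equivDirectSum_ι, ← mul_assoc, moveFirst_mul, hb,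
    braidLast_mul_mul (h.apply i v), map_mul, gAct_ι, map_mul, equivDirectSum_ι]

/-- The iterated adjoint actions in the tensor algebra, modulo the kernel of the quantum symmetrizer,
are those of the derivation system. -/
theorem symmetrizer_adj_iterate_eq_zero_iff (h : IsBraidedBasis c x g) (hYD : IsYetterDrinfeld x g)
    (i j : Fin n) (r : ℕ) : symmetrizer c ((adj c (x i))^[r] (ofVector (x j))) = 0 ↔
      ((derivationSystem hYD).ad i ^ r) ((derivationSystem hYD).x j) = 0 := by
  suffices ∃ a : TensorAlgebra k V,
      (adj c (x i))^[r] (ofVector (x j)) = TensorAlgebra.equivDirectSum a ∧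
      ((derivationSystem hYD).ad i ^ r) ((derivationSystem hYD).x j) =
        Ideal.Quotient.mkₐ k (nicholsIdeal x g hYD) a by
    obtain ⟨a, h1, h2⟩ := this
    rw [h1, h2, symmetrizer_eq_zero_iff h]
    exact (Ideal.Quotient.eq_zero_iff_mem (I := nicholsIdeal x g hYD)).symm
  induction r with
  | zero => exact ⟨TensorAlgebra.ι k (x j), (equivDirectSum_ι _).symm, rfl⟩
  | succ r ih =>
    obtain ⟨a, h1, h2⟩ := ih
    refine ⟨TensorAlgebra.ι k (x i) * a - gAct g i a * TensorAlgebra.ι k (x i), ?_, ?_⟩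
    · rw [Function.iterate_succ_apply', h1, adj, moveFirst_eq h, map_sub, map_mul, map_mul,
        equivDirectSum_ι]
    · rw [pow_succ', Module.End.mul_apply, h2, DerivationSystem.ad_apply, derivationSystem_g,
        derivationSystem_x, map_sub, map_mul, map_mul]

theorem rank_quotient_eq (h : IsBraidedBasis c x g) (hYD : IsYetterDrinfeld x g) :
    Module.rank k (TensorAlgebra k V ⧸ nicholsIdeal x g hYD) = nicholsRank c := by
  set π := (Ideal.Quotient.mkₐ k (nicholsIdeal x g hYD)).toLinearMap with hπ
  set f := symmetrizer c ∘ₗ (TensorAlgebra.equivDirectSum (R := k) (M := V)).toLinearMap with hf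
  have hsurj : Function.Surjective π :=
    Ideal.Quotient.mkₐ_surjective k (nicholsIdeal x g hYD)
  have hker : LinearMap.ker π = LinearMap.ker f := by
    ext a
    exact (Ideal.Quotient.eq_zero_iff_mem (I := nicholsIdeal x g hYD)).trans
      (symmetrizer_eq_zero_iff h a).symm
  have hrange : LinearMap.range f = nicholsAlgebra c :=
    LinearMap.range_comp_of_range_eq_top _ (LinearMap.range_eq_top.mpr
      TensorAlgebra.equivDirectSum.surjective)
  have e := (π.quotKerEquivOfSurjective hsurj).symm.trans
    ((Submodule.quotEquivOfEq _ _ hker).trans f.quotKerEquivRange)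
  rw [nicholsRank, ← hrange]
  exact e.rank_eq

end Bridge

/-! ### Braided bases adapted to commuting operators -/

section BraidedBases

variable {k : Type*} [Field k] {V : Type*} [AddCommGroup V] [Module k V]
  {c : V ⊗[k] V ≃ₗ[k] V ⊗[k] V} {n : ℕ} {x : Module.Basis (Fin n) k V} {g : Fin n → (V ≃ₗ[k] V)}

/-- The contraction of the last factor with a coordinate functional. -/
noncomputable def contractRight (x : Module.Basis (Fin n) k V) (W : Type*) [AddCommGroup W]
    [Module k W] (l : Fin n) : W ⊗[k] V →ₗ[k] W :=
  (TensorProduct.rid k W).toLinearMap ∘ₗ (x.coord l).lTensor W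

@[simp] theorem contractRight_tmul (x : Module.Basis (Fin n) k V) (W : Type*) [AddCommGroup W]
    [Module k W] (l : Fin n) (w : W) (v : V) :
    contractRight x W l (w ⊗ₜ[k] v) = x.repr v l • w := by
  simp [contractRight]

theorem braiding_apply (h : IsBraidedBasis c x g) (v w : V) :
    c (v ⊗ₜ[k] w) = ∑ l, x.repr v l • (g l w ⊗ₜ[k] x l) := by
  conv_lhs => rw [← x.sum_repr v]
  rw [TensorProduct.sum_tmul, map_sum]
  refine Finset.sum_congr rfl fun l _ => ?_
  rw [← TensorProduct.smul_tmul', map_smul, h.apply]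

/-- In terms of a braided basis, the braid equation is the Yetter–Drinfeld condition. -/
theorem isYetterDrinfeld_of_braidEquation (hc : BraidEquation c) (h : IsBraidedBasis c x g) :
    IsYetterDrinfeld x g := by
  have key : ∀ i j v, c (g i (x j) ⊗ₜ[k] g i v) = g i (g j v) ⊗ₜ[k] g i (x j) := by
    intro i j v
    have h1 := LinearMap.congr_fun hc ((x i ⊗ₜ[k] x j) ⊗ₜ[k] v)
    simp only [LinearMap.comp_apply, LinearMap.rTensor_tmul, LinearEquiv.coe_coe, h.apply,
      TensorProduct.assoc_tmul, LinearMap.lTensor_tmul, TensorProduct.assoc_symm_tmul] at h1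
    have h2 := congrArg (contractRight x (V ⊗[k] V) i) h1
    simpa using h2
  intro i j l hl
  ext v
  have h1 := key i j v
  rw [braiding_apply h] at h1
  have h2 := congrArg (contractRight x V l) h1
  rw [map_sum] at h2
  simp only [map_smul, contractRight_tmul, x.repr_self_apply] at h2
  rw [Finset.sum_eq_single l (fun i _ hi => by rw [if_neg hi, zero_smul, smul_zero])
    (fun h => absurd (Finset.mem_univ l) h), if_pos rfl, one_smul] at h2
  exact smul_right_injective V hl h2

theorem isFinitelySemisimple_of_pow_eq_one [CharZero k] [FiniteDimensional k V]
    {f : Module.End k V} {N : ℕ} (hN : N ≠ 0) (hf : f ^ N = 1) : f.IsFinitelySemisimple := by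
  have hsq : Squarefree (Polynomial.X ^ N - 1 : k[X]) :=
    (Polynomial.X_pow_sub_one_separable_iff.mpr (Nat.cast_ne_zero.mpr hN)).squarefree
  exact (Module.End.isSemisimple_of_squarefree_aeval_eq_zero hsq
    (by simp [hf])).isFinitelySemisimple

/-- Commuting operators of finite order which preserve the subspaces spanned by the `x i` with a
given `g i` have a joint eigenbasis which is again a braided basis.  The grading by the `g i` is
encoded as one more commuting operator, diagonal in the basis `x`, whose eigenvalues tell the
`g i` apart. -/
theorem exists_eigenbasis [IsAlgClosed k] [CharZero k] (h : IsBraidedBasis c x g) {ι : Type*}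
    (f : ι → Module.End k V) (hcomm : ∀ a b, Commute (f a) (f b)) {N : ℕ} (hN : N ≠ 0)
    (hfN : ∀ a, f a ^ N = 1) (hgr : ∀ a j l, x.repr (f a (x j)) l ≠ 0 → g l = g j) :
    ∃ (y : Module.Basis (Fin n) k V) (g' : Fin n → (V ≃ₗ[k] V)), IsBraidedBasis c y g' ∧
      (∀ i, ∃ j, g' i = g j) ∧ (∀ i l, x.repr (y i) l ≠ 0 → g l = g' i) ∧
      ∀ a i, ∃ μ : k, f a (y i) = μ • y i := by
  have : FiniteDimensional k V := x.finiteDimensional_of_finite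
  obtain ⟨idx, hidx⟩ := exists_injective_nat (Set.range g)
  let lab : Fin n → k := fun i => (idx ⟨g i, i, rfl⟩ : k)
  have hlab : ∀ i j, lab i = lab j → g i = g j := fun i j hij =>
    congrArg Subtype.val (hidx (Nat.cast_injective hij))
  have hlab' : ∀ i j, g i = g j → lab i = lab j := fun i j hij => by
    have : (⟨g i, i, rfl⟩ : Set.range g) = ⟨g j, j, rfl⟩ := Subtype.ext hij
    simp only [lab, this]
  let L : Module.End k V := x.constr k fun i => lab i • x i
  have hLx : ∀ i, L (x i) = lab i • x i := fun i => x.constr_basis k _ i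
  have hLrepr : ∀ v i, x.repr (L v) i = lab i * x.repr v i := by
    intro v i
    conv_lhs => rw [← x.sum_repr v]
    rw [map_sum, map_sum, Finsupp.finsetSum_apply]
    simp [hLx, Finsupp.single_apply, mul_comm]
  have hLf : ∀ a, Commute L (f a) := by
    intro a
    refine x.ext fun j => x.ext_elem fun l => ?_
    rw [Module.End.mul_apply, Module.End.mul_apply, hLrepr, hLx, map_smul, map_smul,
      Finsupp.smul_apply, smul_eq_mul]
    by_cases hl : x.repr (f a (x j)) l = 0
    · rw [hl, mul_zero, mul_zero]
    · rw [hlab' l j (hgr a j l hl)]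
  have hLgen : ∀ μ v, v ∈ L.maxGenEigenspace μ → ∀ i, x.repr v i ≠ 0 → lab i = μ := by
    intro μ v hv i hi
    obtain ⟨m, hm⟩ := (Module.End.mem_maxGenEigenspace L μ v).mp hv
    have hpow : ∀ m : ℕ, x.repr (((L - μ • (1 : Module.End k V)) ^ m) v) i =
        (lab i - μ) ^ m * x.repr v i := by
      intro m
      induction m with
      | zero => simp
      | succ m ih =>
        rw [pow_succ', Module.End.mul_apply, LinearMap.sub_apply, map_sub, Finsupp.sub_apply,
          hLrepr, LinearMap.smul_apply, map_smul, Finsupp.smul_apply, Module.End.one_apply, ih,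
          smul_eq_mul]
        ring
    have h0 := hpow m
    rw [hm, map_zero, Finsupp.zero_apply, eq_comm, mul_eq_zero] at h0
    exact sub_eq_zero.mp (eq_zero_of_pow_eq_zero (h0.resolve_right hi))
  let F : Option ι → Module.End k V := fun o => o.elim L f
  have hspan := Module.End.iSup_iInf_maxGenEigenspace_eq_top_of_iSup_maxGenEigenspace_eq_top_of_commute
    F (by
      rintro (_ | a) (_ | b) hab
      · exact absurd rfl hab
      · exact hLf b
      · exact (hLf a).symm
      · exact hcomm a b) (fun o => Module.End.iSup_maxGenEigenspace_eq_top (F o))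
  let s : Set V := {v | ∃ χ : Option ι → k, ∀ o, v ∈ (F o).maxGenEigenspace (χ o)}
  have hs : ⊤ ≤ Submodule.span k s := by
    rw [← hspan]
    refine iSup_le fun χ v hv => Submodule.subset_span ⟨χ, ?_⟩
    simpa using hv
  let b := Module.Basis.ofSpan hs
  let y : Module.Basis (Fin n) k V := b.reindex (b.indexEquiv x)
  have hy : ∀ i, ∃ χ : Option ι → k, ∀ o, y i ∈ (F o).maxGenEigenspace (χ o) := by
    intro i
    have : y i ∈ s := by
      refine Module.Basis.ofSpan_subset hs ?_
      rw [Module.Basis.reindex_apply]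
      exact Set.mem_range_self _
    exact this
  have hdeg : ∀ i, ∃ j, ∀ l, x.repr (y i) l ≠ 0 → g l = g j := by
    intro i
    obtain ⟨χ, hχ⟩ := hy i
    have hne : x.repr (y i) ≠ 0 := fun h0 => y.ne_zero i (by simpa using h0)
    obtain ⟨j, hj⟩ := Finsupp.ne_iff.mp hne
    refine ⟨j, fun l hl => hlab l j ?_⟩
    rw [hLgen _ _ (hχ none) l hl, hLgen _ _ (hχ none) j hj]
  choose d hd using hdeg
  refine ⟨y, fun i => g (d i), fun i j => ?_, fun i => ⟨d i, rfl⟩, fun i l hl => hd i l hl,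
    fun a i => ?_⟩
  · rw [braiding_apply h]
    have h1 : ∀ l, x.repr (y i) l • (g l (y j) ⊗ₜ[k] x l) =
        g (d i) (y j) ⊗ₜ[k] (x.repr (y i) l • x l) := by
      intro l
      by_cases hl : x.repr (y i) l = 0
      · simp [hl]
      · rw [hd i l hl, TensorProduct.tmul_smul]
    simp only [h1]
    rw [← TensorProduct.tmul_sum, x.sum_repr]
  · obtain ⟨χ, hχ⟩ := hy i
    refine ⟨χ (some a), ?_⟩
    have h1 : y i ∈ (f a).maxGenEigenspace (χ (some a)) := hχ (some a)
    rw [(isFinitelySemisimple_of_pow_eq_one hN (hfN a)).maxGenEigenspace_eq_eigenspace] at h1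
    exact Module.End.mem_eigenspace_iff.mp h1

/-- A braided basis such that each `g i` has `x i` as an eigenvector. -/
theorem exists_selfEigenbasis [IsAlgClosed k] [CharZero k] (hc : BraidEquation c)
    (h : IsBraidedBasis c x g) {N : ℕ} (hN : N ≠ 0) (hgN : ∀ i, g i ^ N = 1) :
    ∃ (y : Module.Basis (Fin n) k V) (g' : Fin n → (V ≃ₗ[k] V)) (q : Fin n → k),
      IsBraidedBasis c y g' ∧ (∀ i, g' i ^ N = 1) ∧ ∀ i, g' i (y i) = q i • y i := by
  have hYD := isYetterDrinfeld_of_braidEquation hc h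
  have hself : ∀ j l, x.repr (g j (x j)) l ≠ 0 → g l = g j := fun j l hl =>
    mul_right_cancel (hYD j j l hl)
  -- the operator which acts as `γ` on the span of the `x i` with `g i = γ`
  let H : Module.End k V := x.constr k fun i => g i (x i)
  have hHx : ∀ i, H (x i) = g i (x i) := fun i => x.constr_basis k _ i
  have hH : ∀ (γ : V ≃ₗ[k] V) (v : V), (∀ l, x.repr v l ≠ 0 → g l = γ) → H v = γ v := by
    intro γ v hv
    conv_lhs => rw [← x.sum_repr v]
    conv_rhs => rw [← x.sum_repr v]
    rw [map_sum, map_sum]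
    refine Finset.sum_congr rfl fun l _ => ?_
    by_cases hl : x.repr v l = 0
    · simp [hl]
    · rw [map_smul, map_smul, hHx, hv l hl]
  have hstable : ∀ (i : Fin n) (v : V), (∀ l, x.repr v l ≠ 0 → g l = g i) →
      ∀ l, x.repr (g i v) l ≠ 0 → g l = g i := by
    intro i v hv l hl
    rw [← x.sum_repr v, map_sum, map_sum, Finsupp.finsetSum_apply] at hl
    obtain ⟨r, -, hr⟩ := Finset.exists_ne_zero_of_sum_ne_zero hl
    rw [map_smul, map_smul, Finsupp.smul_apply, smul_ne_zero_iff] at hr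
    have h1 := hv r hr.1
    rw [← h1] at hr ⊢
    exact hself r l hr.2
  have hHN : H ^ N = 1 := by
    refine x.ext fun i => ?_
    have hpow : ∀ m : ℕ, (H ^ m) (x i) = (g i ^ m) (x i) ∧
        ∀ l, x.repr ((g i ^ m) (x i)) l ≠ 0 → g l = g i := by
      intro m
      induction m with
      | zero =>
        refine ⟨by simp, fun l hl => ?_⟩
        rw [pow_zero, LinearEquiv.coe_one, id_eq, x.repr_self_apply] at hl
        rw [← (ite_ne_right_iff.mp hl).1]
      | succ m ih =>
        rw [pow_succ', Module.End.mul_apply, ih.1, pow_succ', LinearEquiv.mul_apply]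
        exact ⟨hH _ _ ih.2, hstable i _ ih.2⟩
    rw [(hpow N).1, hgN]
    rfl
  obtain ⟨y, g', hy, hg', hdeg, heig⟩ := exists_eigenbasis h (fun _ : Unit => H)
    (fun _ _ => Commute.refl H) hN (fun _ => hHN)
    (fun _ j l hl => hself j l (by rwa [hHx] at hl))
  choose q hq using heig ()
  refine ⟨y, g', q, hy, fun i => ?_, fun i => ?_⟩
  · obtain ⟨j, hj⟩ := hg' i
    rw [hj, hgN]
  · rw [← hq i, hH (g' i) (y i) (hdeg i)]

/-- If the `g i` commute, then the braiding is diagonal in a suitable basis. -/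
theorem exists_diagonalBasis [IsAlgClosed k] [CharZero k] (hc : BraidEquation c)
    (h : IsBraidedBasis c x g) {N : ℕ} (hN : N ≠ 0) (hgN : ∀ i, g i ^ N = 1)
    (hcomm : ∀ i j, Commute (g i) (g j)) :
    ∃ (y : Module.Basis (Fin n) k V) (g' : Fin n → (V ≃ₗ[k] V)) (Q : Fin n → Fin n → k),
      IsBraidedBasis c y g' ∧ (∀ i, g' i ^ N = 1) ∧ ∀ i j, g' i (y j) = Q i j • y j := by
  have hYD := isYetterDrinfeld_of_braidEquation hc h
  have hcoe : ∀ (γ : V ≃ₗ[k] V) (m : ℕ) (v : V),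
      ((γ.toLinearMap : Module.End k V) ^ m) v = (γ ^ m) v := by
    intro γ m
    induction m with
    | zero => intro v; rfl
    | succ m ih =>
      intro v
      rw [pow_succ', Module.End.mul_apply, ih, pow_succ', LinearEquiv.mul_apply]
      rfl
  obtain ⟨y, g', hy, hg', -, heig⟩ := exists_eigenbasis h
    (fun i => ((g i).toLinearMap : Module.End k V))
    (fun i j => LinearMap.ext fun v => LinearEquiv.congr_fun (hcomm i j) v) hN
    (fun i => LinearMap.ext fun v => by rw [hcoe, hgN]; rfl)
    (fun i j l hl => mul_right_cancel ((hYD i j l hl).trans (hcomm i j)))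
  choose d hd using hg'
  choose Q hQ using heig
  refine ⟨y, g', fun i j => Q (d i) j, hy, fun i => by rw [hd, hgN], fun i j => ?_⟩
  rw [hd i]
  exact hQ (d i) j

theorem isOfFinOrder_of_eigen {γ : V ≃ₗ[k] V} {N : ℕ} (hN : N ≠ 0) (hγ : γ ^ N = 1) {v : V}
    (hv : v ≠ 0) {μ : k} (h : γ v = μ • v) : IsOfFinOrder μ := by
  rw [isOfFinOrder_iff_pow_eq_one]
  refine ⟨N, Nat.pos_of_ne_zero hN, ?_⟩
  have hpow : ∀ m : ℕ, (γ ^ m) v = μ ^ m • v := by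
    intro m
    induction m with
    | zero => simp
    | succ m ih => rw [pow_succ', LinearEquiv.mul_apply, ih, map_smul, h, smul_smul, ← pow_succ]
  have h1 := hpow N
  rw [hγ, LinearEquiv.coe_one, id_eq] at h1
  have h2 : (μ ^ N - 1) • v = 0 := by rw [sub_smul, one_smul, ← h1, sub_self]
  exact sub_eq_zero.mp ((smul_eq_zero.mp h2).resolve_right hv)

theorem derivationSystem_isEigen (hYD : IsYetterDrinfeld x g) {q : Fin n → k}
    (hq : ∀ i, g i (x i) = q i • x i) : (derivationSystem hYD).IsEigen q where
  g_self i := by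
    rw [derivationSystem_x, derivationSystem_g, gAct_ι, hq, map_smul, map_smul]
  M_eq_zero i j hij := by
    rw [derivationSystem_M]
    by_contra h0
    have h1 : g i = g j := mul_left_cancel (hYD i j i h0)
    rw [h1, hq j, map_smul, Finsupp.smul_apply, x.repr_self_apply, if_neg hij, smul_zero] at h0
    exact h0 rfl

theorem derivationSystem_isDiagonal (hYD : IsYetterDrinfeld x g) {Q : Fin n → Fin n → k}
    (hQ : ∀ i j, g i (x j) = Q i j • x j) : (derivationSystem hYD).IsDiagonal Q := by
  intro i l j
  rw [derivationSystem_M, hQ, map_smul, Finsupp.smul_apply, x.repr_self_apply]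
  by_cases h : l = j
  · simp [h]
  · simp [h, Ne.symm h]

end BraidedBases

/-! ### Nichols algebras of dimension `p ^ 3` -/

section Classification

variable {k : Type*} [Field k] {V : Type*} [AddCommGroup V] [Module k V]
  {c : V ⊗[k] V ≃ₗ[k] V ⊗[k] V} {n : ℕ} {x : Module.Basis (Fin n) k V} {g : Fin n → (V ≃ₗ[k] V)}

theorem N_eq_of_orderOf {q : kˣ} {m : ℕ} (hm : orderOf (q : k) = m) (h0 : m ≠ 0) (h1 : m ≠ 1) :
    N q = m := by
  rw [orderOf_units] at hm
  have hq : q ≠ 1 := fun h => h1 (by rw [← hm, h, orderOf_one])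
  have hfin : IsOfFinOrder q := orderOf_pos_iff.mp (by omega)
  rw [N, if_neg (by simp [hq, hfin]), hm]

theorem finiteDimensional_quotient (h : IsBraidedBasis c x g) (hYD : IsYetterDrinfeld x g) {m : ℕ}
    (hrank : nicholsRank c = m) :
    FiniteDimensional k (TensorAlgebra k V ⧸ nicholsIdeal x g hYD) := by
  refine Module.finite_of_rank_eq_nat (n := m) ?_
  rw [rank_quotient_eq h hYD, hrank]

theorem finrank_quotient (h : IsBraidedBasis c x g) (hYD : IsYetterDrinfeld x g) {m : ℕ}
    (hrank : nicholsRank c = m) :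
    Module.finrank k (TensorAlgebra k V ⧸ nicholsIdeal x g hYD) = m :=
  Module.finrank_eq_of_rank_eq (by rw [rank_quotient_eq h hYD, hrank])

/-- With at most two basis elements, or when the dimension is as small as the orders of the `q i`
allow, the group generated by the `g i` is abelian. -/
theorem commute_of_dim [CharZero k] (hYD : IsYetterDrinfeld x g)
    [FiniteDimensional k (TensorAlgebra k V ⧸ nicholsIdeal x g hYD)] {q : Fin n → k}
    (hq : ∀ i, g i (x i) = q i • x i)
    (hdim : n ≤ 2 ∨ ∏ i, orderOf (q i) =
      Module.finrank k (TensorAlgebra k V ⧸ nicholsIdeal x g hYD)) (i j : Fin n) :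
    Commute (g i) (g j) := by
  by_cases hij : i = j
  · rw [hij]
  rcases hdim with hn | hdim
  · -- the vector `g i (x j)` involves `x i` or `x j`, hence `g i * g j` is `g i * g i` or `g j * g i`
    have hne : x.repr (g i (x j)) ≠ 0 := fun h0 =>
      x.ne_zero j ((g i).map_eq_zero_iff.mp (by simpa using h0))
    obtain ⟨l, hl⟩ := Finsupp.ne_iff.mp hne
    have h1 := hYD i j l hl
    have hl' : l = i ∨ l = j := by
      have h2 : (i : ℕ) ≠ j := fun h => hij (Fin.ext h)
      have h3 : (l : ℕ) = i ∨ (l : ℕ) = j := by omega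
      exact h3.imp Fin.ext Fin.ext
    rcases hl' with rfl | rfl
    · rw [mul_left_cancel h1]
    · exact h1.symm
  · -- by the relation for `x j * x i`, the vector `x j` occurs in `g i (x j)`
    obtain ⟨α, β, γ, hrel⟩ := (derivationSystem_isEigen hYD hq).exists_relation hdim hij
    have h1 := (hrel j).1
    rw [derivationSystem_M, if_pos rfl, if_neg (Ne.symm hij), mul_zero, add_zero] at h1
    exact (hYD i j j fun h0 => one_ne_zero (h1.trans (by rw [h0, mul_zero]))).symm

/-- A dimension as small as the orders of the `q_ii` allow forces a quantum linear space. -/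
theorem mul_eq_one_of_dim (hYD : IsYetterDrinfeld x g)
    [FiniteDimensional k (TensorAlgebra k V ⧸ nicholsIdeal x g hYD)] {Q : Fin n → Fin n → k}
    (hQ : ∀ i j, g i (x j) = Q i j • x j)
    (hdim : ∏ i, orderOf (Q i i) =
      Module.finrank k (TensorAlgebra k V ⧸ nicholsIdeal x g hYD)) {i j : Fin n} (hij : i ≠ j) :
    Q i j * Q j i = 1 := by
  have hdiag := derivationSystem_isDiagonal hYD hQ
  obtain ⟨α, β, γ, hrel⟩ := hdiag.isEigen.exists_relation hdim hij
  have h1 := (hrel j).1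
  have h2 := (hrel i).2
  rw [hdiag, if_pos rfl, if_pos rfl, if_neg (Ne.symm hij), mul_zero, add_zero] at h1
  rw [hdiag, if_pos rfl, if_pos rfl, if_neg hij, mul_zero, add_zero, mul_one] at h2
  rw [h2, mul_comm, ← h1]

theorem orderOf_eq_pow [CharZero k] {B : Type*} [Ring B] [Algebra k B] [FiniteDimensional k B]
    {𝒟 : DerivationSystem k B n} {q : Fin n → k} (h : 𝒟.IsEigen q) (hfin : ∀ i, IsOfFinOrder (q i))
    {p : ℕ} (hp : p.Prime) (hdim : Module.finrank k B = p ^ 3) (i : Fin n) :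
    ∃ e, 1 ≤ e ∧ orderOf (q i) = p ^ e := by
  have h1 := h.orderOf_dvd i (hfin i)
  rw [hdim] at h1
  obtain ⟨e, -, he⟩ := (Nat.dvd_prime_pow hp).mp h1
  refine ⟨e, Nat.one_le_iff_ne_zero.mpr ?_, he⟩
  rintro rfl
  exact h.ne_one i (orderOf_eq_one_iff.mp (by simpa using he))

theorem sum_exponents_le [CharZero k] {B : Type*} [Ring B] [Algebra k B] [FiniteDimensional k B]
    {𝒟 : DerivationSystem k B n} {q : Fin n → k} (h : 𝒟.IsEigen q) {p : ℕ} (hp : p.Prime)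
    (hdim : Module.finrank k B = p ^ 3) {e : Fin n → ℕ} (he : ∀ i, orderOf (q i) = p ^ e i) :
    ∑ i, e i ≤ 3 := by
  have h1 := h.prod_orderOf_le
  simp only [he] at h1
  rw [Finset.prod_pow_eq_pow_sum, hdim] at h1
  exact (Nat.pow_le_pow_iff_right hp.one_lt).mp h1

/-- A braided pair of finite group type with Nichols rank `p ^ 3` is diagonal, and its dimension is
at most `3`. -/
theorem exists_diagonal [IsAlgClosed k] [CharZero k] (hc : BraidEquation c)
    (hfin : IsOfFiniteGroupType c) {p : ℕ} (hp : p.Prime) (hrank : nicholsRank c = (p ^ 3 : ℕ)) :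
    ∃ (n : ℕ) (x : Module.Basis (Fin n) k V) (g : Fin n → (V ≃ₗ[k] V)) (Q : Fin n → Fin n → k),
      n ≤ 3 ∧ IsBraidedBasis c x g ∧ (∀ i j, IsOfFinOrder (Q i j)) ∧
      ∀ i j, g i (x j) = Q i j • x j := by
  obtain ⟨n, x₀, g₀, h₀, hΓ⟩ := hfin
  have hN : Nat.card (Subgroup.closure (Set.range g₀)) ≠ 0 := Nat.card_pos.ne'
  have hgN : ∀ i, g₀ i ^ Nat.card (Subgroup.closure (Set.range g₀)) = 1 := by
    intro i
    have := pow_card_eq_one' (x := (⟨g₀ i, Subgroup.subset_closure ⟨i, rfl⟩⟩ :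
      Subgroup.closure (Set.range g₀)))
    exact congrArg Subtype.val this
  obtain ⟨x, g, q, h, hg, hq⟩ := exists_selfEigenbasis hc h₀ hN hgN
  have hYD := isYetterDrinfeld_of_braidEquation hc h
  have := finiteDimensional_quotient h hYD hrank
  have hdim := finrank_quotient h hYD hrank
  have heig := derivationSystem_isEigen hYD hq
  have hqfin : ∀ i, IsOfFinOrder (q i) := fun i =>
    isOfFinOrder_of_eigen hN (hg i) (x.ne_zero i) (hq i)
  choose e he1 he using orderOf_eq_pow heig hqfin hp hdim
  have hsum := sum_exponents_le heig hp hdim he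
  have hn : n ≤ ∑ i, e i := by
    have := Finset.card_nsmul_le_sum Finset.univ e 1 fun i _ => he1 i
    simpa using this
  have hcomm := commute_of_dim hYD hq (by
    by_cases h2 : n ≤ 2
    · exact Or.inl h2
    · right
      simp only [he]
      rw [Finset.prod_pow_eq_pow_sum, hdim]
      congr 1
      omega)
  obtain ⟨y, g', Q, hy, hg', hQ⟩ := exists_diagonalBasis hc h hN hg hcomm
  exact ⟨n, y, g', Q, by omega, hy,
    fun i j => isOfFinOrder_of_eigen hN (hg' i) (y.ne_zero j) (hQ i j), hQ⟩

theorem isOfDiagonalGroupType (h : IsBraidedBasis c x g) {Q : Fin n → Fin n → k}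
    (hQ : ∀ i j, g i (x j) = Q i j • x j) : IsOfDiagonalGroupType c := by
  refine ⟨n, x, g, h, x, fun γ hγ j => ?_⟩
  induction hγ using Subgroup.closure_induction with
  | mem γ hγ =>
    obtain ⟨i, rfl⟩ := hγ
    exact ⟨_, hQ i j⟩
  | one => exact ⟨1, by simp⟩
  | mul γ δ _ _ hγ hδ =>
    obtain ⟨a, ha⟩ := hγ
    obtain ⟨b, hb⟩ := hδ
    exact ⟨b * a, by rw [LinearEquiv.mul_apply, hb, map_smul, ha, smul_smul]⟩
  | inv γ _ hγ =>
    obtain ⟨a, ha⟩ := hγ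
    have ha0 : a ≠ 0 := by
      rintro rfl
      rw [zero_smul] at ha
      exact x.ne_zero j (γ.map_eq_zero_iff.mp ha)
    refine ⟨a⁻¹, γ.injective ?_⟩
    rw [← LinearEquiv.mul_apply, mul_inv_cancel, map_smul, ha, smul_smul, inv_mul_cancel₀ ha0,
      one_smul]
    rfl

/-- A system without generators has dimension one. -/
theorem finrank_le_one_of_isEmpty {B : Type*} [Ring B] [Algebra k B] [FiniteDimensional k B]
    (𝒟 : DerivationSystem k B 0) : Module.finrank k B ≤ 1 := by
  have hinj : Function.Injective 𝒟.ε.toLinearMap := by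
    rw [← LinearMap.ker_eq_bot, LinearMap.ker_eq_bot']
    exact fun b hb => 𝒟.eq_zero b hb fun i => i.elim0
  simpa using LinearMap.finrank_le_finrank_of_injective hinj

/-- An algebra generated by one element `x` with `x ^ m = 0` has dimension at most `m`. -/
theorem finrank_le_of_pow_eq_zero {B : Type*} [Ring B] [Algebra k B]
    (𝒟 : DerivationSystem k B 1) {m : ℕ} (hx : 𝒟.x 0 ^ m = 0) : Module.finrank k B ≤ m := by
  have h := DerivationSystem.finrank_adjoin_singleton_le (k := k) _ _ hx
  have htop := 𝒟.adjoin_x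
  rw [Set.range_unique] at htop
  rwa [show 𝒟.x 0 = 𝒟.x default from rfl, htop, ← Subalgebra.finrank_toSubmodule,
    Algebra.top_toSubmodule, finrank_top] at h

/-- In rank one the Nichols algebra is a truncated polynomial algebra. -/
theorem exists_isNicholsAlgebraIso {x : Module.Basis (Fin 1) k V} {g : Fin 1 → (V ≃ₗ[k] V)}
    (h : IsBraidedBasis c x g) (hYD : IsYetterDrinfeld x g)
    [FiniteDimensional k (TensorAlgebra k V ⧸ nicholsIdeal x g hYD)] {m : ℕ}
    (hdim : Module.finrank k (TensorAlgebra k V ⧸ nicholsIdeal x g hYD) = m)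
    (hpow : (derivationSystem hYD).x 0 ^ m = 0) :
    ∃ φ : TensorAlg k V →ₐ[k] (k[X] ⧸ Ideal.span {(Polynomial.X : k[X]) ^ m}),
      IsNicholsAlgebraIso c φ ∧ φ (ofVector (x 0)) = Ideal.Quotient.mk _ Polynomial.X := by
  set B := TensorAlgebra k V ⧸ nicholsIdeal x g hYD with hB
  set I := Ideal.span {(Polynomial.X : k[X]) ^ m} with hI
  let ev : k[X] →ₐ[k] B := Polynomial.aeval ((derivationSystem hYD).x 0)
  have hev : ∀ P ∈ I, ev P = 0 := by
    intro P hP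
    obtain ⟨R, rfl⟩ := Ideal.mem_span_singleton.mp hP
    simp [ev, hpow]
  let ψ : (k[X] ⧸ I) →ₐ[k] B := Ideal.Quotient.liftₐ I ev hev
  have hψX : ψ (Ideal.Quotient.mk I Polynomial.X) = (derivationSystem hYD).x 0 := by
    change ev Polynomial.X = _
    simp [ev]
  have hsurj : Function.Surjective ψ := by
    rw [← AlgHom.range_eq_top, eq_top_iff, ← (derivationSystem hYD).adjoin_x]
    refine Algebra.adjoin_le ?_
    rintro _ ⟨i, rfl⟩
    obtain rfl : i = 0 := Subsingleton.elim _ _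
    exact ⟨_, hψX⟩
  have hmonic : (Polynomial.X ^ m : k[X]).Monic := Polynomial.monic_X_pow m
  have hfd : FiniteDimensional k (k[X] ⧸ I) := hmonic.finite_quotient
  have hfr : Module.finrank k (k[X] ⧸ I) = Module.finrank k B := by
    rw [hdim, hI, finrank_quotient_span_eq_natDegree, Polynomial.natDegree_X_pow]
  have hbij : Function.Bijective ψ :=
    ⟨(LinearMap.injective_iff_surjective_of_finrank_eq_finrank
      (f := ψ.toLinearMap) hfr).mpr hsurj, hsurj⟩
  let e := AlgEquiv.ofBijective ψ hbij
  let π : TensorAlg k V →ₐ[k] B := (Ideal.Quotient.mkₐ k (nicholsIdeal x g hYD)).comp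
    TensorAlgebra.equivDirectSum.symm.toAlgHom
  have hπ : ∀ a, π a = Ideal.Quotient.mkₐ k (nicholsIdeal x g hYD)
      (TensorAlgebra.equivDirectSum.symm a) := fun a => rfl
  refine ⟨e.symm.toAlgHom.comp π, ⟨?_, fun a => ?_⟩, ?_⟩
  · exact e.symm.surjective.comp ((Ideal.Quotient.mkₐ_surjective k (nicholsIdeal x g hYD)).comp
      TensorAlgebra.equivDirectSum.symm.surjective)
  · change e.symm (π a) = 0 ↔ _
    rw [map_eq_zero_iff _ e.symm.injective, hπ]
    refine (Ideal.Quotient.eq_zero_iff_mem (I := nicholsIdeal x g hYD)).trans ?_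
    have h1 := symmetrizer_eq_zero_iff h (TensorAlgebra.equivDirectSum.symm a)
    rw [AlgEquiv.apply_symm_apply] at h1
    exact h1.symm
  · change e.symm (π (ofVector (x 0))) = _
    rw [AlgEquiv.symm_apply_eq, hπ, ← equivDirectSum_ι, AlgEquiv.symm_apply_apply]
    exact hψX.symm

/-- The Cartan matrix is of type `A₂` as soon as both `ad (x i) (x j)` are nonzero and both
`ad (x i) ^ 2 (x j)` vanish. -/
theorem isTypeA2 {x : Module.Basis (Fin 2) k V} {g : Fin 2 → (V ≃ₗ[k] V)}
    (h : IsBraidedBasis c x g) (hYD : IsYetterDrinfeld x g)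
    (had : ∀ i j, i ≠ j →
      ((derivationSystem hYD).ad i ^ 1) ((derivationSystem hYD).x j) ≠ 0 ∧
      ((derivationSystem hYD).ad i ^ 2) ((derivationSystem hYD).x j) = 0) : IsTypeA2 c x := by
  refine ⟨fun i => by fin_cases i <;> rfl, fun i j hij => ⟨2, ⟨1, rfl, ?_, ?_⟩, ?_⟩⟩
  · rw [Ne, symmetrizer_adj_iterate_eq_zero_iff h hYD]
    exact (had i j hij).1
  · rw [symmetrizer_adj_iterate_eq_zero_iff h hYD]
    exact (had i j hij).2
  · fin_cases i <;> fin_cases j <;> simp_all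

end Classification

end NicholsAlg

theorem mainTheorem2 {k : Type*} [Field k] [IsAlgClosed k] [CharZero k]
    {V : Type*} [AddCommGroup V] [Module k V]
    (c : V ⊗[k] V ≃ₗ[k] V ⊗[k] V) (hc : NicholsAlg.BraidEquation c)
    (hfin : NicholsAlg.IsOfFiniteGroupType c)
    (p : ℕ) (hp : p.Prime) (hrank : NicholsAlg.nicholsRank c = (p ^ 3 : ℕ)) :
    NicholsAlg.IsOfDiagonalGroupType c ∧
    ((∃ (x : Module.Basis (Fin 3) k V) (q : Fin 3 → Fin 3 → kˣ),
        NicholsAlg.HasDiagonalBraiding c x q ∧ NicholsAlg.IsQLSMatrix q ∧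
        ∀ i, NicholsAlg.N (q i i) = (p : ℕ)) ∨
     (∃ (x : Module.Basis (Fin 2) k V) (q : Fin 2 → Fin 2 → kˣ),
        NicholsAlg.HasDiagonalBraiding c x q ∧ NicholsAlg.IsQLSMatrix q ∧
        NicholsAlg.N (q 0 0) = (p : ℕ) ∧ NicholsAlg.N (q 1 1) = (p ^ 2 : ℕ)) ∨
     (∃ (x : Module.Basis (Fin 2) k V) (q : Fin 2 → Fin 2 → kˣ),
        NicholsAlg.HasDiagonalBraiding c x q ∧ NicholsAlg.IsTypeA2 c x ∧
        q 0 0 = (q 0 1 * q 1 0)⁻¹ ∧ q 1 1 = (q 0 1 * q 1 0)⁻¹ ∧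
        NicholsAlg.N (q 0 0) = (p : ℕ)) ∨
     (∃ (x : Module.Basis (Fin 1) k V) (q : Fin 1 → Fin 1 → kˣ),
        NicholsAlg.HasDiagonalBraiding c x q ∧ NicholsAlg.IsQLSMatrix q ∧
        NicholsAlg.N (q 0 0) = (p ^ 3 : ℕ) ∧
        ∃ φ : NicholsAlg.TensorAlg k V →ₐ[k]
            (k[X] ⧸ Ideal.span {(Polynomial.X : k[X]) ^ (p ^ 3)}),
          NicholsAlg.IsNicholsAlgebraIso c φ ∧
          φ (NicholsAlg.ofVector (x 0)) = Ideal.Quotient.mk _ Polynomial.X)) := by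
  open NicholsAlg in
  obtain ⟨n, x, g, Q, hn, h, hfinQ, hQ⟩ := exists_diagonal hc hfin hp hrank
  refine ⟨isOfDiagonalGroupType h hQ, ?_⟩
  have hYD := isYetterDrinfeld_of_braidEquation hc h
  have := finiteDimensional_quotient h hYD hrank
  have hdim := finrank_quotient h hYD hrank
  have hdiag := derivationSystem_isDiagonal hYD hQ
  have heig := hdiag.isEigen
  choose e he1 he using orderOf_eq_pow heig (fun i => hfinQ i i) hp hdim
  have hsum := sum_exponents_le heig hp hdim he
  let q : Fin n → Fin n → kˣ := fun i j => Units.mk0 (Q i j) (by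
    obtain ⟨m, hm, h1⟩ := isOfFinOrder_iff_pow_eq_one.mp (hfinQ i j)
    rintro h0
    rw [h0, zero_pow hm.ne'] at h1
    exact zero_ne_one h1)
  have hbr : HasDiagonalBraiding c x q := fun i j => by
    rw [h i j, hQ, TensorProduct.smul_tmul']
    rfl
  have hN : ∀ i, N (q i i) = (p ^ e i : ℕ) := fun i =>
    N_eq_of_orderOf (he i) (pow_pos hp.pos _).ne'
      (Nat.one_lt_pow (Nat.one_le_iff_ne_zero.mp (he1 i)) hp.one_lt).ne'
  have hqls : ∑ i, e i = 3 → IsQLSMatrix q := fun h3 i j hij => Units.ext (by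
    refine mul_eq_one_of_dim hYD hQ ?_ hij
    simp only [he]
    rw [Finset.prod_pow_eq_pow_sum, hdim, h3])
  have hqQ : ∀ i j, (q i j : k) = Q i j := fun _ _ => rfl
  clear_value q
  -- the exponents `e i ≥ 1` have sum at most `3`
  interval_cases n
  · exfalso
    have h1 := finrank_le_one_of_isEmpty (derivationSystem hYD)
    rw [hdim] at h1
    exact absurd (Nat.one_lt_pow (by norm_num : 3 ≠ 0) hp.one_lt) (not_lt.mpr h1)
  · have h0 : orderOf (Q 0 0) ≠ 0 := by
      rw [he 0]
      exact (pow_pos hp.pos _).ne'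
    have hx := heig.x_pow_eq_zero 0 (heig.ne_one 0) h0
    have h1 : p ^ 3 ≤ p ^ e 0 := by
      rw [← hdim, ← he 0]
      exact finrank_le_of_pow_eq_zero (derivationSystem hYD) hx
    have h2 := (Nat.pow_le_pow_iff_right hp.one_lt).mp h1
    rw [Fin.sum_univ_one] at hsum
    have h3 : e 0 = 3 := by omega
    refine Or.inr (Or.inr (Or.inr ⟨x, q, hbr, hqls (by rw [Fin.sum_univ_one, h3]), ?_, ?_⟩))
    · rw [hN 0, h3]
    · refine exists_isNicholsAlgebraIso h hYD hdim ?_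
      rw [he 0, h3] at hx
      exact hx
  · rw [Fin.sum_univ_two] at hsum
    have he0 := he1 0
    have he1' := he1 1
    have hcases : (e 0 = 1 ∧ e 1 = 1) ∨ (e 0 = 1 ∧ e 1 = 2) ∨ (e 0 = 2 ∧ e 1 = 1) := by omega
    rcases hcases with ⟨h0, h1⟩ | ⟨h0, h1⟩ | ⟨h0, h1⟩
    · -- the bound on the dimension is not attained, and `ad (x 0) (x 1)` is a third root vector
      have hord : ∀ i, orderOf (Q i i) = p := by
        intro i
        fin_cases i
        · exact (he 0).trans (by rw [h0, pow_one])
        · exact (he 1).trans (by rw [h1, pow_one])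
      have huniv : ∀ i j : Fin 2, i ≠ j → ∀ l, l = i ∨ l = j := by
        intro i j hij l
        omega
      have hr : ∀ i j : Fin 2, i ≠ j → q i i = (q i j * q j i)⁻¹ := fun i j hij =>
        eq_inv_of_mul_eq_one_left (Units.ext (by
          simpa only [Units.val_mul, Units.val_one, hqQ] using hdiag.rank_two_matrix hfinQ hij
            (huniv i j hij) hp (hord i) (hord j) hdim))
      refine Or.inr (Or.inr (Or.inl ⟨x, q, hbr, isTypeA2 h hYD fun i j hij => ?_,
        hr 0 1 Fin.zero_ne_one, ?_, ?_⟩))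
      · have r := hdiag.rank_two hfinQ hij (huniv i j hij) hp (hord i) (hord j) hdim
        exact ⟨r.1, r.2.1⟩
      · rw [mul_comm]
        exact hr 1 0 Fin.zero_ne_one.symm
      · rw [hN 0, h0, pow_one]
    · refine Or.inr (Or.inl ⟨x, q, hbr, hqls (by rw [Fin.sum_univ_two, h0, h1]), ?_, ?_⟩)
      · rw [hN 0, h0, pow_one]
      · rw [hN 1, h1]
    · -- the same with the two basis vectors exchanged
      refine Or.inr (Or.inl ⟨x.reindex (Equiv.swap 0 1), fun i j => q (Equiv.swap 0 1 i)
        (Equiv.swap 0 1 j), fun i j => ?_, fun i j hij => ?_, ?_, ?_⟩)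
      · simpa using hbr (Equiv.swap 0 1 i) (Equiv.swap 0 1 j)
      · exact hqls (by rw [Fin.sum_univ_two, h0, h1]) _ _ ((Equiv.swap 0 1).injective.ne hij)
      · simpa [h1] using hN 1
      · simpa [h0] using hN 0
  · rw [Fin.sum_univ_three] at hsum
    have he0 := he1 0
    have he1' := he1 1
    have he2 := he1 2
    refine Or.inl ⟨x, q, hbr, hqls (by rw [Fin.sum_univ_three]; omega), fun i => ?_⟩
    rw [hN i]
    have : e i = 1 := by
      fin_cases i
      · change e 0 = 1
        omega
      · change e 1 = 1
        omega
      · change e 2 = 1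
        omega
    rw [this, pow_one]
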